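/- **Conventions.** All rings are commutative with unit, and $\mathbb{R}^+$ is the multiplicative group of positive real numbers. A *Banach ring* is a ring, complete for a norm with $|x+y|\le\max\{|x|,|y|\}$, $|-x|=|x|$ and $|xy|\le|x||y|$. For such a ring $A$ and $r\in\mathbb{R}^+$, let $A^{\circ,r}$ (resp. $A^{\circ\circ,r}$) be the set of $a\in A$ for which the sequence $r^{-n}|a^n|$ $(n\ge 1)$ is bounded (resp. tends to $0$), and let $\operatorname{Gr}A=\bigoplus_{r>0}A^{\circ,r}/A^{\circ\circ,r}$. An *affinoid Banach ring* is a pair $(A^{\rhd},A^{\mathrm{Gr}})$ of a Banach ring $A^{\rhd}$ and a graded subring $A^{\mathrm{Gr}}$ of $\operatorname{Gr}A^{\rhd}$ that is integrally closed in $\operatorname{Gr}A^{\rhd}$; $A^{+,r}\subseteq A^{\rhd,\circ,r}$ is the preimage of the degree-$r$ part of $A^{\mathrm{Gr}}$. A *morphism* of such pairs is a ring homomorphism $\varphi$ with $|\varphi(a)|\le c|a|$ for some constant $c>0$, carrying $A^{+,r}$ into $B^{+,r}$ for all $r$. A *reified semivaluation* on a ring is a map $v$ to $\Gamma\cup\{0\}$,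 where $\Gamma$ is a totally ordered abelian group (written multiplicatively, with $0$ smaller than all of $\Gamma$) equipped with a strictly increasing homomorphism $\mathbb{R}^+\to\Gamma$ (suppressed in the notation), such that $v(0)=0$, $v(1)=1$, $v(xy)=v(x)v(y)$ and $v(x+y)\le\max\{v(x),v(y)\}$. Let $\Gamma_v\subseteq\Gamma$ be the subgroup generated by $\mathbb{R}^+$ and the nonzero values of $v$. Two reified semivaluations $v,w$ are equivalent if there is an isomorphism $\Gamma_v\cong\Gamma_w$ of ordered groups compatible with the maps from $\mathbb{R}^+$ and carrying $v$ to $w$. Let $X=\operatorname{Spra}(A^{\rhd},A^{\mathrm{Gr}})$ be the set of equivalence classes of reified semivaluations $v$ on $A^{\rhd}$ such that $v(a)\le r$ for all $r\in\mathbb{R}^+$ and all $a\in A^{\rhd,\circ\circ,r}\cup A^{+,r}$, and such that every $\gamma\in\Gamma_v$ satisfies $\gamma\ge r$ for some $r\in\mathbb{R}^+$; its topology is generated by the sets $\{v: v(a)\le q\,v(b)\ne 0\}$ for $a,b\in A^{\rhd}$ and $q\in\mathbb{R}^+$. A *rational subspace* of $X$ is a set of the form $$U=\{v\in X: v(f_i)\le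 q_i v(f_0)\ne 0\ \ (i=1,\dots,n)\}$$ with $f_0,\dots,f_n\in A^{\rhd}$ such that $f_1,\dots,f_n$ generate the unit ideal, and $q_1,\dots,q_n\in\mathbb{R}^+$ arbitrary. The *rational localization* defined by these parameters is $(A^{\rhd},A^{\mathrm{Gr}})\to(B^{\rhd},B^{\mathrm{Gr}})$, where $B^{\rhd}$ is the quotient, by the closure of the ideal $(f_0T_1-f_1,\dots,f_0T_n-f_n)$, of the completion of $A^{\rhd}[T_1,\dots,T_n]$ for the weighted Gauss norm $\sum a_{i_1\cdots i_n}T_1^{i_1}\cdots T_n^{i_n}\mapsto\max|a_{i_1\cdots i_n}|q_1^{i_1}\cdots q_n^{i_n}$, and $B^{\mathrm{Gr}}$ is the integral closure in $\operatorname{Gr}B^{\rhd}$ of the image of $A^{\mathrm{Gr}}[T_1,\dots,T_n]$, with $T_i$ in degree $q_i$. The *structure presheaf* $\mathcal{O}$ on $X$ assigns to an open subset $V$ the inverse limit of the rings $B^{\rhd}$ over all rational localizations defining rational subspaces contained in $V$, the transition maps being the morphisms under $(A^{\rhd},A^{\mathrm{Gr}})$. The pair $(A^{\rhd},A^{\mathrm{Gr}})$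 is *sheafy* if $\mathcal{O}$ is a sheaf. **Theorem.** Let $(A^{\rhd},A^{\mathrm{Gr}})$ be a sheafy affinoid Banach ring and let $X=\operatorname{Spra}(A^{\rhd},A^{\mathrm{Gr}})$. Then for every finite covering $\mathfrak{U}$ of $X$ by rational subspaces, $$H^i(X,\mathcal{O})=\check{H}^i(X,\mathcal{O};\mathfrak{U})=\begin{cases}A^{\rhd}&\text{if } i=0,\\ 0&\text{if } i>0,\end{cases}$$ where the identifications for $i=0$ are induced by the canonical homomorphism $A^{\rhd}\to\mathcal{O}(X)$, $H^i$ is sheaf cohomology on the topological space $X$, and $\check{H}^i(X,\mathcal{O};\mathfrak{U})$ is the cohomology of the Čech complex of $\mathfrak{U}$. -/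

import Mathlib

universe u w

open CategoryTheory TopologicalSpace Filter Topology

namespace Readic

/-! ### Reified semivaluations and the reified valuative spectrum -/

/-- The multiplicative group of positive real numbers. -/
abbrev PosReal : Type := {r : ℝ // 0 < r}

/-- A reified semivaluation on `A`: a semivaluation `val : A → Γ₀` with values in `Γ₀ = Γ ∪ {0}`,
`Γ` a totally ordered abelian group, with an order embedding of the positive reals into `Γ`. -/
structure ReifiedSemivaluation (A : Type u) [CommRing A] where
  /-- the value group together with zero -/
  Γ₀ : Type u
  [inst : LinearOrderedCommGroupWithZero Γ₀]
  /-- the underlying semivaluation -/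
  val : Valuation A Γ₀
  /-- the reification -/
  reif : PosReal →* Γ₀
  reif_strictMono : StrictMono reif

attribute [instance] ReifiedSemivaluation.inst

namespace ReifiedSemivaluation

variable {A : Type u} [CommRing A] (v w : ReifiedSemivaluation A)

/-- The group `Γ_v`: the subgroup of the value group generated by the image of the positive reals
and by the nonzero values of `v`. -/
def valueGroup : Subgroup v.Γ₀ˣ :=
  Subgroup.closure {γ | (∃ r, (γ : v.Γ₀) = v.reif r) ∨ ∃ a, (γ : v.Γ₀) = v.val a}

/-- Equivalence of reified semivaluations: an isomorphism `Γ_v ≃ Γ_w` of ordered groups which is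
compatible with the reifications and carries `v` to `w`. -/
def Equivalent : Prop :=
  ∃ i : v.valueGroup ≃* w.valueGroup,
    (∀ x y, i x ≤ i y ↔ x ≤ y) ∧
    (∀ (r : PosReal) (x : v.valueGroup), ((x : v.Γ₀ˣ) : v.Γ₀) = v.reif r →
      ((i x : w.Γ₀ˣ) : w.Γ₀) = w.reif r) ∧
    (∀ a, v.val a = 0 ↔ w.val a = 0) ∧
    (∀ (a : A) (x : v.valueGroup), ((x : v.Γ₀ˣ) : v.Γ₀) = v.val a →
      ((i x : w.Γ₀ˣ) : w.Γ₀) = w.val a)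

/-- The order relation of a reified semivaluation: `v.rel a q b` means `v(a) ≤ q v(b)`. -/
def rel (a : A) (q : PosReal) (b : A) : Prop := v.val a ≤ v.reif q * v.val b

theorem reif_ne_zero (r : PosReal) : v.reif r ≠ 0 := fun h => by
  have h2 := v.reif.map_mul r r⁻¹
  simp [h] at h2

theorem equivalent_iff : v.Equivalent w ↔ v.rel = w.rel := by
  constructor
  · rintro ⟨i, hle, hr, h0, hv⟩
    funext a q b
    have key : ∀ (v : ReifiedSemivaluation A) (a : A) (h : v.val a ≠ 0),
        Units.mk0 (v.val a) h ∈ v.valueGroup := fun v a h =>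
      Subgroup.subset_closure (Or.inr ⟨a, rfl⟩)
    have keyr : ∀ (v : ReifiedSemivaluation A) (q : PosReal),
        Units.mk0 (v.reif q) (v.reif_ne_zero q) ∈ v.valueGroup := fun v q =>
      Subgroup.subset_closure (Or.inl ⟨q, rfl⟩)
    apply propext
    unfold rel
    by_cases ha : v.val a = 0
    · simp [ha, (h0 a).1 ha]
    have ha' : w.val a ≠ 0 := fun h => ha ((h0 a).2 h)
    by_cases hb : v.val b = 0
    · simp [hb, (h0 b).1 hb, ha, ha']
    have hb' : w.val b ≠ 0 := fun h => hb ((h0 b).2 h)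
    have e := hle ⟨_, key v a ha⟩ (⟨_, keyr v q⟩ * ⟨_, key v b hb⟩)
    have e1 := hv a ⟨_, key v a ha⟩ rfl
    have e2 := hv b ⟨_, key v b hb⟩ rfl
    have e3 := hr q ⟨_, keyr v q⟩ rfl
    rw [map_mul, ← Subtype.coe_le_coe, ← Subtype.coe_le_coe, ← Units.val_le_val,
      ← Units.val_le_val] at e
    simp only [Subgroup.coe_mul, Units.val_mul, e1, e2, e3, Units.val_mk0] at e
    exact e.symm
  · intro h
    have hrel : ∀ a q b, v.val a ≤ v.reif q * v.val b ↔ w.val a ≤ w.reif q * w.val b :=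
      fun a q b => iff_of_eq (congrFun (congrFun (congrFun h a) q) b)
    have h0 : ∀ a, v.val a = 0 ↔ w.val a = 0 := fun a => by
      simpa using hrel a 1 0
    -- the graph of the isomorphism
    let G : Subgroup (v.Γ₀ˣ × w.Γ₀ˣ) := Subgroup.closure
      {p | (∃ r, (p.1 : v.Γ₀) = v.reif r ∧ (p.2 : w.Γ₀) = w.reif r) ∨
        ∃ a, (p.1 : v.Γ₀) = v.val a ∧ (p.2 : w.Γ₀) = w.val a}
    have hG : ∀ p ∈ G, ∃ a q b, v.val a ≠ 0 ∧ v.val b ≠ 0 ∧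
        (p.1 : v.Γ₀) * v.val b = v.reif q * v.val a ∧
        (p.2 : w.Γ₀) * w.val b = w.reif q * w.val a := by
      intro p hp
      induction hp using Subgroup.closure_induction with
      | mem p hp =>
        rcases hp with ⟨r, h1, h2⟩ | ⟨a, h1, h2⟩
        · exact ⟨1, r, 1, by simp, by simp, by simp [h1], by simp [h2]⟩
        · exact ⟨a, 1, 1, by simp [← h1], by simp, by simp [h1], by simp [h2]⟩
      | one => exact ⟨1, 1, 1, by simp⟩
      | mul p p' _ _ hp hp' =>
        obtain ⟨a, q, b, h1, h2, h3, h4⟩ := hp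
        obtain ⟨a', q', b', h1', h2', h3', h4'⟩ := hp'
        refine ⟨a * a', q * q', b * b', by simp [h1, h1'], by simp [h2, h2'], ?_, ?_⟩
        · simp only [Prod.fst_mul, Units.val_mul, map_mul]
          rw [mul_mul_mul_comm, h3, h3', mul_mul_mul_comm]
        · simp only [Prod.snd_mul, Units.val_mul, map_mul]
          rw [mul_mul_mul_comm, h4, h4', mul_mul_mul_comm]
      | inv p _ hp =>
        obtain ⟨a, q, b, h1, h2, h3, h4⟩ := hp
        have hq : ∀ v : ReifiedSemivaluation A, v.reif q⁻¹ * v.reif q = 1 := fun v => by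
          rw [← map_mul]; simp
        refine ⟨b, q⁻¹, a, h2, h1, ?_, ?_⟩
        · have : v.val a = v.reif q⁻¹ * (p.1 * v.val b) := by
            rw [h3, ← mul_assoc, hq, one_mul]
          rw [this, Prod.fst_inv, mul_left_comm, Units.inv_mul_cancel_left]
        · have : w.val a = w.reif q⁻¹ * (p.2 * w.val b) := by
            rw [h4, ← mul_assoc, hq, one_mul]
          rw [this, Prod.snd_inv, mul_left_comm, Units.inv_mul_cancel_left]
    have hle : ∀ p ∈ G, 1 ≤ p.1 ↔ 1 ≤ p.2 := by
      intro p hp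
      obtain ⟨a, q, b, h1, h2, h3, h4⟩ := hG p hp
      have h2' : w.val b ≠ 0 := fun h => h2 ((h0 b).2 h)
      have e := hrel b q a
      rw [← h3, ← h4] at e
      rw [le_mul_iff_one_le_left (zero_lt_iff.2 h2),
        le_mul_iff_one_le_left (zero_lt_iff.2 h2')] at e
      exact_mod_cast e
    have hle' : ∀ p ∈ G, p.1 ≤ 1 ↔ p.2 ≤ 1 := by
      intro p hp
      have := hle p⁻¹ (inv_mem hp)
      simpa using this
    have heq : ∀ p ∈ G, p.1 = 1 ↔ p.2 = 1 := by
      intro p hp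
      rw [le_antisymm_iff, le_antisymm_iff, hle p hp, hle' p hp]
    have hfst : G.map (MonoidHom.fst _ _) = v.valueGroup := by
      rw [MonoidHom.map_closure]
      congr 1
      ext γ
      simp only [Set.mem_image, Set.mem_ofPred_eq, MonoidHom.coe_fst, Prod.exists,
        exists_and_right, exists_eq_right]
      constructor
      · rintro ⟨δ, ⟨r, h1, _⟩ | ⟨a, h1, _⟩⟩
        exacts [Or.inl ⟨r, h1⟩, Or.inr ⟨a, h1⟩]
      · rintro (⟨r, h1⟩ | ⟨a, h1⟩)
        · exact ⟨Units.mk0 _ (w.reif_ne_zero r), Or.inl ⟨r, h1, rfl⟩⟩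
        · have : w.val a ≠ 0 := fun h => γ.ne_zero (h1.trans ((h0 a).2 h))
          exact ⟨Units.mk0 _ this, Or.inr ⟨a, h1, rfl⟩⟩
    have hsnd : G.map (MonoidHom.snd _ _) = w.valueGroup := by
      rw [MonoidHom.map_closure]
      congr 1
      ext γ
      simp only [Set.mem_image, Set.mem_ofPred_eq, MonoidHom.coe_snd, Prod.exists,
        exists_eq_right]
      constructor
      · rintro ⟨δ, ⟨r, _, h1⟩ | ⟨a, _, h1⟩⟩
        exacts [Or.inl ⟨r, h1⟩, Or.inr ⟨a, h1⟩]
      · rintro (⟨r, h1⟩ | ⟨a, h1⟩)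
        · exact ⟨Units.mk0 _ (v.reif_ne_zero r), Or.inl ⟨r, rfl, h1⟩⟩
        · have : v.val a ≠ 0 := fun h => γ.ne_zero (h1.trans ((h0 a).1 h))
          exact ⟨Units.mk0 _ this, Or.inr ⟨a, rfl, h1⟩⟩
    let f : G →* v.valueGroup := ((MonoidHom.fst _ _).comp G.subtype).codRestrict _
      (fun p => hfst ▸ Subgroup.mem_map_of_mem _ p.2)
    let g : G →* w.valueGroup := ((MonoidHom.snd _ _).comp G.subtype).codRestrict _
      (fun p => hsnd ▸ Subgroup.mem_map_of_mem _ p.2)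
    have hf : Function.Bijective f := by
      constructor
      · rw [injective_iff_map_eq_one]
        intro p hp
        have h1 : p.1.1 = 1 := congrArg Subtype.val hp
        exact Subtype.ext (Prod.ext h1 ((heq _ p.2).1 h1))
      · rintro ⟨γ, hγ⟩
        rw [← hfst] at hγ
        obtain ⟨p, hp, rfl⟩ := hγ
        exact ⟨⟨p, hp⟩, rfl⟩
    have hg : Function.Bijective g := by
      constructor
      · rw [injective_iff_map_eq_one]
        intro p hp
        have h1 : p.1.2 = 1 := congrArg Subtype.val hp
        exact Subtype.ext (Prod.ext ((heq _ p.2).2 h1) h1)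
      · rintro ⟨γ, hγ⟩
        rw [← hsnd] at hγ
        obtain ⟨p, hp, rfl⟩ := hγ
        exact ⟨⟨p, hp⟩, rfl⟩
    let i := (MulEquiv.ofBijective f hf).symm.trans (MulEquiv.ofBijective g hg)
    have hi : ∀ p : G, i (f p) = g p := fun p => by
      change g ((MulEquiv.ofBijective f hf).symm ((MulEquiv.ofBijective f hf) p)) = g p
      rw [MulEquiv.symm_apply_apply]
    refine ⟨i, ?_, ?_, h0, ?_⟩
    · intro x y
      obtain ⟨p, rfl⟩ := hf.2 x
      obtain ⟨p', rfl⟩ := hf.2 y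
      rw [hi, hi]
      have := hle' (p.1 / p'.1) (div_mem p.2 p'.2)
      rw [Prod.fst_div, Prod.snd_div, div_le_one', div_le_one'] at this
      exact this.symm
    · intro r x hx
      have hm : ((x : v.Γ₀ˣ), Units.mk0 _ (w.reif_ne_zero r)) ∈ G :=
        Subgroup.subset_closure (Or.inl ⟨r, hx, rfl⟩)
      have := hi ⟨_, hm⟩
      have hx' : f ⟨_, hm⟩ = x := rfl
      rw [hx'] at this
      rw [this]
      rfl
    · intro a x hx
      have hne : w.val a ≠ 0 := fun h => (x : v.Γ₀ˣ).ne_zero (hx.trans ((h0 a).2 h))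
      have hm : ((x : v.Γ₀ˣ), Units.mk0 _ hne) ∈ G :=
        Subgroup.subset_closure (Or.inr ⟨a, hx, rfl⟩)
      have := hi ⟨_, hm⟩
      have hx' : f ⟨_, hm⟩ = x := rfl
      rw [hx'] at this
      rw [this]
      rfl

end ReifiedSemivaluation

/-- The reified valuative spectrum of `A`: the set of equivalence classes of reified semivaluations
on `A`, each class being given by the order relation common to its members
(by `equivalent_iff`, two reified semivaluations are equivalent iff these relations agree). -/
def Sprv (A : Type u) [CommRing A] : Type u :=
  {R : A → PosReal → A → Prop // ∃ v : ReifiedSemivaluation A, v.rel = R}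

/-- A reified semivaluation in the given equivalence class. -/
noncomputable def Sprv.rep {A : Type u} [CommRing A] (x : Sprv A) : ReifiedSemivaluation A :=
  x.2.choose

theorem Sprv.rep_rel {A : Type u} [CommRing A] (x : Sprv A) : x.rep.rel = x.1 :=
  x.2.choose_spec

/-- The class of a reified semivaluation. -/
def ReifiedSemivaluation.toSprv {A : Type u} [CommRing A] (v : ReifiedSemivaluation A) : Sprv A :=
  ⟨v.rel, v, rfl⟩

/-- The topology of `Sprv A` is generated by the sets `{v | v(a) ≤ q v(b) ≠ 0}`. -/
instance (A : Type u) [CommRing A] : TopologicalSpace (Sprv A) :=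
  TopologicalSpace.generateFrom {s | ∃ (a b : A) (q : PosReal),
    s = {x : Sprv A | x.rep.val a ≤ x.rep.reif q * x.rep.val b ∧ x.rep.val b ≠ 0}}

/-! ### The graded ring of a nonarchimedean seminormed ring -/

section Graded

variable {A : Type u} [SeminormedCommRing A]

/-- `A^{∘,r}` is the set of all `a` for which the sequence `r⁻ⁿ |aⁿ|`, `n ≥ 1`, is bounded. -/
def IsPowerBounded (r : PosReal) (a : A) : Prop :=
  ∃ C : ℝ, ∀ n : ℕ, 1 ≤ n → ‖a ^ n‖ / (r : ℝ) ^ n ≤ C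

/-- `A^{∘∘,r}` is the set of all `a` for which the sequence `r⁻ⁿ |aⁿ|` converges to `0`. -/
def IsTopNilpotent (r : PosReal) (a : A) : Prop :=
  Tendsto (fun n : ℕ => ‖a ^ n‖ / (r : ℝ) ^ n) atTop (𝓝 0)

theorem IsPowerBounded.exists_bound {r : PosReal} {a : A} (h : IsPowerBounded r a) :
    ∃ C : ℝ, 1 ≤ C ∧ ∀ n : ℕ, ‖a ^ n‖ / (r : ℝ) ^ n ≤ C := by
  obtain ⟨C, hC⟩ := h
  refine ⟨max 1 (max C ‖(1 : A)‖), le_max_left _ _, fun n => ?_⟩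
  rcases Nat.eq_zero_or_pos n with rfl | hn
  · simp
  · exact (hC n hn).trans ((le_max_left _ _).trans (le_max_right _ _))

theorem IsTopNilpotent.isPowerBounded {r : PosReal} {a : A} (h : IsTopNilpotent r a) :
    IsPowerBounded r a := by
  obtain ⟨C, hC⟩ := h.bddAbove_range
  exact ⟨C, fun n _ => hC ⟨n, rfl⟩⟩

theorem isTopNilpotent_zero (r : PosReal) : IsTopNilpotent r (0 : A) := by
  refine tendsto_const_nhds.congr' ?_
  filter_upwards [eventually_ge_atTop 1] with n hn
  simp [zero_pow (Nat.one_le_iff_ne_zero.1 hn)]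

theorem isPowerBounded_one : IsPowerBounded 1 (1 : A) := ⟨‖(1 : A)‖, fun n _ => by simp⟩

theorem norm_mul_pow_div_le (r s : PosReal) (a b : A) (n : ℕ) :
    ‖(a * b) ^ n‖ / ((r * s : PosReal) : ℝ) ^ n ≤
      (‖a ^ n‖ / (r : ℝ) ^ n) * (‖b ^ n‖ / (s : ℝ) ^ n) := by
  have := r.2
  have := s.2
  rw [mul_pow, Positive.val_mul, mul_pow, div_mul_div_comm]
  gcongr
  exact norm_mul_le _ _

theorem div_pow_nonneg (r : PosReal) (a : A) (n : ℕ) : 0 ≤ ‖a ^ n‖ / (r : ℝ) ^ n := by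
  have := r.2
  positivity

theorem IsPowerBounded.mul {r s : PosReal} {a b : A} (ha : IsPowerBounded r a)
    (hb : IsPowerBounded s b) : IsPowerBounded (r * s) (a * b) := by
  obtain ⟨C, h1, hC⟩ := ha.exists_bound
  obtain ⟨D, h2, hD⟩ := hb.exists_bound
  refine ⟨C * D, fun n _ => (norm_mul_pow_div_le r s a b n).trans ?_⟩
  exact mul_le_mul (hC n) (hD n) (div_pow_nonneg _ _ _) (by linarith)

theorem IsPowerBounded.mul_isTopNilpotent {r s : PosReal} {a b : A} (ha : IsPowerBounded r a)
    (hb : IsTopNilpotent s b) : IsTopNilpotent (r * s) (a * b) := by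
  obtain ⟨C, h1, hC⟩ := ha.exists_bound
  have h := hb.const_mul C
  rw [mul_zero] at h
  refine squeeze_zero (fun n => div_pow_nonneg _ _ _) (fun n => ?_) h
  exact (norm_mul_pow_div_le r s a b n).trans
    (mul_le_mul_of_nonneg_right (hC n) (div_pow_nonneg _ _ _))

theorem norm_neg_pow (a : A) (n : ℕ) : ‖(-a) ^ n‖ = ‖a ^ n‖ := by
  rw [neg_pow]
  rcases neg_one_pow_eq_or A n with h | h <;> simp [h]

variable [IsUltrametricDist A]

theorem norm_add_pow_div_le (r : PosReal) (a b : A) (n : ℕ) : ∃ k ≤ n,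
    ‖(a + b) ^ n‖ / (r : ℝ) ^ n ≤
      (‖a ^ k‖ / (r : ℝ) ^ k) * (‖b ^ (n - k)‖ / (r : ℝ) ^ (n - k)) := by
  have hr := r.2
  rw [add_pow]
  obtain ⟨k, hk, h⟩ := IsUltrametricDist.exists_norm_finsetSum_le_of_nonempty
    (t := Finset.range (n + 1)) ⟨0, by simp⟩
    (fun k => a ^ k * b ^ (n - k) * ((n.choose k : ℕ) : A))
  have hk' : k ≤ n := by simpa [Nat.lt_succ_iff] using hk
  refine ⟨k, hk', ?_⟩
  rw [div_mul_div_comm, ← pow_add, Nat.add_sub_cancel' hk']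
  gcongr
  refine h.trans ?_
  rw [mul_comm, ← nsmul_eq_mul]
  exact (IsUltrametricDist.norm_nsmul_le _ _).trans (norm_mul_le _ _)

theorem IsPowerBounded.add {r : PosReal} {a b : A} (ha : IsPowerBounded r a)
    (hb : IsPowerBounded r b) : IsPowerBounded r (a + b) := by
  obtain ⟨C, h1, hC⟩ := ha.exists_bound
  obtain ⟨D, h2, hD⟩ := hb.exists_bound
  refine ⟨C * D, fun n _ => ?_⟩
  obtain ⟨k, _, h⟩ := norm_add_pow_div_le r a b n
  exact h.trans (mul_le_mul (hC _) (hD _) (div_pow_nonneg _ _ _) (by linarith))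

theorem IsTopNilpotent.add {r : PosReal} {a b : A} (ha : IsTopNilpotent r a)
    (hb : IsTopNilpotent r b) : IsTopNilpotent r (a + b) := by
  obtain ⟨C, h1, hC⟩ := ha.isPowerBounded.exists_bound
  obtain ⟨D, h2, hD⟩ := hb.isPowerBounded.exists_bound
  unfold IsTopNilpotent at *
  rw [Metric.tendsto_atTop] at *
  intro ε hε
  obtain ⟨N, hN⟩ := ha (ε / D) (by positivity)
  obtain ⟨M, hM⟩ := hb (ε / C) (by positivity)
  refine ⟨N + M, fun n hn => ?_⟩
  obtain ⟨k, hk, h⟩ := norm_add_pow_div_le r a b n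
  simp only [dist_zero_right, Real.norm_eq_abs, abs_of_nonneg (div_pow_nonneg _ _ _)] at *
  refine h.trans_lt ?_
  by_cases hkN : N ≤ k
  · calc _ ≤ (‖a ^ k‖ / (r : ℝ) ^ k) * D :=
          mul_le_mul_of_nonneg_left (hD _) (div_pow_nonneg _ _ _)
      _ < ε / D * D := mul_lt_mul_of_pos_right (hN k hkN) (by linarith)
      _ = ε := div_mul_cancel₀ _ (by linarith)
  · calc _ ≤ C * (‖b ^ (n - k)‖ / (r : ℝ) ^ (n - k)) :=
          mul_le_mul_of_nonneg_right (hC _) (div_pow_nonneg _ _ _)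
      _ < C * (ε / C) := mul_lt_mul_of_pos_left (hM _ (by omega)) (by linarith)
      _ = ε := mul_div_cancel₀ _ (by linarith)

variable (A) in
/-- The additive group `A^{∘,r}`. -/
def powerBounded (r : PosReal) : AddSubgroup A where
  carrier := {a | IsPowerBounded r a}
  zero_mem' := (isTopNilpotent_zero r).isPowerBounded
  neg_mem' := by
    rintro a ⟨C, hC⟩
    exact ⟨C, fun n hn => by rw [norm_neg_pow]; exact hC n hn⟩
  add_mem' := IsPowerBounded.add

variable (A) in
/-- The additive group `A^{∘∘,r}`. -/
def topNilpotent (r : PosReal) : AddSubgroup A where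
  carrier := {a | IsTopNilpotent r a}
  zero_mem' := isTopNilpotent_zero r
  neg_mem' := by
    intro a ha
    change Tendsto _ _ _
    simp_rw [norm_neg_pow]
    exact ha
  add_mem' := IsTopNilpotent.add

variable (A) in
/-- The direct sum `⨁_r A^{∘,r}`, as a subring of the group ring of the positive reals. -/
def grPre : Subring (MonoidAlgebra A PosReal) where
  carrier := {x | ∀ r, x.coeff r ∈ powerBounded A r}
  zero_mem' r := by simp
  one_mem' r := by
    classical
    rw [MonoidAlgebra.one_def, MonoidAlgebra.coeff_single, Finsupp.single_apply]
    split_ifs with h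
    · subst h; exact isPowerBounded_one
    · exact zero_mem _
  add_mem' hx hy r := by simpa using add_mem (hx r) (hy r)
  neg_mem' hx r := by simpa using neg_mem (hx r)
  mul_mem' {x y} hx hy r := by
    classical
    rw [MonoidAlgebra.coeff_mul]
    refine sum_mem fun s _ => sum_mem fun t _ => ?_
    dsimp only
    split_ifs with h
    · rw [← h]; exact (hx s).mul (hy t)
    · exact zero_mem _

variable (A) in
/-- The direct sum `⨁_r A^{∘∘,r}`, as an ideal of `⨁_r A^{∘,r}`. -/
def grIdeal : Ideal (grPre A) where
  carrier := {x | ∀ r, x.1.coeff r ∈ topNilpotent A r}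
  zero_mem' r := by simp
  add_mem' hx hy r := by simpa using add_mem (hx r) (hy r)
  smul_mem' x y hy r := by
    classical
    change (x.1 * y.1).coeff r ∈ _
    rw [MonoidAlgebra.coeff_mul]
    refine sum_mem fun s _ => sum_mem fun t _ => ?_
    dsimp only
    split_ifs with h
    · rw [← h]; exact IsPowerBounded.mul_isTopNilpotent (x.2 s) (hy t)
    · exact zero_mem _

variable (A) in
/-- The graded ring `Gr A = ⨁_r A^{∘,r} / A^{∘∘,r}`. -/
def Gr : Type u := grPre A ⧸ grIdeal A

noncomputable instance : CommRing (Gr A) := inferInstanceAs (CommRing (grPre A ⧸ grIdeal A))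

variable (A) in
/-- The projection `⨁_r A^{∘,r} → Gr A`. -/
noncomputable def grMk : grPre A →+* Gr A := Ideal.Quotient.mk (grIdeal A)

/-- The element of `⨁_r A^{∘,r}` which is `a` in degree `r` and zero in the other degrees. -/
noncomputable def grSingle (r : PosReal) (a : A) (h : a ∈ powerBounded A r) : grPre A :=
  ⟨MonoidAlgebra.single r a, fun s => by
    classical
    rw [MonoidAlgebra.coeff_single, Finsupp.single_apply]
    split_ifs with hs
    · exact hs ▸ h
    · exact zero_mem _⟩

/-- The class in `Gr^r A` of an element `a` of `A^{∘,r}`. -/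
noncomputable def grClass (r : PosReal) (a : A) (h : a ∈ powerBounded A r) : Gr A :=
  grMk A (grSingle r a h)

/-- A subring of `Gr A` is graded if it contains the homogeneous components of its elements. -/
def IsGradedSubring (S : Subring (Gr A)) : Prop :=
  ∀ x : grPre A, grMk A x ∈ S →
    ∀ r, grClass r (x.1.coeff r) (x.2 r) ∈ S

/-- The set `A^{+,r}` of all `a ∈ A^{∘,r}` whose class in `Gr^r A` belongs to the subring `S`. -/
def plus (S : Subring (Gr A)) (r : PosReal) : Set A :=
  {a | ∃ h : a ∈ powerBounded A r, grClass r a h ∈ S}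

/-- The pair `(A, S)` is an affinoid seminormed ring: `S` is a graded subring of `Gr A` which is
integrally closed in `Gr A`. -/
structure IsAffinoid (S : Subring (Gr A)) : Prop where
  graded : IsGradedSubring S
  integrallyClosed : IsIntegrallyClosedIn S (Gr A)

/-- A morphism of affinoid seminormed rings: a bounded ring homomorphism which carries the graded
subring of the source into that of the target. -/
structure IsMorphism {B : Type w} [SeminormedCommRing B] [IsUltrametricDist B] (φ : A →+* B)
    (S : Subring (Gr A)) (T : Subring (Gr B)) : Prop where
  bounded : ∃ c : ℝ, 0 < c ∧ ∀ a, ‖φ a‖ ≤ c * ‖a‖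
  map_plus : ∀ r, ∀ a ∈ plus S r, φ a ∈ plus T r

end Graded

/-! ### The reified adic spectrum and its rational subspaces -/

section Spectrum

variable {A : Type u} [NormedCommRing A] [IsUltrametricDist A]

/-- A reified semivaluation is bounded if `v(a) ≤ r` whenever `a ∈ A^{∘∘,r}`. -/
def ReifiedSemivaluation.IsBounded (v : ReifiedSemivaluation A) : Prop :=
  ∀ r, ∀ a ∈ topNilpotent A r, v.val a ≤ v.reif r

/-- A reified semivaluation is commensurable if it is bounded and every element of its value group
`Γ_v` is bounded below by a positive real number. -/
def ReifiedSemivaluation.IsCommensurable (v : ReifiedSemivaluation A) : Prop :=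
  v.IsBounded ∧ ∀ γ ∈ v.valueGroup, ∃ r, v.reif r ≤ (γ : v.Γ₀)

/-- The reified adic spectrum of `(A, S)`, as a subspace of the reified valuative spectrum: the
classes of the commensurable `v` such that `v(a) ≤ r` whenever `a ∈ A^{+,r}`. -/
def Spra (S : Subring (Gr A)) : Type u :=
  {x : Sprv A // x.rep.IsCommensurable ∧ ∀ r, ∀ a ∈ plus S r, x.rep.val a ≤ x.rep.reif r}

instance (S : Subring (Gr A)) : TopologicalSpace (Spra S) :=
  instTopologicalSpaceSubtype

variable (A) in
/-- Parameters `f₀, f₁, …, fₙ` and scale factors `q₁, …, qₙ` of a rational subspace: `f₁, …, fₙ`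
generate the unit ideal. -/
structure RationalDatum where
  n : ℕ
  f₀ : A
  f : Fin n → A
  q : Fin n → PosReal
  span_eq_top : Ideal.span (Set.range f) = ⊤

/-- The rational subspace `{v | v(fᵢ) ≤ qᵢ v(f₀) ≠ 0 for i = 1, …, n}` of `Spra (A, S)`. -/
def RationalDatum.subspace (D : RationalDatum A) (S : Subring (Gr A)) : Set (Spra S) :=
  {x | x.1.rep.val D.f₀ ≠ 0 ∧
    ∀ i, x.1.rep.val (D.f i) ≤ x.1.rep.reif (D.q i) * x.1.rep.val D.f₀}

/-- The rational subspaces of `Spra (A, S)`. -/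
def IsRational (S : Subring (Gr A)) (U : Set (Spra S)) : Prop :=
  ∃ D : RationalDatum A, U = D.subspace S

end Spectrum

/-! ### Weighted Tate algebras and rational localizations -/

section Gauss

variable (A : Type u) [SeminormedCommRing A] {n : ℕ} (q : Fin n → PosReal)

/-- The polynomial ring `A[T₁, …, Tₙ]`, to be equipped with the weighted Gauss norm. -/
def WeightedPoly (_q : Fin n → PosReal) : Type u := MvPolynomial (Fin n) A

noncomputable instance : CommRing (WeightedPoly A q) :=
  inferInstanceAs (CommRing (MvPolynomial (Fin n) A))

/-- The monomial `q₁ ^ i₁ ⋯ qₙ ^ iₙ` in the weights. -/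
noncomputable def weight (m : Fin n →₀ ℕ) : NNReal :=
  ∏ i, (q i : ℝ).toNNReal ^ m i

/-- The weighted Gauss norm `∑ aᵢ Tⁱ ↦ max |aᵢ| qⁱ`. -/
noncomputable def gauss (p : MvPolynomial (Fin n) A) : NNReal :=
  p.support.sup fun m => ‖p.coeff m‖₊ * weight q m

variable {A q}

theorem weight_add (m m' : Fin n →₀ ℕ) : weight q (m + m') = weight q m * weight q m' := by
  simp only [weight, Finsupp.add_apply, pow_add, Finset.prod_mul_distrib]

theorem gauss_le_iff {p : MvPolynomial (Fin n) A} {c : NNReal} :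
    gauss A q p ≤ c ↔ ∀ m, ‖p.coeff m‖₊ * weight q m ≤ c := by
  unfold gauss
  rw [Finset.sup_le_iff]
  refine ⟨fun h m => ?_, fun h m _ => h m⟩
  by_cases hm : m ∈ p.support
  · exact h m hm
  · simp [MvPolynomial.notMem_support_iff.1 hm]

theorem le_gauss (p : MvPolynomial (Fin n) A) (m : Fin n →₀ ℕ) :
    ‖p.coeff m‖₊ * weight q m ≤ gauss A q p := gauss_le_iff.1 le_rfl m

theorem gauss_neg (p : MvPolynomial (Fin n) A) : gauss A q (-p) = gauss A q p := by
  apply le_antisymm <;> rw [gauss_le_iff] <;> intro m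
  · rw [MvPolynomial.coeff_neg, nnnorm_neg]; exact le_gauss p m
  · rw [← nnnorm_neg, ← MvPolynomial.coeff_neg]; exact le_gauss (-p) m

variable [IsUltrametricDist A]

theorem gauss_add_le (p p' : MvPolynomial (Fin n) A) :
    gauss A q (p + p') ≤ max (gauss A q p) (gauss A q p') := by
  rw [gauss_le_iff]
  intro m
  rw [MvPolynomial.coeff_add]
  refine (mul_le_mul_of_nonneg_right (IsUltrametricDist.nnnorm_add_le_max _ _) zero_le).trans ?_
  rw [max_mul_of_nonneg _ _ zero_le]
  exact max_le_max (le_gauss p m) (le_gauss p' m)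

theorem gauss_mul_le (p p' : MvPolynomial (Fin n) A) :
    gauss A q (p * p') ≤ gauss A q p * gauss A q p' := by
  classical
  rw [gauss_le_iff]
  intro m
  rw [MvPolynomial.coeff_mul]
  obtain ⟨x, hx, h⟩ := IsUltrametricDist.exists_norm_finsetSum_le_of_nonempty
    (t := Finset.HasAntidiagonal.antidiagonal m) ⟨(0, m), Finset.HasAntidiagonal.mem_antidiagonal.2 (zero_add m)⟩ (fun x => p.coeff x.1 * p'.coeff x.2)
  rw [← Finset.HasAntidiagonal.mem_antidiagonal.1 hx, weight_add]
  rw [← Finset.HasAntidiagonal.mem_antidiagonal.1 hx] at h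
  calc _ ≤ (‖p.coeff x.1‖₊ * ‖p'.coeff x.2‖₊) * (weight q x.1 * weight q x.2) :=
        mul_le_mul_of_nonneg_right (le_trans (by exact_mod_cast h) (nnnorm_mul_le _ _)) zero_le
    _ = (‖p.coeff x.1‖₊ * weight q x.1) * (‖p'.coeff x.2‖₊ * weight q x.2) := by ring
    _ ≤ _ := mul_le_mul' (le_gauss p _) (le_gauss p' _)

variable (A q) in
/-- The weighted Gauss norm as a ring seminorm. -/
noncomputable def gaussSeminorm : RingSeminorm (WeightedPoly A q) where
  toFun p := (gauss A q p : ℝ)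
  map_zero' := by
    have : gauss A q (0 : MvPolynomial (Fin n) A) = 0 := by simp [gauss]
    exact_mod_cast this
  add_le' p p' := by
    have := (gauss_add_le (q := q) p p').trans
      (max_le (le_add_of_nonneg_right zero_le) (le_add_of_nonneg_left zero_le))
    exact_mod_cast this
  neg' p := by
    have := gauss_neg (q := q) p
    exact_mod_cast this
  mul_le' p p' := by
    have := gauss_mul_le (q := q) p p'
    exact_mod_cast this

noncomputable instance : SeminormedCommRing (WeightedPoly A q) where
  __ := (gaussSeminorm A q).toSeminormedRing
  mul_comm := mul_comm

instance : IsUltrametricDist (WeightedPoly A q) :=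
  IsUltrametricDist.isUltrametricDist_of_forall_norm_add_le_max_norm fun p p' => by
    have : (gauss A q _ : ℝ) ≤ _ := NNReal.coe_le_coe.2 (gauss_add_le (q := q) p p')
    rwa [NNReal.coe_max] at this

variable (A q) in
/-- The weighted Tate algebra `A{T₁/q₁, …, Tₙ/qₙ}`: the completion of `A[T₁, …, Tₙ]` for the
weighted Gauss norm. -/
abbrev WeightedTate : Type u := UniformSpace.Completion (WeightedPoly A q)

instance : IsUltrametricDist (WeightedTate A q) :=
  IsUltrametricDist.isUltrametricDist_of_forall_norm_add_le_max_norm fun x y => by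
    induction x, y using UniformSpace.Completion.induction_on₂ with
    | hp => apply isClosed_le <;> fun_prop
    | ih x y =>
      rw [← UniformSpace.Completion.coe_add]
      simpa only [UniformSpace.Completion.norm_coe] using IsUltrametricDist.norm_add_le_max x y

variable (A q) in
/-- The inclusion of the polynomials into the weighted Tate algebra. -/
noncomputable def polyToTate : MvPolynomial (Fin n) A →+* WeightedTate A q :=
  (UniformSpace.Completion.coeRingHom : WeightedPoly A q →+* WeightedTate A q)

end Gauss

instance {R : Type u} [SeminormedCommRing R] [IsUltrametricDist R] (I : Ideal R) :
    IsUltrametricDist (R ⧸ I) :=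
  IsUltrametricDist.isUltrametricDist_of_forall_norm_add_le_max_norm fun x y => by
    refine le_of_forall_pos_le_add fun ε hε => ?_
    obtain ⟨a, rfl, ha⟩ := Ideal.Quotient.norm_mk_lt x hε
    obtain ⟨b, rfl, hb⟩ := Ideal.Quotient.norm_mk_lt y hε
    rw [← map_add]
    refine (Ideal.Quotient.norm_mk_le I _).trans ((IsUltrametricDist.norm_add_le_max a b).trans ?_)
    rw [← max_add_add_right]
    exact max_le_max ha.le hb.le

namespace RationalDatum

variable {A : Type u} [NormedCommRing A] [IsUltrametricDist A] (D : RationalDatum A)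

/-- The closure of the ideal `(f₀ T₁ - f₁, …, f₀ Tₙ - fₙ)` of `A{T₁/q₁, …, Tₙ/qₙ}`. -/
noncomputable def ideal : Ideal (WeightedTate A D.q) :=
  (Ideal.span (Set.range fun i => polyToTate A D.q
    (MvPolynomial.C D.f₀ * MvPolynomial.X i - MvPolynomial.C (D.f i)))).closure

instance : IsClosed (D.ideal : Set (WeightedTate A D.q)) := by
  unfold ideal
  rw [Ideal.coe_closure]
  exact isClosed_closure

/-- The ring `B` of the rational localization `(A, S) → (B, B^Gr)` defined by `D`: the quotient of
`A{T₁/q₁, …, Tₙ/qₙ}` by the closure of `(f₀ T₁ - f₁, …, f₀ Tₙ - fₙ)`. -/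
abbrev Loc : Type u := WeightedTate A D.q ⧸ D.ideal

/-- The ring homomorphism `A[T₁, …, Tₙ] → B`. -/
noncomputable def ofPoly : MvPolynomial (Fin D.n) A →+* D.Loc :=
  (Ideal.Quotient.mk D.ideal).comp (polyToTate A D.q)

/-- The ring homomorphism `A → B`. -/
noncomputable def toLoc : A →+* D.Loc := D.ofPoly.comp MvPolynomial.C

/-- The graded subring `B^Gr` of `Gr B`: the integral closure in `Gr B` of the image of
`S[T₁, …, Tₙ]`, where `Tᵢ` is placed in degree `qᵢ`. The image is the subring generated by the
classes of the images of the elements of the `A^{+,r}` and the classes of the `Tᵢ`. -/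
noncomputable def locGr (S : Subring (Gr A)) : Subring (Gr D.Loc) :=
  (integralClosure (Subring.closure
    ({y : Gr D.Loc | ∃ (r : PosReal) (a : A) (h : D.toLoc a ∈ powerBounded D.Loc r),
        a ∈ plus S r ∧ y = grClass r (D.toLoc a) h} ∪
      {y : Gr D.Loc | ∃ (i : Fin D.n) (h : D.ofPoly (MvPolynomial.X i) ∈ powerBounded D.Loc (D.q i)),
        y = grClass (D.q i) (D.ofPoly (MvPolynomial.X i)) h})) (Gr D.Loc)).toSubring

end RationalDatum

/-! ### The structure presheaf -/

section Presheaf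

variable {A : Type u} [NormedCommRing A] [IsUltrametricDist A] (S : Subring (Gr A))

/-- The sections over `U` of the structure presheaf: the inverse limit of the rings `B` over all
rational localizations `(A, S) → (B, B^Gr)` defining rational subspaces contained in `U`, the
transition maps being all morphisms of affinoid rings under `(A, S)`. -/
def sections (U : Set (Spra S)) :
    Subring (∀ D : {D : RationalDatum A // D.subspace S ⊆ U}, D.1.Loc) where
  carrier := {s | ∀ (D D' : {D : RationalDatum A // D.subspace S ⊆ U}) (φ : D.1.Loc →+* D'.1.Loc),
    IsMorphism φ (D.1.locGr S) (D'.1.locGr S) → φ.comp D.1.toLoc = D'.1.toLoc → φ (s D) = s D'}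
  zero_mem' D D' φ _ _ := by simp
  one_mem' D D' φ _ _ := by simp
  add_mem' hs ht D D' φ h h' := by simp [hs D D' φ h h', ht D D' φ h h']
  mul_mem' hs ht D D' φ h h' := by simp [hs D D' φ h h', ht D D' φ h h']
  neg_mem' hs D D' φ h h' := by simp [hs D D' φ h h']

/-- The restriction maps of the structure presheaf. -/
def restrict {U V : Set (Spra S)} (h : V ⊆ U) : sections S U →+* sections S V where
  toFun s := ⟨fun D => s.1 ⟨D.1, D.2.trans h⟩,
    fun D D' => s.2 ⟨D.1, D.2.trans h⟩ ⟨D'.1, D'.2.trans h⟩⟩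
  map_zero' := rfl
  map_one' := rfl
  map_add' _ _ := rfl
  map_mul' _ _ := rfl

/-- The structure presheaf `𝒪` on `X = Spra (A, S)`. -/
noncomputable def structurePresheaf : TopCat.Presheaf CommRingCat.{u} (TopCat.of (Spra S)) where
  obj U := CommRingCat.of (sections S (U.unop : Set (Spra S)))
  map f := CommRingCat.ofHom (restrict S (leOfHom f.unop))

/-- The canonical homomorphism `A → 𝒪(X)`. -/
noncomputable def toGlobal :
    A →+* (structurePresheaf S).obj (Opposite.op (⊤ : Opens (TopCat.of (Spra S)))) where
  toFun a := (⟨fun D => D.1.toLoc a, fun _ _ _ _ h => RingHom.congr_fun h a⟩ :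
    sections S ((⊤ : Opens (TopCat.of (Spra S))) : Set (Spra S)))
  map_zero' := Subtype.ext (funext fun D => map_zero D.1.toLoc)
  map_one' := Subtype.ext (funext fun D => map_one D.1.toLoc)
  map_add' a b := Subtype.ext (funext fun D => map_add D.1.toLoc a b)
  map_mul' a b := Subtype.ext (funext fun D => map_mul D.1.toLoc a b)

/-- The pair `(A, S)` is sheafy if its structure presheaf is a sheaf. -/
def IsSheafy : Prop := TopCat.Presheaf.IsSheaf (structurePresheaf S)

/-- The structure presheaf, regarded as a presheaf of abelian groups. -/
noncomputable def structurePresheafAb : TopCat.Presheaf AddCommGrpCat.{u} (TopCat.of (Spra S)) :=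
  structurePresheaf S ⋙ forget₂ CommRingCat RingCat ⋙ forget₂ RingCat AddCommGrpCat

/-- The structure sheaf of a sheafy pair, regarded as a sheaf of abelian groups. -/
noncomputable def structureSheaf (h : IsSheafy S) :
    Sheaf (Opens.grothendieckTopology (TopCat.of (Spra S))) AddCommGrpCat.{u} where
  obj := structurePresheafAb S
  property := ((sheafCompose (Opens.grothendieckTopology (TopCat.of (Spra S)))
    (forget₂ CommRingCat.{u} RingCat.{u} ⋙ forget₂ RingCat.{u} AddCommGrpCat.{u})).obj
      ⟨structurePresheaf S, h⟩).property

/-- The sheaf cohomology group `H^i(X, 𝒪)`. -/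
abbrev cohomology (h : IsSheafy S) (i : ℕ) : Type u := Sheaf.H.{u} (structureSheaf S h) i

/-- The canonical map `A → H^0(X, 𝒪)`: the map `A → 𝒪(X)` followed by `𝒪(X) ≃ H^0(X, 𝒪)`. -/
noncomputable def toCohomologyZero (h : IsSheafy S) : A →+ cohomology S h 0 :=
  (Sheaf.H.equiv₀ (structureSheaf S h)
    (Limits.isTerminalTop (α := Opens (TopCat.of (Spra S))))).symm.toAddMonoidHom.comp
      (toGlobal S).toAddMonoidHom

end Presheaf

/-! ### Čech cohomology -/

section Cech

variable {X : TopCat.{u}} (P : TopCat.Presheaf AddCommGrpCat.{u} X) {ι : Type u} (U : ι → Opens X)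

/-- The Čech complex of a presheaf of abelian groups with respect to a family of open sets. -/
noncomputable def cechComplex : CochainComplex AddCommGrpCat.{u} ℕ :=
  (cechComplexFunctor U).obj P

/-- The Čech cohomology of a presheaf with respect to a family of open sets. -/
noncomputable def cechCohomology (i : ℕ) : AddCommGrpCat.{u} := (cechComplex P U).homology i

/-- The augmentation `P(X) → ∏ᵢ P(Uᵢ)` given by restriction. -/
noncomputable def cechAugmentation :
    P.obj (Opposite.op ⊤) ⟶ (cechComplex P U).X 0 :=
  Limits.Pi.lift fun _ => P.map (homOfLE le_top).op

/-- The class `c` in degree-zero Čech cohomology is the one of the `0`-cocycle given by the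
restrictions of the global section `s`. -/
def IsCechClassOf (s : P.obj (Opposite.op ⊤)) (c : cechCohomology P U 0) : Prop :=
  ∃ z : (cechComplex P U).cycles 0,
    (cechComplex P U).iCycles 0 z = cechAugmentation P U s ∧ (cechComplex P U).homologyπ 0 z = c

end Cech

end Readic

namespace Readic

/-! ### Power-bounded families and bounded homomorphisms -/

section Bounds

/-! Sheafiness supplies uniqueness and gluing of sections, so the analytic content is a single
surjectivity. Cut a rational subspace V, on which v(g) is bounded below by a positive real, into V₁
= {v(f) ≤ q v(g)} and V₂ = {v(f) ≥ q v(g)}. Then every section over V₁ ∩ V₂ is a sum of sections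
over V₁ and V₂ (`IsSplit.exists_restrict_add`). Indeed, with z = f/g, the ring of V₁ ∩ V₂ is
topologically generated over A by elements coming from V times powers of z. Polynomials in these
split by the sign of the exponent of z, and both halves are bounded for the Gauss norm, so the
decomposition passes to completions (`RationalDatum.exists_add_eq_of_laurent`).

To compute with sections, one needs that a rational localization depends only on its subspace. This
follows from its universal property once the spectrum is known to detect units and the groups
A^{+,r} (`isUnit_of_forall_val_ne_zero`, `mem_plus_of_forall_val_le`). Both rest on one alternative:
either a valuation with prescribed bounds exists, or an algebraic identity forbids it
(`exists_reifiedSemivaluation_or`). The trivial datum then identifies A with 𝒪(X).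

Rational subspaces are compact, by ultraproducts. Hence every local problem on a rational subspace
can be reached by finitely many splittings: a hereditary property that holds for ∅, holds locally
and passes from V₁ and V₂ to V holds for all rational subspaces (`of_isSplit_of_local`).

This principle is used twice. For a short exact sequence 0 → F → I → Q with F acyclic for
splittings, lifts of a section of Q to I can be patched across each splitting. So H¹(X, F) = 0 if I
is injective, and Q is acyclic again because I is flasque; dimension shifting kills the higher
groups. For the Čech complex, exactness of the augmented complex on V is clear if V lies in a member
of the covering, and it passes from V₁, V₂ and V₁ ∩ V₂ to V by a Mayer–Vietoris argument. -/

/-- A ring homomorphism between seminormed rings is bounded if `‖φ a‖ ≤ c ‖a‖` for some `c`. -/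
def IsBoundedHom {A B : Type*} [SeminormedCommRing A] [SeminormedCommRing B] (φ : A →+* B) :
    Prop := ∃ c : ℝ, 0 < c ∧ ∀ a, ‖φ a‖ ≤ c * ‖a‖

theorem IsBoundedHom.comp {A B C : Type*} [SeminormedCommRing A] [SeminormedCommRing B]
    [SeminormedCommRing C] {ψ : B →+* C} {φ : A →+* B} (hψ : IsBoundedHom ψ)
    (hφ : IsBoundedHom φ) : IsBoundedHom (ψ.comp φ) := by
  obtain ⟨c, hc, h⟩ := hψ
  obtain ⟨d, hd, h'⟩ := hφ
  refine ⟨c * d, mul_pos hc hd, fun a => (h _).trans ?_⟩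
  rw [mul_assoc]
  exact mul_le_mul_of_nonneg_left (h' a) hc.le

theorem IsBoundedHom.id {A : Type*} [SeminormedCommRing A] : IsBoundedHom (RingHom.id A) :=
  ⟨1, one_pos, fun a => by simp⟩

theorem IsBoundedHom.continuous {A B : Type*} [SeminormedCommRing A] [SeminormedCommRing B]
    {φ : A →+* B} (h : IsBoundedHom φ) : Continuous φ := by
  obtain ⟨c, _, h⟩ := h
  exact AddMonoidHomClass.continuous_of_bound φ c h

theorem IsPowerBounded.map {A B : Type*} [SeminormedCommRing A] [SeminormedCommRing B]
    {φ : A →+* B} (h : IsBoundedHom φ) {r : PosReal} {a : A} (ha : IsPowerBounded r a) :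
    IsPowerBounded r (φ a) := by
  obtain ⟨c, hc, h⟩ := h
  obtain ⟨C, hC⟩ := ha
  have hr := r.2
  refine ⟨c * C, fun n hn => ?_⟩
  rw [← map_pow]
  calc _ ≤ c * ‖a ^ n‖ / (r : ℝ) ^ n := by gcongr; exact h _
    _ = c * (‖a ^ n‖ / (r : ℝ) ^ n) := mul_div_assoc _ _ _
    _ ≤ _ := mul_le_mul_of_nonneg_left (hC n hn) hc.le

theorem IsTopNilpotent.map {A B : Type*} [SeminormedCommRing A] [SeminormedCommRing B]
    {φ : A →+* B} (h : IsBoundedHom φ) {r : PosReal} {a : A} (ha : IsTopNilpotent r a) :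
    IsTopNilpotent r (φ a) := by
  obtain ⟨c, hc, h⟩ := h
  have h' := Tendsto.const_mul c ha
  rw [mul_zero] at h'
  have hr := r.2
  refine squeeze_zero (fun n => div_pow_nonneg _ _ _) (fun n => ?_) h'
  rw [← map_pow, ← mul_div_assoc]
  gcongr
  exact h _

theorem isTopNilpotent_of_norm_lt {A : Type*} [SeminormedCommRing A] {r : PosReal} {a : A}
    (h : ‖a‖ < r) : IsTopNilpotent r a := by
  have hr := r.2
  have h' : Tendsto (fun n : ℕ => (‖a‖ / r) ^ n) atTop (𝓝 0) :=
    tendsto_pow_atTop_nhds_zero_of_lt_one (by positivity) ((div_lt_one hr).2 h)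
  refine squeeze_zero' (.of_forall fun n => div_pow_nonneg _ _ _) ?_ h'
  filter_upwards [eventually_ge_atTop 1] with n hn
  rw [div_pow]
  gcongr
  exact norm_pow_le' a hn

theorem IsPowerBounded.isTopNilpotent {A : Type*} [SeminormedCommRing A] {r s : PosReal} {a : A}
    (h : IsPowerBounded r a) (hrs : r < s) : IsTopNilpotent s a := by
  obtain ⟨C, h1, hC⟩ := h.exists_bound
  have hr := r.2
  have hs := s.2
  have h' := (tendsto_pow_atTop_nhds_zero_of_lt_one (r := (r : ℝ) / s) (by positivity)
    ((div_lt_one hs).2 hrs)).const_mul C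
  rw [mul_zero] at h'
  refine squeeze_zero (fun n => div_pow_nonneg _ _ _) (fun n => ?_) h'
  have := hC n
  rw [div_le_iff₀ (by positivity)] at this
  rw [div_pow, ← mul_div_assoc]
  gcongr

/-- One constant serves all monomials, because the bound for each power-bounded factor is uniform in
its exponent and the number of factors is fixed. -/
theorem exists_norm_prod_pow_le {B : Type*} [SeminormedCommRing B] {ι : Type*} (s : Finset ι)
    (y : ι → B) (w : ι → PosReal) (hy : ∀ i, IsPowerBounded (w i) (y i)) :
    ∃ K : ℝ, 0 < K ∧ ∀ m : ι → ℕ, ‖∏ i ∈ s, y i ^ m i‖ ≤ K * ∏ i ∈ s, (w i : ℝ) ^ m i := by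
  classical
  induction s using Finset.induction_on with
  | empty => exact ⟨‖(1 : B)‖ + 1, by positivity, fun m => by simp⟩
  | insert i s hi ih =>
    obtain ⟨K, hK, h⟩ := ih
    obtain ⟨C, hC1, hC⟩ := (hy i).exists_bound
    refine ⟨C * K, mul_pos (by linarith) hK, fun m => ?_⟩
    rw [Finset.prod_insert hi, Finset.prod_insert hi, mul_mul_mul_comm]
    have hw := (w i).2
    have h1 := hC (m i)
    rw [div_le_iff₀ (by positivity)] at h1
    exact (norm_mul_le _ _).trans (mul_le_mul h1 (h m) (norm_nonneg _) (by positivity))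

theorem coe_weight {n : ℕ} (q : Fin n → PosReal) (m : Fin n →₀ ℕ) :
    (weight q m : ℝ) = ∏ i, (q i : ℝ) ^ m i := by
  unfold weight
  push_cast
  exact Finset.prod_congr rfl fun i _ => by rw [Real.coe_toNNReal _ (q i).2.le]

variable {A : Type u} [SeminormedCommRing A] [IsUltrametricDist A] {n : ℕ} {q : Fin n → PosReal}

theorem norm_weightedPoly (p : WeightedPoly A q) : ‖p‖ = gauss A q p := rfl

/-- The Gauss norm is a maximum over monomials and the target is ultrametric, so boundedness of an
additive map is decided on monomials. -/
theorem norm_le_of_monomial_le {B : Type*} [SeminormedAddCommGroup B] [IsUltrametricDist B]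
    (θ : MvPolynomial (Fin n) A →+ B) {K : ℝ} (hK : 0 ≤ K)
    (h : ∀ m a, ‖θ (MvPolynomial.monomial m a)‖ ≤ K * (‖a‖ * weight q m))
    (p : WeightedPoly A q) : ‖θ p‖ ≤ K * ‖p‖ := by
  rw [norm_weightedPoly]
  conv_lhs => rw [← MvPolynomial.support_sum_monomial_coeff (p : MvPolynomial (Fin n) A), map_sum]
  refine IsUltrametricDist.norm_sum_le_of_forall_le_of_nonneg (by positivity) fun m _ => ?_
  refine (h _ _).trans (mul_le_mul_of_nonneg_left ?_ hK)
  exact_mod_cast le_gauss (q := q) p m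

theorem norm_polyToTate (p : MvPolynomial (Fin n) A) : ‖polyToTate A q p‖ = gauss A q p :=
  UniformSpace.Completion.norm_coe (E := WeightedPoly A q) p

theorem isPowerBounded_polyToTate_X (i : Fin n) :
    IsPowerBounded (q i) (polyToTate A q (MvPolynomial.X i)) := by
  refine ⟨‖(1 : A)‖, fun k _ => ?_⟩
  have hq := (q i).2
  rw [div_le_iff₀ (by positivity), ← map_pow, MvPolynomial.X_pow_eq_monomial]
  rw [norm_polyToTate]
  have : gauss A q (MvPolynomial.monomial (Finsupp.single i k) 1) ≤
      ‖(1 : A)‖₊ * weight q (Finsupp.single i k) := by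
    classical
    rw [gauss_le_iff]
    intro m
    rw [MvPolynomial.coeff_monomial]
    split_ifs with h
    · rw [h]
    · simp
  refine (NNReal.coe_le_coe.2 this).trans_eq ?_
  rw [NNReal.coe_mul, coe_weight, coe_nnnorm]
  congr 1
  classical
  rw [Finset.prod_eq_single i (fun j _ hj => by simp [hj.symm]) (by simp)]
  simp

theorem norm_polyToTate_C_le (a : A) : ‖polyToTate A q (MvPolynomial.C a)‖ ≤ ‖a‖ := by
  rw [norm_polyToTate]
  have : gauss A q (MvPolynomial.C a) ≤ ‖a‖₊ := by
    classical
    rw [gauss_le_iff]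
    intro m
    rw [MvPolynomial.coeff_C]
    split_ifs with h
    · rw [← h]; simp [weight]
    · simp
  exact_mod_cast this

theorem denseRange_polyToTate : DenseRange (polyToTate A q) :=
  UniformSpace.Completion.denseRange_coe (α := WeightedPoly A q)

/-- Evaluation at a power-bounded family extends to the weighted Tate algebra. -/
theorem exists_evalTate {B : Type*} [NormedCommRing B] [IsUltrametricDist B] [CompleteSpace B]
    {φ : A →+* B} (hφ : IsBoundedHom φ) {b : Fin n → B} (hb : ∀ i, IsPowerBounded (q i) (b i)) :
    ∃ ψ : WeightedTate A q →+* B, IsBoundedHom ψ ∧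
      ∀ p, ψ (polyToTate A q p) = MvPolynomial.eval₂Hom φ b p := by
  obtain ⟨c, hc, hφ⟩ := hφ
  obtain ⟨K, hK, h⟩ := exists_norm_prod_pow_le Finset.univ b q hb
  have hbd : ∀ p : WeightedPoly A q, ‖MvPolynomial.eval₂Hom φ b p‖ ≤ c * K * ‖p‖ := by
    refine norm_le_of_monomial_le (MvPolynomial.eval₂Hom φ b).toAddMonoidHom (by positivity)
      fun m a => ?_
    change ‖MvPolynomial.eval₂Hom φ b (MvPolynomial.monomial m a)‖ ≤ _
    rw [MvPolynomial.coe_eval₂Hom, MvPolynomial.eval₂_monomial, Finsupp.prod_pow, coe_weight]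
    calc _ ≤ (c * ‖a‖) * (K * ∏ i, (q i : ℝ) ^ m i) :=
          (norm_mul_le _ _).trans (mul_le_mul (hφ a) (h m) (norm_nonneg _) (by positivity))
      _ = _ := by ring
  let ev : WeightedPoly A q →+* B := MvPolynomial.eval₂Hom φ b
  have hcont : Continuous ev := AddMonoidHomClass.continuous_of_bound ev _ hbd
  have hcoe : ∀ p : WeightedPoly A q, UniformSpace.Completion.extensionHom ev hcont
      (p : WeightedTate A q) = ev p := fun p =>
    UniformSpace.Completion.extensionHom_coe ev hcont p
  refine ⟨UniformSpace.Completion.extensionHom ev hcont, ⟨c * K, by positivity, fun x => ?_⟩,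
    hcoe⟩
  refine UniformSpace.Completion.induction_on x ?_ fun p => ?_
  · have : Continuous (UniformSpace.Completion.extensionHom ev hcont) :=
      UniformSpace.Completion.continuous_extension
    exact isClosed_le this.norm (by fun_prop)
  · rw [hcoe, UniformSpace.Completion.norm_coe]
    exact hbd p

end Bounds

/-! ### Universal property of rational localizations -/

namespace RationalDatum

variable {A : Type u} [NormedCommRing A] [IsUltrametricDist A] (D : RationalDatum A)

theorem norm_mk_le (x : WeightedTate A D.q) : ‖Ideal.Quotient.mk D.ideal x‖ ≤ ‖x‖ :=
  Ideal.Quotient.norm_mk_le _ _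

theorem isBoundedHom_mk : IsBoundedHom (Ideal.Quotient.mk D.ideal) :=
  ⟨1, one_pos, fun x => by simpa using D.norm_mk_le x⟩

theorem isBoundedHom_toLoc : IsBoundedHom D.toLoc :=
  ⟨1, one_pos, fun a => by
    rw [one_mul]
    exact (D.norm_mk_le _).trans (norm_polyToTate_C_le (q := D.q) a)⟩

/-- The image of the variable `Tᵢ` in the rational localization. -/
noncomputable def T (i : Fin D.n) : D.Loc := D.ofPoly (MvPolynomial.X i)

theorem isPowerBounded_T (i : Fin D.n) : IsPowerBounded (D.q i) (D.T i) :=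
  (isPowerBounded_polyToTate_X i).map D.isBoundedHom_mk

theorem toLoc_mul_T (i : Fin D.n) : D.toLoc D.f₀ * D.T i = D.toLoc (D.f i) := by
  rw [← sub_eq_zero]
  have h : D.toLoc D.f₀ * D.T i - D.toLoc (D.f i) = D.ofPoly
    (MvPolynomial.C D.f₀ * MvPolynomial.X i - MvPolynomial.C (D.f i)) := by
    rw [map_sub, map_mul]; rfl
  rw [h]
  refine Ideal.Quotient.eq_zero_iff_mem.2 ?_
  refine SetLike.mem_coe.1 ?_
  rw [ideal, Ideal.coe_closure]
  exact subset_closure (Ideal.subset_span ⟨i, rfl⟩)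

/-- In the localization every `f i` is a multiple of `f₀`, and the `f i` generate the unit ideal. -/
theorem isUnit_toLoc_f₀ : IsUnit (D.toLoc D.f₀) := by
  rw [← Ideal.span_singleton_eq_top, eq_top_iff, ← Ideal.map_top D.toLoc, ← D.span_eq_top,
    Ideal.map_span, Ideal.span_le]
  rintro _ ⟨_, ⟨i, rfl⟩, rfl⟩
  exact Ideal.mem_span_singleton'.2 ⟨D.T i, by rw [mul_comm, toLoc_mul_T]⟩

theorem denseRange_ofPoly : DenseRange D.ofPoly :=
  (Ideal.Quotient.mk_surjective.denseRange).comp denseRange_polyToTate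
    D.isBoundedHom_mk.continuous

variable {B : Type*} [NormedCommRing B]

/-- The image of `T i` is forced by the relation f₀ Tᵢ = fᵢ with f₀ invertible, and polynomials are
dense. -/
theorem hom_ext {ψ ψ' : D.Loc →+* B} (h : IsBoundedHom ψ) (h' : IsBoundedHom ψ')
    (hc : ψ.comp D.toLoc = ψ'.comp D.toLoc) : ψ = ψ' := by
  have hc' : ∀ a, ψ (D.toLoc a) = ψ' (D.toLoc a) := RingHom.congr_fun hc
  have hT : ∀ i, ψ (D.T i) = ψ' (D.T i) := fun i => by
    have hu := D.isUnit_toLoc_f₀.map ψ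
    rw [← hu.mul_right_inj]
    conv_rhs => rw [hc']
    rw [← map_mul, ← map_mul, toLoc_mul_T, hc']
  have hp : ψ.comp D.ofPoly = ψ'.comp D.ofPoly :=
    MvPolynomial.ringHom_ext hc' hT
  refine RingHom.ext fun x => congrFun (D.denseRange_ofPoly.equalizer h.continuous h'.continuous
    (funext fun p => RingHom.congr_fun hp p)) x

variable [IsUltrametricDist B] [CompleteSpace B]

/-- Evaluation at b extends to the weighted Tate algebra by power-boundedness. It kills the
generators of the ideal, and its kernel is closed, so it kills the closure as well. -/
theorem exists_lift {φ : A →+* B} (hφ : IsBoundedHom φ) {b : Fin D.n → B}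
    (hb : ∀ i, IsPowerBounded (D.q i) (b i)) (hf : ∀ i, φ D.f₀ * b i = φ (D.f i)) :
    ∃ ψ : D.Loc →+* B, IsBoundedHom ψ ∧ ψ.comp D.toLoc = φ ∧ ∀ i, ψ (D.T i) = b i := by
  obtain ⟨ψ, hψ, h⟩ := exists_evalTate (q := D.q) hφ hb
  have hker : ∀ x ∈ D.ideal, ψ x = 0 := by
    have h1 : (Ideal.span (Set.range fun i => polyToTate A D.q
        (MvPolynomial.C D.f₀ * MvPolynomial.X i - MvPolynomial.C (D.f i)))) ≤ RingHom.ker ψ := by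
      rw [Ideal.span_le]
      rintro _ ⟨i, rfl⟩
      simp [RingHom.mem_ker, h, hf]
    have h2 : IsClosed {x | ψ x = 0} := isClosed_eq hψ.continuous continuous_const
    intro x hx
    refine closure_minimal (t := {x | ψ x = 0}) (fun y hy => h1 hy) h2 ?_
    rw [← SetLike.mem_coe, ideal, Ideal.coe_closure] at hx
    exact hx
  refine ⟨Ideal.Quotient.lift D.ideal ψ hker, ?_, ?_, fun i => ?_⟩
  · obtain ⟨c, hc, hψ⟩ := hψ
    refine ⟨c, hc, fun x => ?_⟩
    refine le_of_forall_pos_le_add fun ε hε => ?_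
    -- The quotient norm is an infimum that need not be attained; a representative within ε / c
    -- costs only ε after applying ψ.
    obtain ⟨a, rfl, ha⟩ := Ideal.Quotient.norm_mk_lt x (ε := ε / c) (by positivity)
    rw [Ideal.Quotient.lift_mk]
    refine (hψ a).trans ((mul_le_mul_of_nonneg_left ha.le hc.le).trans_eq ?_)
    rw [mul_add, mul_div_cancel₀ _ hc.ne']
  · ext a
    change ψ (polyToTate A D.q (MvPolynomial.C a)) = φ a
    simp [h]
  · change ψ (polyToTate A D.q (MvPolynomial.X i)) = b i
    simp [h]

end RationalDatum

end Readic

namespace Readic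

/-! ### The groups `A^{+,r}` -/

section Plus

variable {A : Type u} [SeminormedCommRing A] [IsUltrametricDist A]

theorem grSingle_add (r : PosReal) (a b : A) (ha : a ∈ powerBounded A r)
    (hb : b ∈ powerBounded A r) :
    grSingle r (a + b) (add_mem ha hb) = grSingle r a ha + grSingle r b hb :=
  Subtype.ext (MonoidAlgebra.single_add _ _ _)

theorem grClass_add (r : PosReal) (a b : A) (ha : a ∈ powerBounded A r)
    (hb : b ∈ powerBounded A r) :
    grClass r (a + b) (add_mem ha hb) = grClass r a ha + grClass r b hb := by
  unfold grClass
  rw [grSingle_add, map_add]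

theorem grClass_mul {r s : PosReal} {a b : A} (ha : a ∈ powerBounded A r)
    (hb : b ∈ powerBounded A s) :
    grClass (r * s) (a * b) (IsPowerBounded.mul ha hb) = grClass r a ha * grClass s b hb := by
  unfold grClass
  rw [← map_mul]
  congr 1
  exact Subtype.ext (MonoidAlgebra.single_mul_single ..).symm

theorem grClass_one : grClass 1 (1 : A) isPowerBounded_one = 1 := by
  unfold grClass
  rw [← map_one (grMk A)]
  rfl

theorem grClass_eq_zero {r : PosReal} {a : A} (h : IsTopNilpotent r a) :
    grClass r a h.isPowerBounded = 0 := by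
  refine Ideal.Quotient.eq_zero_iff_mem.2 fun s => ?_
  classical
  change (MonoidAlgebra.single r a).coeff s ∈ _
  rw [MonoidAlgebra.coeff_single, Finsupp.single_apply]
  split_ifs with hs
  · exact hs ▸ h
  · exact zero_mem _

variable (S : Subring (Gr A))

/-- The additive group `A^{+,r}`. -/
def plusGroup (r : PosReal) : AddSubgroup A where
  carrier := plus S r
  zero_mem' := ⟨zero_mem _, by rw [grClass_eq_zero (isTopNilpotent_zero r)]; exact zero_mem _⟩
  add_mem' := by
    rintro a b ⟨ha, ha'⟩ ⟨hb, hb'⟩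
    exact ⟨add_mem ha hb, by rw [grClass_add r a b ha hb]; exact add_mem ha' hb'⟩
  neg_mem' := by
    rintro a ⟨ha, ha'⟩
    refine ⟨neg_mem ha, ?_⟩
    have h := grClass_add r a (-a) ha (neg_mem ha)
    have h0 : grClass r (a + -a) (add_mem ha (neg_mem ha)) = 0 :=
      grClass_eq_zero (by rw [add_neg_cancel]; exact isTopNilpotent_zero r)
    rw [h0] at h
    rw [← neg_eq_of_add_eq_zero_right h.symm]
    exact neg_mem ha'

variable {S}

theorem plus_mul {r s : PosReal} {a b : A} (ha : a ∈ plus S r) (hb : b ∈ plus S s) :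
    a * b ∈ plus S (r * s) := by
  obtain ⟨ha, ha'⟩ := ha
  obtain ⟨hb, hb'⟩ := hb
  exact ⟨IsPowerBounded.mul ha hb, by rw [grClass_mul ha hb]; exact mul_mem ha' hb'⟩

theorem one_mem_plus : (1 : A) ∈ plus S 1 :=
  ⟨isPowerBounded_one, by rw [grClass_one]; exact one_mem S⟩

theorem IsTopNilpotent.mem_plus {r : PosReal} {a : A} (h : IsTopNilpotent r a) : a ∈ plus S r :=
  ⟨h.isPowerBounded, by rw [grClass_eq_zero h]; exact zero_mem S⟩

theorem isPowerBounded_of_mem_plus {r : PosReal} {a : A} (h : a ∈ plus S r) :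
    IsPowerBounded r a := h.1

end Plus

/-! ### Reified semivaluations -/

namespace ReifiedSemivaluation

variable {A B : Type u} [CommRing A] [CommRing B] (v w : ReifiedSemivaluation A)

theorem reif_inv_mul (r : PosReal) : v.reif r⁻¹ * v.reif r = 1 := by rw [← map_mul]; simp

theorem reif_mul_inv (r : PosReal) : v.reif r * v.reif r⁻¹ = 1 := by rw [← map_mul]; simp

theorem reif_le_reif {r s : PosReal} : v.reif r ≤ v.reif s ↔ r ≤ s := v.reif_strictMono.le_iff_le

theorem reif_pos (r : PosReal) : 0 < v.reif r := zero_lt_iff.2 (v.reif_ne_zero r)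

theorem le_reif_mul_iff (r : PosReal) (x y : v.Γ₀) : x ≤ v.reif r * y ↔ v.reif r⁻¹ * x ≤ y := by
  constructor <;> intro h
  · calc _ ≤ v.reif r⁻¹ * (v.reif r * y) := by gcongr
      _ = y := by rw [← mul_assoc, reif_inv_mul, one_mul]
  · calc x = v.reif r * (v.reif r⁻¹ * x) := by rw [← mul_assoc, reif_mul_inv, one_mul]
      _ ≤ _ := by gcongr

/-- The pullback of a reified semivaluation along a ring homomorphism. -/
def comap (φ : A →+* B) (v : ReifiedSemivaluation B) : ReifiedSemivaluation A where
  Γ₀ := v.Γ₀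
  val := v.val.comap φ
  reif := v.reif
  reif_strictMono := v.reif_strictMono

section Retract

variable (h : ∀ a, ∃ r, v.val a ≤ v.reif r)

open Classical in
/-- The retraction of a reified semivaluation which is bounded above by positive reals: the values
which are not bounded below by any positive real are replaced by zero. -/
noncomputable def retract : ReifiedSemivaluation A where
  Γ₀ := v.Γ₀
  val :=
    { toFun := fun a => if ∃ r, v.reif r ≤ v.val a then v.val a else 0
      map_zero' := by simp
      map_one' := by
        rw [if_pos ⟨1, by simp⟩, map_one]
      map_mul' := fun a b => by
        -- Here the upper bound `h` is needed: if v(b) is at most a real s, then a lower bound r for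
        -- v(ab) yields the lower bound r/s for v(a).
        have key : ∀ a b, (∃ r, v.reif r ≤ v.val (a * b)) → ∃ r, v.reif r ≤ v.val a := by
          rintro a b ⟨r, hr⟩
          obtain ⟨s, hs⟩ := h b
          refine ⟨s⁻¹ * r, ?_⟩
          rw [map_mul, ← le_reif_mul_iff, mul_comm]
          rw [map_mul] at hr
          exact hr.trans (by gcongr)
        by_cases ha : ∃ r, v.reif r ≤ v.val a
        · by_cases hb : ∃ r, v.reif r ≤ v.val b
          · obtain ⟨r, hr⟩ := ha
            obtain ⟨s, hs⟩ := hb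
            have hab : ∃ r, v.reif r ≤ v.val (a * b) :=
              ⟨r * s, by rw [map_mul, map_mul]; exact mul_le_mul' hr hs⟩
            rw [if_pos hab, if_pos ⟨r, hr⟩, if_pos ⟨s, hs⟩, map_mul]
          · rw [if_neg hb, mul_zero, if_neg]
            exact fun h => hb (key b a (by rwa [mul_comm]))
        · rw [if_neg ha, zero_mul, if_neg]
          exact fun h => ha (key a b h)
      map_add_le_max' := fun a b => by
        split_ifs with hab ha hb hb
        · exact v.val.map_add a b
        · obtain ⟨r, hr⟩ := hab
          obtain ⟨s, hs⟩ := ha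
          simp only [not_exists, not_le] at hb
          rcases le_max_iff.1 (v.val.map_add a b) with h | h
          · exact h.trans (le_max_left _ _)
          · exact absurd (hr.trans h) (hb r).not_ge
        · obtain ⟨r, hr⟩ := hab
          simp only [not_exists, not_le] at ha
          rcases le_max_iff.1 (v.val.map_add a b) with h | h
          · exact absurd (hr.trans h) (ha r).not_ge
          · exact h.trans (le_max_right _ _)
        · rename_i ha
          obtain ⟨r, hr⟩ := hab
          simp only [not_exists, not_le] at ha hb
          rcases le_max_iff.1 (v.val.map_add a b) with h | h
          · exact absurd (hr.trans h) (ha r).not_ge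
          · exact absurd (hr.trans h) (hb r).not_ge
        all_goals exact zero_le  }
  reif := v.reif
  reif_strictMono := v.reif_strictMono

theorem retract_val_of_le {a : A} {r : PosReal} (hr : v.reif r ≤ v.val a) :
    (v.retract h).val a = v.val a := if_pos ⟨r, hr⟩

theorem retract_val_of_lt {a : A} (hr : ∀ r, v.val a < v.reif r) :
    (v.retract h).val a = 0 := if_neg fun ⟨r, h⟩ => h.not_gt (hr r)

theorem retract_val_le (a : A) : (v.retract h).val a ≤ v.val a := by
  by_cases ha : ∃ r, v.reif r ≤ v.val a
  · obtain ⟨r, hr⟩ := ha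
    exact (v.retract_val_of_le h hr).le
  · rw [v.retract_val_of_lt h (by simpa using ha)]
    exact zero_le

theorem exists_le_of_retract_val_ne_zero {a : A} (ha : (v.retract h).val a ≠ 0) :
    ∃ r, v.reif r ≤ v.val a := by
  by_contra hr
  exact ha (v.retract_val_of_lt h (by simpa using hr))

theorem exists_le_retract_val {a : A} (ha : (v.retract h).val a ≠ 0) :
    ∃ r, (v.retract h).reif r ≤ (v.retract h).val a := by
  obtain ⟨r, hr⟩ := v.exists_le_of_retract_val_ne_zero h ha
  exact ⟨r, hr.trans_eq (v.retract_val_of_le h hr).symm⟩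

end Retract

variable {v w}

/-- A point of the spectrum remembers only `rel`, and `rep` is an arbitrary representative. This
lemma and its companions transport conditions between representatives. -/
theorem val_le_iff_of_rel_eq (h : v.rel = w.rel) (a : A) (q : PosReal) (b : A) :
    v.val a ≤ v.reif q * v.val b ↔ w.val a ≤ w.reif q * w.val b :=
  iff_of_eq (congrFun (congrFun (congrFun h a) q) b)

theorem val_eq_zero_iff_of_rel_eq (h : v.rel = w.rel) (a : A) : v.val a = 0 ↔ w.val a = 0 := by
  simpa using val_le_iff_of_rel_eq h a 1 0

theorem val_le_reif_iff_of_rel_eq (h : v.rel = w.rel) (a : A) (q : PosReal) :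
    v.val a ≤ v.reif q ↔ w.val a ≤ w.reif q := by
  simpa using val_le_iff_of_rel_eq h a q 1

theorem reif_le_val_iff_of_rel_eq (h : v.rel = w.rel) (a : A) (q : PosReal) :
    v.reif q ≤ v.val a ↔ w.reif q ≤ w.val a := by
  have := val_le_iff_of_rel_eq h 1 q⁻¹ a
  rwa [le_reif_mul_iff, le_reif_mul_iff, inv_inv, map_one, map_one, mul_one, mul_one] at this

end ReifiedSemivaluation

/-! ### Constructing points of the reified adic spectrum -/

section Points

variable {A : Type u} [NormedCommRing A] [IsUltrametricDist A] {S : Subring (Gr A)}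

theorem ReifiedSemivaluation.IsBounded.exists_val_le {v : ReifiedSemivaluation A}
    (hv : v.IsBounded) (a : A) : ∃ r, v.val a ≤ v.reif r :=
  ⟨⟨‖a‖ + 1, by positivity⟩, hv _ a (isTopNilpotent_of_norm_lt (by simp))⟩

/-- It suffices to treat generators of the value group. The induction carries lower and upper real
bounds together, because inversion exchanges them. -/
theorem ReifiedSemivaluation.IsBounded.isCommensurable {v : ReifiedSemivaluation A}
    (hv : v.IsBounded) (h : ∀ a, v.val a ≠ 0 → ∃ r, v.reif r ≤ v.val a) :
    v.IsCommensurable := by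
  refine ⟨hv, fun γ hγ => ?_⟩
  have : (∃ r, v.reif r ≤ (γ : v.Γ₀)) ∧ ∃ r, (γ : v.Γ₀) ≤ v.reif r := by
    induction hγ using Subgroup.closure_induction with
    | mem γ hγ =>
      rcases hγ with ⟨r, hr⟩ | ⟨a, ha⟩
      · exact ⟨⟨r, hr.ge⟩, ⟨r, hr.le⟩⟩
      · rw [ha]
        exact ⟨h a (ha ▸ γ.ne_zero), hv.exists_val_le a⟩
    | one => exact ⟨⟨1, by simp⟩, ⟨1, by simp⟩⟩
    | mul γ δ _ _ h1 h2 =>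
      obtain ⟨⟨r, hr⟩, ⟨r', hr'⟩⟩ := h1
      obtain ⟨⟨s, hs⟩, ⟨s', hs'⟩⟩ := h2
      exact ⟨⟨r * s, by rw [map_mul]; exact mul_le_mul' hr hs⟩,
        ⟨r' * s', by rw [map_mul]; exact mul_le_mul' hr' hs'⟩⟩
    | inv γ _ h1 =>
      obtain ⟨⟨r, hr⟩, ⟨r', hr'⟩⟩ := h1
      refine ⟨⟨r'⁻¹, ?_⟩, ⟨r⁻¹, ?_⟩⟩
      · calc v.reif r'⁻¹ = v.reif r'⁻¹ * γ * (γ⁻¹ : v.Γ₀ˣ) := by simp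
          _ ≤ v.reif r'⁻¹ * v.reif r' * (γ⁻¹ : v.Γ₀ˣ) := by gcongr
          _ = _ := by rw [v.reif_inv_mul, one_mul]
      · calc ((γ⁻¹ : v.Γ₀ˣ) : v.Γ₀) = v.reif r⁻¹ * v.reif r * (γ⁻¹ : v.Γ₀ˣ) := by
              rw [v.reif_inv_mul, one_mul]
          _ ≤ v.reif r⁻¹ * γ * (γ⁻¹ : v.Γ₀ˣ) := by gcongr
          _ = _ := by simp
  exact this.1

namespace Spra

/-- A representative of a point of `Spra (A, S)`. -/
noncomputable abbrev v (x : Spra S) : ReifiedSemivaluation A := x.1.rep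

theorem isBounded (x : Spra S) : x.v.IsBounded := x.2.1.1

theorem val_le_of_mem_plus (x : Spra S) {r : PosReal} {a : A} (h : a ∈ plus S r) :
    x.v.val a ≤ x.v.reif r := x.2.2 r a h

theorem exists_le_val (x : Spra S) {a : A} (h : x.v.val a ≠ 0) : ∃ r, x.v.reif r ≤ x.v.val a :=
  x.2.1.2 (Units.mk0 _ h) (Subgroup.subset_closure (Or.inr ⟨a, rfl⟩))

/-- Boundedness need not be assumed separately, since A^{∘∘,r} is contained in A^{+,r}. -/
theorem exists_of_reifiedSemivaluation (v : ReifiedSemivaluation A)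
    (hp : ∀ r, ∀ a ∈ plus S r, v.val a ≤ v.reif r)
    (hl : ∀ a, v.val a ≠ 0 → ∃ r, v.reif r ≤ v.val a) : ∃ x : Spra S, x.v.rel = v.rel := by
  have h : v.toSprv.rep.rel = v.rel := v.toSprv.rep_rel
  have hp' : ∀ r, ∀ a ∈ plus S r, v.toSprv.rep.val a ≤ v.toSprv.rep.reif r := fun r a ha =>
    (ReifiedSemivaluation.val_le_reif_iff_of_rel_eq h a r).2 (hp r a ha)
  refine ⟨⟨v.toSprv, ReifiedSemivaluation.IsBounded.isCommensurable
    (fun r a ha => hp' r a (IsTopNilpotent.mem_plus ha)) fun a ha => ?_, hp'⟩, h⟩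
  obtain ⟨r, hr⟩ := hl a (mt (ReifiedSemivaluation.val_eq_zero_iff_of_rel_eq h a).2 ha)
  exact ⟨r, (ReifiedSemivaluation.reif_le_val_iff_of_rel_eq h a r).2 hr⟩

/-- The retraction of a reified semivaluation which is bounded by the `A^{+,r}` defines a point. -/
theorem exists_of_retract (v : ReifiedSemivaluation A)
    (hp : ∀ r, ∀ a ∈ plus S r, v.val a ≤ v.reif r) :
    ∃ (h : ∀ a, ∃ r, v.val a ≤ v.reif r) (x : Spra S), x.v.rel = (v.retract h).rel := by
  have h : ∀ a, ∃ r, v.val a ≤ v.reif r :=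
    ReifiedSemivaluation.IsBounded.exists_val_le
      fun r a ha => hp r a (IsTopNilpotent.mem_plus ha)
  exact ⟨h, exists_of_reifiedSemivaluation _
    (fun r a ha => (v.retract_val_le h a).trans (hp r a ha))
    fun a ha => v.exists_le_retract_val h ha⟩

end Spra

end Points

end Readic

namespace Readic

/-! ### Existence of reified semivaluations -/

/-- The image of I avoids 1, hence lies in a maximal ideal P of f(R). A minimal prime Q of f(R)
below P is the contraction of a prime Q' of M. So f(R)/Q embeds in the fraction field of M/Q', where
a valuation ring contains it and has P among its nonunits. -/
theorem exists_valuationSubring_of_forall_ne_one {R M : Type u} [CommRing R] [CommRing M]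
    (f : R →+* M) (I : Ideal R) (hI : ∀ x ∈ I, f x ≠ 1) :
    ∃ (K : Type u) (_ : Field K) (g : M →+* K) (O : ValuationSubring K),
      (∀ x, O.valuation (g (f x)) ≤ 1) ∧ ∀ x ∈ I, O.valuation (g (f x)) < 1 := by
  have hs : Function.Surjective f.rangeRestrict := f.rangeRestrict_surjective
  have hI' : I.map f.rangeRestrict ≠ ⊤ := by
    rw [Ne, Ideal.eq_top_iff_one, Ideal.mem_map_iff_of_surjective _ hs]
    rintro ⟨x, hx, h⟩
    exact hI x hx (congrArg Subtype.val h)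
  obtain ⟨P, hP, hIP⟩ := Ideal.exists_le_maximal _ hI'
  -- P itself may not lift to M, but minimal primes always lift along an injective ring
  -- homomorphism.
  obtain ⟨Q, hQ, hQP⟩ := Ideal.exists_minimalPrimes_le (I := ⊥) (J := P) bot_le
  obtain ⟨Q', hQ', hQQ⟩ := Ideal.exists_comap_eq_of_mem_minimalPrimes_of_injective
    (f := f.range.subtype) Subtype.val_injective Q hQ
  let g : M →+* FractionRing (M ⧸ Q') := (algebraMap _ _).comp (Ideal.Quotient.mk Q')
  have hker : ∀ x, g x = 0 → x ∈ Q' := fun x hx => by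
    rw [← Ideal.Quotient.eq_zero_iff_mem]
    exact (IsFractionRing.injective (M ⧸ Q') (FractionRing (M ⧸ Q'))) (by simpa [g] using hx)
  let h := (g.comp f.range.subtype).rangeRestrict
  have hh : Function.Surjective h := RingHom.rangeRestrict_surjective _
  have hJ : P.map h ≠ ⊤ := by
    rw [Ne, Ideal.eq_top_iff_one, Ideal.mem_map_iff_of_surjective _ hh]
    rintro ⟨x, hx, h1⟩
    have h2 : g (x.1 - 1) = 0 := by
      rw [map_sub, map_one, sub_eq_zero]
      exact congrArg Subtype.val h1
    have h3 : x - 1 ∈ P := hQP (by rw [← hQQ]; exact hker _ h2)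
    exact hP.ne_top ((Ideal.eq_top_iff_one _).2 (by simpa using sub_mem hx h3))
  obtain ⟨O, hO, hO'⟩ := Ideal.image_subset_nonunits_valuationSubring (P.map h) hJ
  refine ⟨_, inferInstance, g, O, fun x => ?_, fun x hx => ?_⟩
  · rw [O.valuation_le_one_iff]
    exact hO ⟨f.rangeRestrict x, rfl⟩
  · rw [← ValuationSubring.mem_nonunits_iff]
    exact hO' ⟨h (f.rangeRestrict x),
      Ideal.mem_map_of_mem _ (hIP (Ideal.mem_map_of_mem _ hx)), rfl⟩

/-! ### A Rees ring that encodes the bounds on a reified semivaluation -/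

section Rees

variable {B : Type u} [SeminormedCommRing B] [IsUltrametricDist B] (T : Subring (Gr B))
  (q : PosReal)

open Polynomial

/-- The polynomials whose `j`-th coefficient lies in `B^{+, r q ^ j}`. -/
def plusPoly (r : PosReal) : AddSubgroup B[X] where
  carrier := {P | ∀ j, P.coeff j ∈ plusGroup T (r * q ^ j)}
  zero_mem' j := by simp
  add_mem' hP hQ j := by rw [coeff_add]; exact add_mem (hP j) (hQ j)
  neg_mem' hP j := by rw [coeff_neg]; exact neg_mem (hP j)

/-- The polynomials in `plusPoly` whose constant coefficient lies in `B^{∘∘, r}`. -/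
def nilPoly (r : PosReal) : AddSubgroup B[X] where
  carrier := {P | P ∈ plusPoly T q r ∧ P.coeff 0 ∈ topNilpotent B r}
  zero_mem' := ⟨zero_mem _, by simp⟩
  add_mem' hP hQ := ⟨add_mem hP.1 hQ.1, by rw [coeff_add]; exact add_mem hP.2 hQ.2⟩
  neg_mem' hP := ⟨neg_mem hP.1, by rw [coeff_neg]; exact neg_mem hP.2⟩

variable {T q}

theorem mul_mem_plusPoly {r s : PosReal} {P Q : B[X]} (hP : P ∈ plusPoly T q r)
    (hQ : Q ∈ plusPoly T q s) : P * Q ∈ plusPoly T q (r * s) := fun j => by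
  rw [coeff_mul]
  refine sum_mem fun x hx => ?_
  rw [← Finset.HasAntidiagonal.mem_antidiagonal.1 hx, pow_add, mul_mul_mul_comm]
  exact plus_mul (hP _) (hQ _)

theorem mul_mem_nilPoly {r s : PosReal} {P Q : B[X]} (hP : P ∈ plusPoly T q r)
    (hQ : Q ∈ nilPoly T q s) : P * Q ∈ nilPoly T q (r * s) := by
  refine ⟨mul_mem_plusPoly hP hQ.1, ?_⟩
  rw [mul_coeff_zero]
  have := isPowerBounded_of_mem_plus (hP 0)
  rw [pow_zero, mul_one] at this
  exact this.mul_isTopNilpotent hQ.2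

theorem C_mem_plusPoly {r : PosReal} {a : B} (ha : a ∈ plus T r) : C a ∈ plusPoly T q r :=
  fun j => by
    rw [coeff_C]
    split_ifs with h
    · rw [h, pow_zero, mul_one]; exact ha
    · exact zero_mem _

/-- Placing X in degree q⁻¹ inside the ideal is what forces the strict inequality v(β) < q⁻¹ later
on. -/
theorem X_mem_nilPoly : (X : B[X]) ∈ nilPoly T q q⁻¹ := by
  refine ⟨fun j => ?_, by simp⟩
  rw [coeff_X]
  split_ifs with h
  · rw [← h, pow_one, inv_mul_cancel]; exact one_mem_plus
  · exact zero_mem _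

variable (T q)

/-- The Rees ring `⨁_r plusPoly T q r`. -/
def rees : Subring (MonoidAlgebra B[X] PosReal) where
  carrier := {x | ∀ r, x.coeff r ∈ plusPoly T q r}
  zero_mem' r := by simp
  one_mem' r := by
    classical
    rw [MonoidAlgebra.one_def, MonoidAlgebra.coeff_single, Finsupp.single_apply]
    split_ifs with h
    · subst h; rw [← C_1]; exact C_mem_plusPoly one_mem_plus
    · exact zero_mem _
  add_mem' hx hy r := by simpa using add_mem (hx r) (hy r)
  neg_mem' hx r := by simpa using neg_mem (hx r)
  mul_mem' {x y} hx hy r := by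
    classical
    rw [MonoidAlgebra.coeff_mul]
    refine sum_mem fun s _ => sum_mem fun t _ => ?_
    dsimp only
    split_ifs with h
    · rw [← h]; exact mul_mem_plusPoly (hx s) (hy t)
    · exact zero_mem _

/-- The ideal `⨁_r nilPoly T q r` of the Rees ring. -/
def reesIdeal : Ideal (rees T q) where
  carrier := {x | ∀ r, x.1.coeff r ∈ nilPoly T q r}
  zero_mem' r := by simp
  add_mem' hx hy r := by simpa using add_mem (hx r) (hy r)
  smul_mem' x y hy r := by
    classical
    change (x.1 * y.1).coeff r ∈ _
    rw [MonoidAlgebra.coeff_mul]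
    refine sum_mem fun s _ => sum_mem fun t _ => ?_
    dsimp only
    split_ifs with h
    · rw [← h]; exact mul_mem_nilPoly (x.2 s) (hy t)
    · exact zero_mem _

variable {T q}

theorem single_mem_rees {r : PosReal} {P : B[X]} (h : P ∈ plusPoly T q r) :
    MonoidAlgebra.single r P ∈ rees T q := fun s => by
  classical
  rw [MonoidAlgebra.coeff_single, Finsupp.single_apply]
  split_ifs with hs
  · exact hs ▸ h
  · exact zero_mem _

theorem single_mem_reesIdeal {r : PosReal} {P : B[X]} (h : P ∈ nilPoly T q r) :
    (⟨_, single_mem_rees h.1⟩ : rees T q) ∈ reesIdeal T q := fun s => by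
  classical
  change (MonoidAlgebra.single r P).coeff s ∈ _
  rw [MonoidAlgebra.coeff_single, Finsupp.single_apply]
  split_ifs with hs
  · exact hs ▸ h
  · exact zero_mem _

omit [IsUltrametricDist B] in
theorem isTopNilpotent_one_of_one_lt {s : PosReal} (hs : 1 < s) : IsTopNilpotent s (1 : B) :=
  (isPowerBounded_one (A := B)).isTopNilpotent hs

variable (T q)

/-- Either there is a reified semivaluation `v` on `C` bounded by the `B^{+,r}` with
`v(β) < q⁻¹`, or `1` is a polynomial in `β` with suitably small coefficients. -/
theorem exists_reifiedSemivaluation_or {C : Type u} [CommRing C] (φ : B →+* C) (β : C) :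
    (∃ v : ReifiedSemivaluation C, (∀ r, ∀ a ∈ plus T r, v.val (φ a) ≤ v.reif r) ∧
      v.val β < v.reif q⁻¹) ∨
    ∃ P : B[X], (∀ j, P.coeff j ∈ plus T (q ^ j)) ∧ IsTopNilpotent 1 (P.coeff 0) ∧
      P.eval₂ φ β = 1 := by
  -- The group ring of the positive reals over C keeps track of degrees; X is sent to β.
  let F : MonoidAlgebra B[X] PosReal →+* MonoidAlgebra C PosReal :=
    MonoidAlgebra.mapRingHom PosReal (eval₂RingHom φ β)
  have hF : ∀ r P, F (MonoidAlgebra.single r P) = MonoidAlgebra.single r (P.eval₂ φ β) :=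
    fun r P => by simp [F]
  by_cases h : ∃ x ∈ reesIdeal T q, F x.1 = 1
  · right
    obtain ⟨x, hx, h⟩ := h
    refine ⟨x.1.coeff 1, fun j => ?_, (hx 1).2, ?_⟩
    -- Comparing degree-one components (1 being the unit of the positive reals) in F x = 1 leaves a
    -- single polynomial.
    · have := (hx 1).1 j
      rwa [one_mul] at this
    · have h1 := congrArg (fun y => y.coeff 1) h
      simpa [F] using h1
  · left
    push Not at h
    obtain ⟨K, _, g, O, hO, hO'⟩ := exists_valuationSubring_of_forall_ne_one
      (F.comp (rees T q).subtype) (reesIdeal T q) h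
    let t : PosReal →* K := (g : MonoidAlgebra C PosReal →* K).comp (MonoidAlgebra.of C PosReal)
    have ht : ∀ r, O.valuation (t r) ≠ 0 := fun r h0 => by
      have : O.valuation (t r * t r⁻¹) = 0 := by rw [map_mul, h0, zero_mul]
      rw [← map_mul, mul_inv_cancel, map_one, map_one] at this
      exact one_ne_zero this
    -- For s > 1 the constant 1 belongs to B^{∘∘,s}, so placed in degree s it lies in the ideal.
    -- This gives strict monotonicity of the reification.
    have htlt : ∀ s, 1 < s → O.valuation (t s) < 1 := fun s hs => by
      have hn : (Polynomial.C 1 : B[X]) ∈ nilPoly T q s :=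
        ⟨C_mem_plusPoly (IsTopNilpotent.mem_plus (isTopNilpotent_one_of_one_lt hs)),
          by rw [coeff_C_zero]; exact isTopNilpotent_one_of_one_lt hs⟩
      have := hO' _ (single_mem_reesIdeal hn)
      simp only [RingHom.comp_apply, Subring.subtype_apply, hF, map_one, eval₂_one] at this
      exact this
    have hsingle : ∀ r c, g (MonoidAlgebra.single r c) = g (MonoidAlgebra.single 1 c) * t r := by
      intro r c
      change _ = _ * g (MonoidAlgebra.single r 1)
      rw [← map_mul, MonoidAlgebra.single_mul_single, one_mul, mul_one]
    let v : ReifiedSemivaluation C :=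
      { Γ₀ := O.ValueGroup
        val := O.valuation.comap (g.comp MonoidAlgebra.singleOneRingHom)
        reif :=
          -- The inverse appears because an element c in degree r should have value v(c)/r, so that
          -- integrality over the valuation ring means v(c) ≤ r.
          { toFun := fun r => O.valuation (t r⁻¹)
            map_one' := by simp
            map_mul' := fun r s => by rw [mul_inv, map_mul, map_mul] }
        reif_strictMono := fun r s hrs => by
          change O.valuation (t r⁻¹) < O.valuation (t s⁻¹)
          have h1 : r⁻¹ = s / r * s⁻¹ := by
            rw [div_mul_eq_mul_div, mul_inv_cancel, one_div]
          have h2 : 1 < s / r := by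
            rwa [lt_div_iff_mul_lt, one_mul]
          rw [h1, map_mul, map_mul]
          exact mul_lt_of_lt_one_left (zero_lt_iff.2 (ht _)) (htlt _ h2) }
    have hv : ∀ r c, O.valuation (g (MonoidAlgebra.single r c)) * v.reif r = v.val c := by
      intro r c
      change _ * O.valuation (t r⁻¹) = O.valuation (g (MonoidAlgebra.single 1 c))
      rw [hsingle, ← map_mul, mul_assoc, ← map_mul, mul_inv_cancel, map_one, mul_one]
    refine ⟨v, fun r a ha => ?_, ?_⟩
    · have := hO ⟨_, single_mem_rees (C_mem_plusPoly (q := q) ha)⟩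
      simp only [RingHom.comp_apply, Subring.subtype_apply, hF, eval₂_C] at this
      rw [← hv r]
      exact mul_le_of_le_one_left zero_le this
    · have := hO' _ (single_mem_reesIdeal (X_mem_nilPoly (T := T) (q := q)))
      simp only [RingHom.comp_apply, Subring.subtype_apply, hF, eval₂_X] at this
      rw [← hv q⁻¹]
      exact mul_lt_of_lt_one_left (zero_lt_iff.2 (v.reif_ne_zero _)) this

end Rees

end Readic

namespace Readic

/-! ### Integrality and power-boundedness -/

section Integral

variable {B : Type u} [SeminormedCommRing B] [IsUltrametricDist B] {T : Subring (Gr B)}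
  {q : PosReal}

/-- The relation trades a factor b^(j+1) for c_j, which has the same weight q^(j+1). Repeated use
lowers the power of b below L, and the ultrametric inequality keeps the constant unchanged. -/
theorem isPowerBounded_of_pow_eq {L N : ℕ} {b : B} {c : Fin N → B} (hN : N ≤ L)
    (hc : ∀ j : Fin N, IsPowerBounded (q ^ ((j : ℕ) + 1)) (c j))
    (h : b ^ L = ∑ j, c j * b ^ (L - (j + 1))) : IsPowerBounded q b := by
  classical
  have hq := q.2
  obtain ⟨W, hW⟩ : ∃ W : Fin N → PosReal, ∀ j, W j = q ^ ((j : ℕ) + 1) := ⟨_, fun _ => rfl⟩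
  obtain ⟨K, hK, hKm⟩ := exists_norm_prod_pow_le Finset.univ c W fun j => hW j ▸ hc j
  have hW0 : ∀ e : Fin N → ℕ, 0 ≤ ∏ i, (W i : ℝ) ^ e i := fun e =>
    Finset.prod_nonneg fun i _ => pow_nonneg (W i).2.le _
  let K' : ℝ := ∑ i ∈ Finset.range L, ‖b ^ i‖ / (q : ℝ) ^ i
  have hK'0 : 0 ≤ K' := Finset.sum_nonneg fun i _ => div_pow_nonneg _ _ _
  have hK' : ∀ n < L, ‖b ^ n‖ ≤ K' * (q : ℝ) ^ n := fun n hn => by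
    rw [← div_le_iff₀ (by positivity)]
    exact Finset.single_le_sum (f := fun i => ‖b ^ i‖ / (q : ℝ) ^ i)
      (fun i _ => div_pow_nonneg _ _ _) (Finset.mem_range.2 hn)
  -- The statement includes all monomials in the c_j, since each reduction step produces another
  -- such factor.
  have key : ∀ n, ∀ e : Fin N → ℕ, ‖(∏ i, c i ^ e i) * b ^ n‖ ≤
      K * K' * ((∏ i, (W i : ℝ) ^ e i) * (q : ℝ) ^ n) := by
    intro n
    induction n using Nat.strong_induction_on with
    | _ n ih =>
      intro e
      rcases lt_or_ge n L with hn | hn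
      · calc _ ≤ (K * ∏ i, (W i : ℝ) ^ e i) * (K' * (q : ℝ) ^ n) :=
              (norm_mul_le _ _).trans (mul_le_mul (hKm e) (hK' n hn) (norm_nonneg _)
                (mul_nonneg hK.le (hW0 e)))
          _ = _ := by ring
      · have hbn : b ^ n = ∑ j, c j * b ^ (n - (j + 1)) := by
          rw [← Nat.sub_add_cancel hn, pow_add, h, Finset.mul_sum]
          refine Finset.sum_congr rfl fun j _ => ?_
          rw [mul_left_comm, ← pow_add]
          congr 2
          have := j.2
          omega
        rw [hbn, Finset.mul_sum]
        refine IsUltrametricDist.norm_sum_le_of_forall_le_of_nonneg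
          (mul_nonneg (mul_nonneg hK.le hK'0) (mul_nonneg (hW0 e) (by positivity)))
          fun j _ => ?_
        have hj := j.2
        have h1 := ih (n - (j + 1)) (by omega) (e + Pi.single j 1)
        have h2 : ∏ i, (W i : ℝ) ^ (Pi.single j 1 : Fin N → ℕ) i = W j := by
          rw [Finset.prod_eq_single j (fun i _ hi => by simp [hi]) (by simp)]
          simp
        have h2' : ∏ i, c i ^ (Pi.single j 1 : Fin N → ℕ) i = c j := by
          rw [Finset.prod_eq_single j (fun i _ hi => by simp [hi]) (by simp)]
          simp
        simp only [Pi.add_apply, pow_add, Finset.prod_mul_distrib] at h1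
        rw [h2', h2, mul_assoc] at h1
        refine h1.trans_eq ?_
        rw [mul_assoc (∏ i, _)]
        congr 2
        rw [hW, Positive.val_pow, ← pow_add]
        congr 1
        omega
  refine ⟨K * K', fun n _ => ?_⟩
  rw [div_le_iff₀ (by positivity)]
  simpa using key n 0

theorem grClass_congr {r s : PosReal} {a b : B} (hrs : r = s) (hab : a = b)
    (ha : a ∈ powerBounded B r) (hb : b ∈ powerBounded B s) :
    grClass r a ha = grClass s b hb := by
  subst hrs hab; rfl

omit [IsUltrametricDist B] in
theorem IsPowerBounded.pow {r : PosReal} {a : B} (h : IsPowerBounded r a) (n : ℕ) :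
    IsPowerBounded (r ^ n) (a ^ n) := by
  induction n with
  | zero => simpa using isPowerBounded_one
  | succ n ih => rw [pow_succ, pow_succ]; exact ih.mul h

theorem grClass_pow {r : PosReal} {a : B} (h : a ∈ powerBounded B r) (n : ℕ) :
    grClass (r ^ n) (a ^ n) (IsPowerBounded.pow h n) = grClass r a h ^ n := by
  induction n with
  | zero =>
    exact (grClass_congr (pow_zero r) (pow_zero a) _ isPowerBounded_one).trans
      (grClass_one.trans (pow_zero _).symm)
  | succ n ih =>
    refine (grClass_congr (pow_succ r n) (pow_succ a n) _
      (IsPowerBounded.mul (IsPowerBounded.pow h n) h)).trans ?_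
    rw [grClass_mul (IsPowerBounded.pow h n) h, ih, pow_succ]

/-- The projection of the group `B^{∘,r}` to the graded ring. -/
noncomputable def grHom (B : Type u) [SeminormedCommRing B] [IsUltrametricDist B] (r : PosReal) :
    powerBounded B r →+ Gr B :=
  AddMonoidHom.mk' (fun a => grClass r a.1 a.2) fun a b => grClass_add r a.1 b.1 a.2 b.2

/-- Power-boundedness comes from the same relation. Reading the relation in degree q^L of the graded
ring then exhibits the class of b as a root of a monic polynomial over T. -/
theorem mem_plus_of_pow_eq (hT : ∀ y : Gr B, IsIntegral T y → y ∈ T) {L N : ℕ} {b : B}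
    {c : Fin N → B} (hN : N ≤ L) (hc : ∀ j : Fin N, c j ∈ plus T (q ^ ((j : ℕ) + 1)))
    (h : b ^ L = ∑ j, c j * b ^ (L - (j + 1))) : b ∈ plus T q := by
  have hb : b ∈ powerBounded B q :=
    isPowerBounded_of_pow_eq hN (fun j => isPowerBounded_of_mem_plus (hc j)) h
  refine ⟨hb, hT _ ?_⟩
  have hdeg : ∀ j : Fin N, q ^ ((j : ℕ) + 1) * q ^ (L - (j + 1)) = q ^ L := fun j => by
    have := j.2
    rw [← pow_add]
    congr 1
    omega
  have hterm : ∀ j : Fin N, c j * b ^ (L - (j + 1)) ∈ powerBounded B (q ^ L) := fun j => by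
    rw [← hdeg j]
    exact (isPowerBounded_of_mem_plus (hc j)).mul (IsPowerBounded.pow hb _)
  have hrel : grClass q b hb ^ L =
      ∑ j, grClass _ (c j) (hc j).1 * grClass q b hb ^ (L - (j + 1)) := by
    have e : (⟨b ^ L, IsPowerBounded.pow hb L⟩ : powerBounded B (q ^ L)) =
        ∑ j, ⟨_, hterm j⟩ := by
      ext
      rw [AddSubgroup.val_finsetSum]
      exact h
    have e' := congrArg (grHom B (q ^ L)) e
    rw [map_sum] at e'
    rw [← grClass_pow hb L]
    refine e'.trans (Finset.sum_congr rfl fun j _ => ?_)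
    rw [← grClass_pow hb, ← grClass_mul (hc j).1 (IsPowerBounded.pow hb _)]
    exact grClass_congr (hdeg j).symm rfl _ _
  let P : Polynomial T :=
    ∑ j : Fin N, Polynomial.C ⟨_, (hc j).2⟩ * Polynomial.X ^ (L - ((j : ℕ) + 1))
  have hP : P.degree < L := by
    refine (Polynomial.degree_sum_le _ _).trans_lt ((Finset.sup_lt_iff (WithBot.bot_lt_coe _)).2
      fun j _ => (Polynomial.degree_C_mul_X_pow_le _ _).trans_lt ?_)
    have := j.2
    exact_mod_cast (by omega : L - ((j : ℕ) + 1) < L)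
  refine ⟨Polynomial.X ^ L - P, Polynomial.monic_X_pow_sub hP, ?_⟩
  rw [Polynomial.eval₂_sub, Polynomial.eval₂_X_pow, hrel, Polynomial.eval₂_finsetSum, sub_eq_zero]
  refine Finset.sum_congr rfl fun j _ => ?_
  rw [Polynomial.eval₂_mul, Polynomial.eval₂_C, Polynomial.eval₂_X_pow]
  rfl

/-- The element 1 - a divides 1 - aⁿ, which is a unit as soon as ‖aⁿ‖ < 1. No bound on ‖a‖ itself is
available, so the geometric series is used only in truncated form. -/
theorem IsTopNilpotent.exists_mul_one_sub_eq_one {B : Type*} [NormedCommRing B]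
    [IsUltrametricDist B] [CompleteSpace B] {a : B} (h : IsTopNilpotent 1 a) :
    ∃ u : B, u * (1 - a) = 1 ∧ IsTopNilpotent 1 (u - 1) := by
  have h' : Tendsto (fun n : ℕ => ‖a ^ n‖) atTop (𝓝 0) := by simpa [IsTopNilpotent] using h
  obtain ⟨n, hn, hn0⟩ := ((h'.eventually (gt_mem_nhds one_pos)).and
    (eventually_ge_atTop 1)).exists
  have hu : IsUnit (1 - a) := isUnit_of_dvd_unit (by simpa using sub_dvd_pow_sub_pow 1 a n)
    (isUnit_one_sub_of_norm_lt_one hn)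
  obtain ⟨u, hu⟩ := hu.exists_left_inv
  have hsum : ∀ n, u - 1 = ∑ i ∈ Finset.range n, a ^ (i + 1) + a ^ (n + 1) * u := by
    intro n
    have h1 : u = 1 + a * u := by linear_combination hu
    induction n with
    | zero => simp; linear_combination h1
    | succ n ih =>
      rw [ih, Finset.sum_range_succ]
      linear_combination a ^ (n + 1) * h1
  refine ⟨u, hu, ?_⟩
  have h2 : Tendsto (fun n : ℕ => ‖a ^ (n + 1)‖ * ‖u‖) atTop (𝓝 0) := by
    simpa using ((tendsto_add_atTop_iff_nat 1).2 h').mul_const ‖u‖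
  -- For this n the remainder a^(n+1) u has norm below 1 and is therefore topologically nilpotent,
  -- as is each a^(i+1).
  obtain ⟨n, hn⟩ := (h2.eventually (gt_mem_nhds one_pos)).exists
  rw [hsum n]
  refine (topNilpotent B 1).add_mem (sum_mem fun i _ => ?_)
    (isTopNilpotent_of_norm_lt ((norm_mul_le _ _).trans_lt hn))
  change Tendsto _ _ _
  simp only [Positive.val_one, one_pow, div_one, ← pow_mul]
  exact h'.comp (tendsto_id.const_mul_atTop' (Nat.succ_pos i))

end Integral

/-! ### Units and bounds are detected by the adic spectrum -/

section Detect

variable {B : Type u} [NormedCommRing B] [IsUltrametricDist B] [CompleteSpace B]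
  {T : Subring (Gr B)}

/-- A nonunit lies in a maximal ideal m, and a point coming from B/m would vanish on it. The other
alternative gives 1 - a ∈ m with a topologically nilpotent, which is absurd because 1 - a is a unit.
-/
theorem isUnit_of_forall_val_ne_zero {g : B} (h : ∀ x : Spra T, x.v.val g ≠ 0) : IsUnit g := by
  by_contra hg
  obtain ⟨m, hm, hgm⟩ := exists_max_ideal_of_mem_nonunits hg
  -- With β = 0 the condition on v(β) is void and P evaluates to its constant coefficient.
  rcases exists_reifiedSemivaluation_or T 1 (Ideal.Quotient.mk m) 0 with
    ⟨v, hv, -⟩ | ⟨P, -, hP, h1⟩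
  · obtain ⟨h', x, hx⟩ := Spra.exists_of_retract (S := T) (v.comap (Ideal.Quotient.mk m)) hv
    refine h x ((ReifiedSemivaluation.val_eq_zero_iff_of_rel_eq hx g).2 ?_)
    have h0 : (v.comap (Ideal.Quotient.mk m)).val g = 0 := by
      change v.val (Ideal.Quotient.mk m g) = 0
      rw [Ideal.Quotient.eq_zero_iff_mem.2 hgm, map_zero]
    exact le_zero_iff.1 ((ReifiedSemivaluation.retract_val_le _ h' g).trans_eq h0)
  · rw [← P.divX_mul_X_add, Polynomial.eval₂_add, Polynomial.eval₂_mul, Polynomial.eval₂_X,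
      Polynomial.eval₂_C, mul_zero, zero_add] at h1
    obtain ⟨u, hu, -⟩ := hP.exists_mul_one_sub_eq_one
    refine hm.ne_top ((Ideal.eq_top_iff_one m).2 (hu ▸ m.mul_mem_left u ?_))
    rw [← Ideal.Quotient.eq_zero_iff_mem, map_sub, h1, map_one, sub_self]

/-- The alternative is applied to B[1/b] with β = 1/b. A semivaluation with v(β) < q⁻¹ has v(b) > q,
against the hypothesis; otherwise clearing denominators in P(1/b) = 1 gives an integral equation for
b. -/
theorem mem_plus_of_forall_val_le (hT : ∀ y : Gr B, IsIntegral T y → y ∈ T) {b : B} {q : PosReal}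
    (h : ∀ x : Spra T, x.v.val b ≤ x.v.reif q) : b ∈ plus T q := by
  let φ := algebraMap B (Localization.Away b)
  have hβ : φ b * IsLocalization.Away.invSelf b = 1 := IsLocalization.Away.mul_invSelf b
  rcases exists_reifiedSemivaluation_or T q φ (IsLocalization.Away.invSelf b) with
    ⟨v, hv, hlt⟩ | ⟨P, hPj, hP, h1⟩
  · exfalso
    obtain ⟨h', x, hx⟩ := Spra.exists_of_retract (S := T) (v.comap φ) hv
    have hgt : v.reif q < v.val (φ b) := by
      by_contra hle
      have h2 : v.val (φ b) * v.val (IsLocalization.Away.invSelf b) < 1 :=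
        calc _ ≤ v.reif q * v.val (IsLocalization.Away.invSelf b) := by
              gcongr; exact not_lt.1 hle
          _ < v.reif q * v.reif q⁻¹ := by
              exact mul_lt_mul_of_pos_left hlt (v.reif_pos q)
          _ = 1 := v.reif_mul_inv q
      rw [← map_mul, hβ, map_one] at h2
      exact lt_irrefl _ h2
    have h3 := (ReifiedSemivaluation.val_le_reif_iff_of_rel_eq hx b q).1 (h x)
    -- The retraction keeps the value of b, which exceeds the real number q.
    rw [ReifiedSemivaluation.retract_val_of_le _ h' (r := q) hgt.le] at h3
    exact h3.not_gt hgt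
  · obtain ⟨u, hu, hu1⟩ := hP.exists_mul_one_sub_eq_one
    have hu' : u ∈ plus T 1 := by
      have := (plusGroup T 1).add_mem (IsTopNilpotent.mem_plus hu1) one_mem_plus
      rwa [sub_add_cancel] at this
    let N := P.natDegree
    have h2 : φ (b ^ N) = φ (∑ i ∈ Finset.range (N + 1), P.coeff i * b ^ (N - i)) := by
      rw [map_pow, ← mul_one (φ b ^ N), ← h1, Polynomial.eval₂_eq_sum_range, Finset.mul_sum, map_sum]
      refine Finset.sum_congr rfl fun i hi => ?_
      have hi' : i ≤ N := Nat.lt_succ_iff.1 (Finset.mem_range.1 hi)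
      rw [map_mul, map_pow]
      conv_lhs => rw [← Nat.sub_add_cancel hi', pow_add]
      calc _ = φ (P.coeff i) * φ b ^ (N - i) * (φ b * IsLocalization.Away.invSelf b) ^ i := by
            ring
        _ = _ := by rw [hβ, one_pow, mul_one]
    -- An identity in B[1/b] holds in B only after multiplication by some b^M, hence the exponent M
    -- + N below.
    obtain ⟨⟨_, M, rfl⟩, h3⟩ := (IsLocalization.eq_iff_exists (Submonoid.powers b) _).1 h2
    dsimp only at h3
    -- The term with i = 0 is split off: moved to the other side it gives the factor 1 - P₀, whose
    -- inverse u lies in B^{+,1}.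
    rw [Finset.sum_range_succ', mul_add, Nat.sub_zero] at h3
    refine mem_plus_of_pow_eq hT (L := M + N) (N := N) (c := fun j => u * P.coeff (j + 1))
      (by omega) (fun j => ?_) ?_
    · have := plus_mul hu' (hPj (j + 1))
      rwa [one_mul] at this
    · have h4 : ∑ j : Fin N, u * P.coeff (j + 1) * b ^ (M + N - (j + 1)) =
          u * (b ^ M * ∑ i ∈ Finset.range N, P.coeff (i + 1) * b ^ (N - (i + 1))) := by
        rw [Fin.sum_univ_eq_sum_range (fun j => u * P.coeff (j + 1) * b ^ (M + N - (j + 1))),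
          Finset.mul_sum, Finset.mul_sum]
        refine Finset.sum_congr rfl fun i hi => ?_
        have hi' := Finset.mem_range.1 hi
        rw [show M + N - (i + 1) = M + (N - (i + 1)) by omega, pow_add]
        ring
      rw [h4, pow_add]
      linear_combination u * h3 - b ^ M * b ^ N * hu

end Detect

end Readic

namespace Readic

/-! ### Functoriality of the graded ring -/

section GrMap

variable {A : Type u} {B : Type w} [SeminormedCommRing A] [IsUltrametricDist A]
  [SeminormedCommRing B] [IsUltrametricDist B] {φ : A →+* B}

/-- The homomorphism on the rings `⨁_r A^{∘,r}` induced by a bounded homomorphism. -/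
noncomputable def grPreMap (h : IsBoundedHom φ) : grPre A →+* grPre B :=
  (MonoidAlgebra.mapRingHom PosReal φ).restrict (grPre A) (grPre B) fun x hx r => by
    rw [MonoidAlgebra.coeff_mapRingHom]
    exact IsPowerBounded.map h (hx r)

/-- The homomorphism on graded rings induced by a bounded homomorphism. -/
noncomputable def grMap (h : IsBoundedHom φ) : Gr A →+* Gr B :=
  Ideal.quotientMap (grIdeal B) (grPreMap h) fun x hx r => by
    change (MonoidAlgebra.mapRingHom PosReal φ x.1).coeff r ∈ _
    rw [MonoidAlgebra.coeff_mapRingHom]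
    exact IsTopNilpotent.map h (hx r)

theorem grMap_grClass (h : IsBoundedHom φ) {r : PosReal} {a : A} (ha : a ∈ powerBounded A r) :
    grMap h (grClass r a ha) = grClass r (φ a) (IsPowerBounded.map h ha) := by
  refine (Ideal.quotientMap_mk ..).trans ?_
  refine congrArg (grMk B) (Subtype.ext ?_)
  exact MonoidAlgebra.map_single ..

end GrMap

/-! ### Rational localizations depend only on their subspaces -/

namespace RationalDatum

variable {A : Type u} [NormedCommRing A] [IsUltrametricDist A] (D : RationalDatum A)
  (S : Subring (Gr A))

/-- The set of generators of the graded subring of a rational localization. -/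
def locGrGenerators : Set (Gr D.Loc) :=
  {y : Gr D.Loc | ∃ (r : PosReal) (a : A) (h : D.toLoc a ∈ powerBounded D.Loc r),
      a ∈ plus S r ∧ y = grClass r (D.toLoc a) h} ∪
    {y : Gr D.Loc | ∃ (i : Fin D.n) (h : D.ofPoly (MvPolynomial.X i) ∈ powerBounded D.Loc (D.q i)),
      y = grClass (D.q i) (D.ofPoly (MvPolynomial.X i)) h}

variable {S D}

theorem mem_locGr {y : Gr D.Loc} :
    y ∈ D.locGr S ↔ IsIntegral (Subring.closure (D.locGrGenerators S)) y := Iff.rfl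

theorem mem_locGr_of_mem {y : Gr D.Loc} (h : y ∈ D.locGrGenerators S) : y ∈ D.locGr S :=
  mem_locGr.2 (isIntegral_algebraMap (R := Subring.closure (D.locGrGenerators S))
    (x := ⟨y, Subring.subset_closure h⟩))

theorem mem_locGr_of_isIntegral (y : Gr D.Loc) (h : IsIntegral (D.locGr S) y) : y ∈ D.locGr S := by
  rw [mem_locGr]
  exact isIntegral_trans
    (A := integralClosure (Subring.closure (D.locGrGenerators S)) (Gr D.Loc)) y h

theorem toLoc_mem_plus {r : PosReal} {a : A} (h : a ∈ plus S r) :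
    D.toLoc a ∈ plus (D.locGr S) r :=
  have hb := (isPowerBounded_of_mem_plus h).map D.isBoundedHom_toLoc
  ⟨hb, mem_locGr_of_mem (Or.inl ⟨r, a, hb, h, rfl⟩)⟩

theorem T_mem_plus (i : Fin D.n) : D.T i ∈ plus (D.locGr S) (D.q i) :=
  ⟨D.isPowerBounded_T i, mem_locGr_of_mem (Or.inr ⟨i, D.isPowerBounded_T i, rfl⟩)⟩

theorem mem_subspace {x : Spra S} : x ∈ D.subspace S ↔
    x.v.val D.f₀ ≠ 0 ∧ ∀ i, x.v.val (D.f i) ≤ x.v.reif (D.q i) * x.v.val D.f₀ := Iff.rfl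

/-- Only this direction of the comparison between the spectrum of the localization and the rational
subspace is needed: it turns inequalities on the subspace into inequalities at all points of the
localization. -/
theorem exists_mem_subspace_rel_eq (x : Spra (D.locGr S)) :
    ∃ y : Spra S, y ∈ D.subspace S ∧ y.v.rel = (x.v.comap D.toLoc).rel := by
  obtain ⟨y, hy⟩ := Spra.exists_of_reifiedSemivaluation (S := S) (x.v.comap D.toLoc)
    (fun r a ha => x.val_le_of_mem_plus (toLoc_mem_plus ha)) (fun a ha => x.exists_le_val ha)
  refine ⟨y, mem_subspace.2 ⟨?_, fun i => ?_⟩, hy⟩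
  · rw [Ne, ReifiedSemivaluation.val_eq_zero_iff_of_rel_eq hy]
    intro h0
    have h0' : x.v.val (D.toLoc D.f₀) = 0 := h0
    exact (D.isUnit_toLoc_f₀.map x.v.val).ne_zero h0'
  · rw [ReifiedSemivaluation.val_le_iff_of_rel_eq hy]
    change x.v.val (D.toLoc (D.f i)) ≤ x.v.reif (D.q i) * x.v.val (D.toLoc D.f₀)
    rw [← toLoc_mul_T, map_mul, mul_comm]
    gcongr
    exact x.val_le_of_mem_plus (T_mem_plus i)

theorem isUnit_toLoc {g : A} (h : ∀ y ∈ D.subspace S, y.v.val g ≠ 0) : IsUnit (D.toLoc g) := by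
  refine isUnit_of_forall_val_ne_zero (T := D.locGr S) fun x hx => ?_
  obtain ⟨y, hy, hxy⟩ := exists_mem_subspace_rel_eq x
  exact h y hy ((ReifiedSemivaluation.val_eq_zero_iff_of_rel_eq hxy g).2 hx)

/-- The fraction f/g exists because g becomes a unit, and it lies in the plus group because its
value is at most q at every point of the localization. -/
theorem exists_mul_eq {f g : A} {q : PosReal}
    (h : ∀ y ∈ D.subspace S, y.v.val g ≠ 0 ∧ y.v.val f ≤ y.v.reif q * y.v.val g) :
    ∃ b ∈ plus (D.locGr S) q, D.toLoc g * b = D.toLoc f := by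
  obtain ⟨u, hu⟩ := (isUnit_toLoc fun y hy => (h y hy).1).exists_right_inv
  have hb : D.toLoc g * (u * D.toLoc f) = D.toLoc f := by rw [← mul_assoc, hu, one_mul]
  refine ⟨u * D.toLoc f, mem_plus_of_forall_val_le mem_locGr_of_isIntegral fun x => ?_, hb⟩
  obtain ⟨y, hy, hxy⟩ := exists_mem_subspace_rel_eq x
  have h1 : x.v.val (D.toLoc f) ≤ x.v.reif q * x.v.val (D.toLoc g) :=
    (ReifiedSemivaluation.val_le_iff_of_rel_eq hxy f q g).1 (h y hy).2
  have h2 : x.v.val u * x.v.val (D.toLoc g) = 1 := by rw [← map_mul, mul_comm, hu, map_one]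
  calc x.v.val (u * D.toLoc f) = x.v.val u * x.v.val (D.toLoc f) := map_mul _ _ _
    _ ≤ x.v.val u * (x.v.reif q * x.v.val (D.toLoc g)) := by gcongr
    _ = x.v.reif q := by rw [mul_left_comm, h2, mul_one]

/-- The graded subring of the target is integrally closed, so only the generators from A and from
the variables have to be checked. -/
theorem isMorphism_of_T_mem_plus {D' : RationalDatum A} {ψ : D'.Loc →+* D.Loc}
    (hψ : IsBoundedHom ψ) (hc : ψ.comp D'.toLoc = D.toLoc)
    (hT : ∀ i, ψ (D'.T i) ∈ plus (D.locGr S) (D'.q i)) :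
    IsMorphism ψ (D'.locGr S) (D.locGr S) := by
  refine ⟨hψ, fun r a ⟨ha, hai⟩ => ⟨ha.map hψ, ?_⟩⟩
  have hle : Subring.closure (D'.locGrGenerators S) ≤ (D.locGr S).comap (grMap hψ) := by
    rw [Subring.closure_le]
    rintro _ (⟨r, a, h, ha, rfl⟩ | ⟨i, h, rfl⟩) <;>
    rw [SetLike.mem_coe, Subring.mem_comap, grMap_grClass]
    · obtain ⟨h1, h2⟩ := toLoc_mem_plus (D := D) ha
      have e : ψ (D'.toLoc a) = D.toLoc a := RingHom.congr_fun hc a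
      exact (congrArg (· ∈ D.locGr S) (grClass_congr rfl e _ h1)).mpr h2
    · exact (hT i).2
  have := hai.map_of_comp_eq (((grMap hψ).comp (Subring.subtype _)).codRestrict (D.locGr S)
    fun x => hle x.2) (grMap hψ) rfl
  rw [grMap_grClass] at this
  exact mem_locGr_of_isIntegral _ this

/-- On the smaller subspace the fractions f'ᵢ/f'₀ exist with the required bounds, so the universal
property of D' applies. -/
theorem exists_isMorphism {D' : RationalDatum A} (h : D.subspace S ⊆ D'.subspace S) :
    ∃ ψ : D'.Loc →+* D.Loc, IsMorphism ψ (D'.locGr S) (D.locGr S) ∧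
      ψ.comp D'.toLoc = D.toLoc := by
  have hb : ∀ i, ∃ b ∈ plus (D.locGr S) (D'.q i), D.toLoc D'.f₀ * b = D.toLoc (D'.f i) :=
    fun i => exists_mul_eq fun y hy => ⟨(mem_subspace.1 (h hy)).1, (mem_subspace.1 (h hy)).2 i⟩
  choose b hbp hbe using hb
  obtain ⟨ψ, hψ, hc, hT⟩ := D'.exists_lift D.isBoundedHom_toLoc
    (fun i => isPowerBounded_of_mem_plus (hbp i)) hbe
  exact ⟨ψ, isMorphism_of_T_mem_plus hψ hc fun i => by rw [hT]; exact hbp i, hc⟩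

end RationalDatum

/-! ### Sections over rational subspaces -/

section Sections

variable {A : Type u} [NormedCommRing A] [IsUltrametricDist A] {S : Subring (Gr A)}

open RationalDatum

/-- A datum that defines U maps to every other datum in the limit; thus its component determines the
section. Together with `exists_section` this identifies the sections over U with `D.Loc`. -/
theorem sections_ext {U : Set (Spra S)} {D : RationalDatum A} (hD : D.subspace S = U)
    {s t : sections S U} (h : s.1 ⟨D, hD.subset⟩ = t.1 ⟨D, hD.subset⟩) : s = t := by
  refine Subtype.ext (funext fun D' => ?_)
  obtain ⟨ψ, hψ, hc⟩ := exists_isMorphism (D'.2.trans hD.symm.subset)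
  rw [← s.2 ⟨D, hD.subset⟩ D' ψ hψ hc, h, t.2 ⟨D, hD.subset⟩ D' ψ hψ hc]

theorem exists_section {U : Set (Spra S)} {D : RationalDatum A} (hD : D.subspace S = U)
    (b : D.Loc) : ∃ s : sections S U, s.1 ⟨D, hD.subset⟩ = b := by
  have h : ∀ D' : {D' : RationalDatum A // D'.subspace S ⊆ U}, ∃ ψ : D.Loc →+* D'.1.Loc,
      IsMorphism ψ (D.locGr S) (D'.1.locGr S) ∧ ψ.comp D.toLoc = D'.1.toLoc :=
    fun D' => exists_isMorphism (D'.2.trans hD.symm.subset)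
  choose ψ hψ hc using h
  refine ⟨⟨fun D' => ψ D' b, fun D' D'' φ hφ hφc => ?_⟩, ?_⟩
  · have : φ.comp (ψ D') = ψ D'' :=
      D.hom_ext (IsBoundedHom.comp hφ.bounded (hψ D').bounded) (hψ D'').bounded
        (by rw [RingHom.comp_assoc, hc, hφc, hc])
    exact RingHom.congr_fun this b
  · have : ψ ⟨D, hD.subset⟩ = RingHom.id _ :=
      D.hom_ext (hψ ⟨D, hD.subset⟩).bounded IsBoundedHom.id (by rw [hc, RingHom.id_comp])
    exact RingHom.congr_fun this b

variable (A) in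
/-- The rational datum with parameters `f₀ = f₁ = 1`, which defines the whole space. -/
def trivialDatum : RationalDatum A where
  n := 1
  f₀ := 1
  f _ := 1
  q _ := 1
  span_eq_top := by
    rw [Ideal.eq_top_iff_one]
    exact Ideal.subset_span ⟨0, rfl⟩

theorem trivialDatum_subspace : (trivialDatum A).subspace S = Set.univ :=
  Set.eq_univ_of_forall fun x => mem_subspace.2 ⟨by simp [trivialDatum], by simp [trivialDatum]⟩

/-- Sending the variable to 1 gives an inverse, by completeness of A and uniqueness of bounded
homomorphisms out of the localization. -/
theorem trivialDatum_toLoc_bijective [CompleteSpace A] :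
    Function.Bijective (trivialDatum A).toLoc := by
  obtain ⟨σ, hσ, hc, -⟩ := (trivialDatum A).exists_lift (φ := RingHom.id A) IsBoundedHom.id
    (b := fun _ => 1) (fun _ => isPowerBounded_one) (fun _ => by simp [trivialDatum])
  have h : ((trivialDatum A).toLoc).comp σ = RingHom.id _ :=
    hom_ext _ ((trivialDatum A).isBoundedHom_toLoc.comp hσ) IsBoundedHom.id
      (by rw [RingHom.comp_assoc, hc]; rfl)
  exact Function.bijective_iff_has_inverse.2
    ⟨σ, RingHom.congr_fun hc, RingHom.congr_fun h⟩

theorem toGlobal_bijective [CompleteSpace A] (S : Subring (Gr A)) :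
    Function.Bijective (toGlobal S) := by
  have hD : (trivialDatum A).subspace S =
      ((⊤ : Opens (TopCat.of (Spra S))) : Set (Spra S)) := trivialDatum_subspace
  constructor
  · intro a b hab
    refine trivialDatum_toLoc_bijective.1 ?_
    exact congrArg (fun s : sections S _ => s.1 ⟨trivialDatum A, hD.subset⟩) hab
  · intro s
    obtain ⟨a, ha⟩ := trivialDatum_toLoc_bijective.2
      ((s : sections S _).1 ⟨trivialDatum A, hD.subset⟩)
    exact ⟨a, sections_ext hD ha⟩

end Sections

end Readic

namespace Readic

/-! ### Laurent decompositions -/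

section Laurent

theorem prod_zpow_pow {G : Type*} [CommGroup G] {ι : Type*} (s : Finset ι) (z : G) (e : ι → ℤ)
    (m : ι → ℕ) : ∏ i ∈ s, (z ^ e i) ^ m i = z ^ ∑ i ∈ s, e i * m i := by
  classical
  induction s using Finset.induction_on with
  | empty => simp
  | insert i s hi ih =>
    rw [Finset.prod_insert hi, Finset.sum_insert hi, ih, zpow_add, zpow_mul, zpow_natCast]

/-- The exponent of `z` in the monomial `∏ (y_i z ^ e_i) ^ m_i`. -/
def laurentDegree {n : ℕ} (e : Fin n → ℤ) (m : Fin n →₀ ℕ) : ℤ := ∑ i, e i * m i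

theorem weight_laurent {n : ℕ} {p : Fin n → PosReal} {q : PosReal} {e : Fin n → ℤ}
    {w : Fin n → PosReal} (hw : ∀ i, w i = p i * q ^ e i) (m : Fin n →₀ ℕ) :
    (weight w m : ℝ) =
      (∏ i, (p i : ℝ) ^ m i) * ((q ^ laurentDegree e m : PosReal) : ℝ) := by
  rw [coe_weight]
  have h : ∏ i, w i ^ m i = (∏ i, p i ^ m i) * q ^ laurentDegree e m := by
    simp only [hw, mul_pow, Finset.prod_mul_distrib, prod_zpow_pow]
    rfl
  have hc : ∀ f : Fin n → PosReal, ((∏ i, f i : PosReal) : ℝ) = ∏ i, (f i : ℝ) := fun f =>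
    map_prod (⟨⟨Subtype.val, rfl⟩, fun _ _ => rfl⟩ : PosReal →* ℝ) f Finset.univ
  have := congrArg (Subtype.val : PosReal → ℝ) h
  rw [Positive.val_mul, hc, hc] at this
  simpa only [Positive.val_pow] using this

open Classical in
/-- The monomials of `A[T₁, …, Tₙ]` whose Laurent degree satisfies `c`, evaluated by substituting
`ψ(y_i)` for `T_i` and multiplying by the power of `z` given by the absolute Laurent degree. -/
noncomputable def laurentPart {A B : Type*} [CommRing A] [CommRing B] {n : ℕ} (φ : A →+* B)
    (y : Fin n → B) (e : Fin n → ℤ) (c : ℤ → Prop) (z : B) : MvPolynomial (Fin n) A →+ B :=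
  (Finsupp.liftAddHom fun m : Fin n →₀ ℕ =>
    if c (laurentDegree e m) then
      (AddMonoidHom.mulRight ((∏ i, y i ^ m i) * z ^ (laurentDegree e m).natAbs)).comp
        φ.toAddMonoidHom
    else 0).comp AddMonoidAlgebra.coeffAddEquiv.toAddMonoidHom

open Classical in
theorem laurentPart_monomial {A B : Type*} [CommRing A] [CommRing B] {n : ℕ} (φ : A →+* B)
    (y : Fin n → B) (e : Fin n → ℤ) (c : ℤ → Prop) (z : B) (m : Fin n →₀ ℕ)
    (a : A) :
    laurentPart φ y e c z (MvPolynomial.monomial m a) = if c (laurentDegree e m) then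
      φ a * ((∏ i, y i ^ m i) * z ^ (laurentDegree e m).natAbs) else 0 := by
  refine (Finsupp.liftAddHom_apply_single _ m a).trans ?_
  split_ifs <;> rfl

/-- By `hc` the power of z substituted for a Laurent degree d has weight q^d, the share of d in the
Gauss weight. It will be used with (z₁, q) for d ≥ 0 and with (z₂, q⁻¹) for d < 0. -/
theorem norm_laurentPart_le {A B : Type u} [NormedCommRing A] [IsUltrametricDist A]
    [NormedCommRing B] [IsUltrametricDist B] {n : ℕ} {φ : A →+* B} (hφ : IsBoundedHom φ)
    {y : Fin n → B} {p : Fin n → PosReal} (hy : ∀ i, IsPowerBounded (p i) (y i))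
    (e : Fin n → ℤ) (c : ℤ → Prop) {z : B} {q q' : PosReal} (hz : IsPowerBounded q' z)
    (hc : ∀ d, c d → q' ^ d.natAbs = q ^ d) {w : Fin n → PosReal}
    (hw : ∀ i, w i = p i * q ^ e i) :
    ∃ K : ℝ, ∀ x : WeightedPoly A w, ‖laurentPart φ y e c z x‖ ≤ K * ‖x‖ := by
  classical
  obtain ⟨k, hk, hφ⟩ := hφ
  obtain ⟨K, hK, hKm⟩ := exists_norm_prod_pow_le Finset.univ y p hy
  obtain ⟨C, hC1, hC⟩ := hz.exists_bound
  have hC0 : 0 < C := by linarith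
  refine ⟨k * (K * C), norm_le_of_monomial_le _ (by positivity) fun m a => ?_⟩
  rw [laurentPart_monomial]
  split_ifs with h
  · have h1 : ‖z ^ (laurentDegree e m).natAbs‖ ≤ C * ((q ^ laurentDegree e m : PosReal) : ℝ) := by
      have hq' := q'.2
      have := hC (laurentDegree e m).natAbs
      rwa [div_le_iff₀ (by positivity), ← Positive.val_pow, hc _ h] at this
    have hp : 0 ≤ ∏ i, (p i : ℝ) ^ m i :=
      Finset.prod_nonneg fun i _ => pow_nonneg (p i).2.le _
    calc _ ≤ (k * ‖a‖) * ((K * ∏ i, (p i : ℝ) ^ m i) *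
            (C * ((q ^ laurentDegree e m : PosReal) : ℝ))) :=
          (norm_mul_le _ _).trans (mul_le_mul (hφ a) ((norm_mul_le _ _).trans
            (mul_le_mul (hKm m) h1 (norm_nonneg _) (by positivity)))
            (norm_nonneg _) (by positivity))
      _ = _ := by rw [weight_laurent hw]; ring
  · rw [norm_zero]; positivity

/-- If the variables of a rational localization map to Laurent monomials in `z` with coefficients
from a common ring, then every element is the sum of a part without negative powers of `z` and a
part without positive powers of `z`. -/
theorem RationalDatum.exists_add_eq_of_laurent {A : Type u} [NormedCommRing A]
    [IsUltrametricDist A] (E : RationalDatum A) {B B₁ B₂ : Type u} [NormedCommRing B]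
    [NormedCommRing B₁] [IsUltrametricDist B₁] [CompleteSpace B₁]
    [NormedCommRing B₂] [IsUltrametricDist B₂] [CompleteSpace B₂]
    {φ : A →+* B} (hφ : IsBoundedHom φ) {y : Fin E.n → B} {p : Fin E.n → PosReal}
    (hy : ∀ i, IsPowerBounded (p i) (y i)) (e : Fin E.n → ℤ)
    {ψ₁ : B →+* B₁} (hψ₁ : IsBoundedHom ψ₁) {ψ₂ : B →+* B₂} (hψ₂ : IsBoundedHom ψ₂)
    {q : PosReal} {z₁ : B₁} (hz₁ : IsPowerBounded q z₁) {z₂ : B₂} (hz₂ : IsPowerBounded q⁻¹ z₂)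
    (hq : ∀ i, E.q i = p i * q ^ e i) {χ₁ : B₁ →+* E.Loc} (hχ₁ : IsBoundedHom χ₁)
    {χ₂ : B₂ →+* E.Loc} (hχ₂ : IsBoundedHom χ₂) (hχ : χ₁.comp ψ₁ = χ₂.comp ψ₂)
    (hχφ : (χ₁.comp ψ₁).comp φ = E.toLoc) (z : (E.Loc)ˣ) (hz : χ₁ z₁ = z)
    (hz' : χ₂ z₂ = (z⁻¹ : (E.Loc)ˣ)) (hT : ∀ i, E.T i = χ₁ (ψ₁ (y i)) * (z ^ e i : (E.Loc)ˣ))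
    (b : E.Loc) : ∃ b₁ b₂, χ₁ b₁ + χ₂ b₂ = b := by
  classical
  obtain ⟨K₁, hK₁⟩ := norm_laurentPart_le (w := E.q) (hψ₁.comp hφ) (fun i => (hy i).map hψ₁) e
    (fun d => 0 ≤ d) (q := q) hz₁ (fun d hd => by
      rw [← zpow_natCast, Int.natAbs_of_nonneg hd]) hq
  obtain ⟨K₂, hK₂⟩ := norm_laurentPart_le (w := E.q) (hψ₂.comp hφ) (fun i => (hy i).map hψ₂) e
    (fun d => ¬ 0 ≤ d) (q := q) hz₂ (fun d hd => by
      rw [← zpow_natCast, Int.ofNat_natAbs_of_nonpos (not_le.1 hd).le, inv_zpow', neg_neg]) hq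
  let θ₁ : WeightedPoly A E.q →+ B₁ :=
    laurentPart (ψ₁.comp φ) (fun i => ψ₁ (y i)) e (fun d => 0 ≤ d) z₁
  let θ₂ : WeightedPoly A E.q →+ B₂ :=
    laurentPart (ψ₂.comp φ) (fun i => ψ₂ (y i)) e (fun d => ¬ 0 ≤ d) z₂
  have hθ₁ : Continuous θ₁ := AddMonoidHomClass.continuous_of_bound θ₁ K₁ hK₁
  have hθ₂ : Continuous θ₂ := AddMonoidHomClass.continuous_of_bound θ₂ K₂ hK₂
  have hmon : ∀ m a, χ₁ (laurentPart (ψ₁.comp φ) (fun i => ψ₁ (y i)) e (fun d => 0 ≤ d) z₁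
      (MvPolynomial.monomial m a)) + χ₂ (laurentPart (ψ₂.comp φ) (fun i => ψ₂ (y i)) e
        (fun d => ¬ 0 ≤ d) z₂ (MvPolynomial.monomial m a)) =
      E.ofPoly (MvPolynomial.monomial m a) := by
    intro m a
    have hprod : E.ofPoly (MvPolynomial.monomial m a) =
        E.toLoc a * ((∏ i, χ₁ (ψ₁ (y i)) ^ m i) * (z ^ laurentDegree e m : (E.Loc)ˣ)) := by
      rw [MvPolynomial.monomial_eq, map_mul, Finsupp.prod_pow, map_prod]
      congr 1
      simp only [map_pow]
      have : ∀ i, E.ofPoly (MvPolynomial.X i) ^ m i =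
          χ₁ (ψ₁ (y i)) ^ m i * ((z ^ e i) ^ m i : (E.Loc)ˣ) := fun i => by
        rw [← T, hT, mul_pow, Units.val_pow_eq_pow_val]
      rw [Finset.prod_congr rfl fun i _ => this i, Finset.prod_mul_distrib, ← Units.coe_prod,
        prod_zpow_pow]
      rfl
    have h1 : ∀ a, χ₁ (ψ₁ (φ a)) = E.toLoc a := RingHom.congr_fun hχφ
    have h2 : ∀ b, χ₂ (ψ₂ b) = χ₁ (ψ₁ b) := RingHom.congr_fun hχ.symm
    rw [laurentPart_monomial, laurentPart_monomial, hprod]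
    by_cases hd : 0 ≤ laurentDegree e m
    · rw [if_pos hd, if_neg (not_not.2 hd), map_zero, add_zero]
      simp only [map_mul, map_prod, map_pow, RingHom.comp_apply, h1, hz]
      congr 2
      rw [← Units.val_pow_eq_pow_val, ← zpow_natCast, Int.natAbs_of_nonneg hd]
    · rw [if_neg hd, if_pos hd, map_zero, zero_add]
      simp only [map_mul, map_prod, map_pow, RingHom.comp_apply, h1, h2, hz']
      congr 2
      rw [← Units.val_pow_eq_pow_val, ← zpow_natCast,
        Int.ofNat_natAbs_of_nonpos (not_le.1 hd).le, inv_zpow', neg_neg]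
  have hpoly : ∀ x : WeightedPoly A E.q, χ₁ (θ₁ x) + χ₂ (θ₂ x) = E.ofPoly x := by
    intro x
    have : (χ₁.toAddMonoidHom.comp θ₁ + χ₂.toAddMonoidHom.comp θ₂ :
        MvPolynomial (Fin E.n) A →+ E.Loc) = E.ofPoly.toAddMonoidHom :=
      AddMonoidAlgebra.addMonoidHom_ext hmon
    exact DFunLike.congr_fun this x
  -- Only a lift t of b is decomposed. The maps θ₁ and θ₂ need not vanish on `E.ideal`, since only
  -- existence is claimed.
  obtain ⟨t, rfl⟩ := Ideal.Quotient.mk_surjective b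
  refine ⟨θ₁.extension hθ₁ t, θ₂.extension hθ₂ t, ?_⟩
  refine UniformSpace.Completion.induction_on t ?_ fun x => ?_
  · exact isClosed_eq ((hχ₁.continuous.comp (AddMonoidHom.continuous_extension θ₁ hθ₁)).add
      (hχ₂.continuous.comp (AddMonoidHom.continuous_extension θ₂ hθ₂))) E.isBoundedHom_mk.continuous
  · rw [AddMonoidHom.extension_coe, AddMonoidHom.extension_coe]
    exact hpoly x

end Laurent

end Readic

namespace Readic

/-! ### Rational subspaces -/

namespace RationalDatum

variable {A : Type u} [NormedCommRing A] [IsUltrametricDist A] {S : Subring (Gr A)}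

/-- A rational datum with parameters indexed by an arbitrary finite type. -/
noncomputable def ofFintype {ι : Type*} [Fintype ι] (f₀ : A) (f : ι → A) (q : ι → PosReal)
    (h : Ideal.span (Set.range f) = ⊤) : RationalDatum A where
  n := Fintype.card ι
  f₀ := f₀
  f := f ∘ (Fintype.equivFin ι).symm
  q := q ∘ (Fintype.equivFin ι).symm
  span_eq_top := by rwa [EquivLike.range_comp f (Fintype.equivFin ι).symm]

theorem mem_ofFintype_subspace {ι : Type*} [Fintype ι] {f₀ : A} {f : ι → A} {q : ι → PosReal}
    {h : Ideal.span (Set.range f) = ⊤} {x : Spra S} :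
    x ∈ (ofFintype f₀ f q h).subspace S ↔
      x.v.val f₀ ≠ 0 ∧ ∀ i, x.v.val (f i) ≤ x.v.reif (q i) * x.v.val f₀ :=
  ⟨fun hx => ⟨hx.1, fun i => by simpa [ofFintype] using hx.2 (Fintype.equivFin ι i)⟩,
    fun hx => ⟨hx.1, fun _ => hx.2 _⟩⟩

variable (D : RationalDatum A)

/-- The parameters of a rational datum, including `f₀`. -/
def f' : Option (Fin D.n) → A := fun i => i.elim D.f₀ D.f

/-- The scale factors of a rational datum, including the one of `f₀`. -/
def q' : Option (Fin D.n) → PosReal := fun i => i.elim 1 D.q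

/-- The images of the variables in the rational localization, including `1` for `f₀ / f₀`. -/
noncomputable def T' : Option (Fin D.n) → D.Loc := fun i => i.elim 1 D.T

theorem toLoc_mul_T' (i : Option (Fin D.n)) : D.toLoc D.f₀ * D.T' i = D.toLoc (D.f' i) := by
  cases i with
  | none => exact mul_one _
  | some i => exact D.toLoc_mul_T i

theorem isPowerBounded_T' (i : Option (Fin D.n)) : IsPowerBounded (D.q' i) (D.T' i) := by
  cases i with
  | none => exact isPowerBounded_one
  | some i => exact D.isPowerBounded_T i

omit [IsUltrametricDist A] in
theorem span_range_f' : Ideal.span (Set.range D.f') = ⊤ := by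
  rw [eq_top_iff, ← D.span_eq_top]
  exact Ideal.span_mono (by rintro _ ⟨i, rfl⟩; exact ⟨some i, rfl⟩)

variable {D}

theorem mem_subspace' {x : Spra S} : x ∈ D.subspace S ↔
    x.v.val D.f₀ ≠ 0 ∧ ∀ i, x.v.val (D.f' i) ≤ x.v.reif (D.q' i) * x.v.val D.f₀ := by
  rw [mem_subspace, Option.forall]
  refine and_congr_right fun _ => (and_iff_right ?_).symm
  simp [f', q']

omit [IsUltrametricDist A] in
theorem span_range_mul {ι κ : Type*} {f : ι → A} {g : κ → A} (hf : Ideal.span (Set.range f) = ⊤)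
    (hg : Ideal.span (Set.range g) = ⊤) :
    Ideal.span (Set.range fun i : ι × κ => f i.1 * g i.2) = ⊤ := by
  rw [eq_top_iff, ← Ideal.top_mul ⊤]
  nth_rw 1 [← hf]
  rw [← hg, Ideal.span_mul_span', Ideal.span_le]
  rintro _ ⟨_, ⟨i, rfl⟩, _, ⟨j, rfl⟩, rfl⟩
  exact Ideal.subset_span ⟨(i, j), rfl⟩

end RationalDatum

open RationalDatum

section Rational

variable {A : Type u} [NormedCommRing A] [IsUltrametricDist A] {S : Subring (Gr A)}

/-- The products of parameters, taken relative to the product of the two f₀, describe the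
intersection. Including f₀ itself among the parameters lets each original inequality be recovered by
cancelling the other f₀. -/
theorem IsRational.inter {U V : Set (Spra S)} (hU : IsRational S U) (hV : IsRational S V) :
    IsRational S (U ∩ V) := by
  obtain ⟨D, rfl⟩ := hU
  obtain ⟨E, rfl⟩ := hV
  refine ⟨ofFintype (D.f₀ * E.f₀) (fun i : Option (Fin D.n) × Option (Fin E.n) =>
    D.f' i.1 * E.f' i.2) (fun i => D.q' i.1 * E.q' i.2)
    (span_range_mul D.span_range_f' E.span_range_f'), ?_⟩
  ext x
  rw [mem_ofFintype_subspace, Set.mem_inter_iff, mem_subspace', mem_subspace']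
  constructor
  · rintro ⟨⟨hD, hD'⟩, ⟨hE, hE'⟩⟩
    refine ⟨by rw [map_mul]; exact mul_ne_zero hD hE, fun i => ?_⟩
    rw [map_mul, map_mul, map_mul, mul_mul_mul_comm]
    exact mul_le_mul' (hD' _) (hE' _)
  · rintro ⟨h0, h⟩
    rw [map_mul] at h0
    have hD := left_ne_zero_of_mul h0
    have hE := right_ne_zero_of_mul h0
    refine ⟨⟨hD, fun i => ?_⟩, ⟨hE, fun i => ?_⟩⟩
    · have := h (i, none)
      simp only [f', q', Option.elim_none, map_mul, mul_one] at this
      rw [← mul_assoc] at this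
      exact le_of_mul_le_mul_right this (zero_lt_iff.2 hE)
    · have := h (none, i)
      simp only [f', q', Option.elim_none, map_mul, one_mul] at this
      rw [mul_left_comm] at this
      exact le_of_mul_le_mul_left this (zero_lt_iff.2 hD)

theorem isRational_univ : IsRational S Set.univ := ⟨_, trivialDatum_subspace.symm⟩

variable (S) in
/-- The set of all `v` with `v(f) ≤ q v(g)` and `v(g) ≥ ρ`. -/
def ratioSet (f g : A) (q ρ : PosReal) : Set (Spra S) :=
  {x | x.v.val f ≤ x.v.reif q * x.v.val g ∧ x.v.reif ρ ≤ x.v.val g}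

/-- The bound v(g) ≥ ρ reads v(1) ≤ ρ⁻¹ v(g), so 1 is one of the parameters and the unit ideal
condition is automatic. -/
theorem isRational_ratioSet (f g : A) (q ρ : PosReal) : IsRational S (ratioSet S f g q ρ) := by
  refine ⟨ofFintype g ![f, 1] ![q, ρ⁻¹] ?_, ?_⟩
  · rw [Ideal.eq_top_iff_one]
    exact Ideal.subset_span ⟨1, rfl⟩
  · ext x
    rw [mem_ofFintype_subspace, Fin.forall_fin_two]
    simp only [Matrix.cons_val_zero, Matrix.cons_val_one, ratioSet, Set.mem_ofPred_eq]
    rw [x.v.le_reif_mul_iff ρ⁻¹, inv_inv, map_one, mul_one]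
    refine ⟨fun h => ⟨fun h0 => ?_, h⟩, fun h => h.2⟩
    exact (h.2.trans_eq h0).not_gt (x.v.reif_pos ρ)

/-- Write 1 = ∑ aᵢ fᵢ and use v(aᵢ) ≤ ‖aᵢ‖ + 1. With c = v(f₀) this bounds v(f₀) below uniformly on
a rational subspace, which serves both compactness and splittings. -/
theorem exists_reif_le_of_span_eq_top {n : ℕ} {f : Fin n → A} (q : Fin n → PosReal)
    (h : Ideal.span (Set.range f) = ⊤) : ∃ ρ, ∀ x : Spra S, ∀ c : x.v.Γ₀,
      (∀ i, x.v.val (f i) ≤ x.v.reif (q i) * c) → x.v.reif ρ ≤ c := by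
  obtain ⟨a, ha⟩ := Ideal.mem_span_range_iff_exists_fun.1 ((Ideal.eq_top_iff_one _).1 h)
  let r : Fin n → PosReal := fun i => ⟨‖a i‖ + 1, by positivity⟩
  obtain ⟨M, hM⟩ := (Finset.univ.image fun i => r i * q i).exists_le
  refine ⟨M⁻¹, fun x c hc => ?_⟩
  suffices h1 : x.v.val 1 ≤ x.v.reif M * c by
    rwa [x.v.le_reif_mul_iff, map_one, mul_one] at h1
  rw [← ha]
  refine Valuation.map_sum_le _ fun i _ => ?_
  have hr : x.v.val (a i) ≤ x.v.reif (r i) :=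
    x.isBounded _ _ (isTopNilpotent_of_norm_lt (by simp [r]))
  calc _ = x.v.val (a i) * x.v.val (f i) := map_mul _ _ _
    _ ≤ x.v.reif (r i) * (x.v.reif (q i) * c) := mul_le_mul' hr (hc i)
    _ = x.v.reif (r i * q i) * c := by rw [map_mul, mul_assoc]
    _ ≤ x.v.reif M * c := by
        gcongr
        exact x.v.reif_le_reif.2 (hM _ (Finset.mem_image_of_mem _ (Finset.mem_univ i)))

end Rational

/-! ### Laurent splittings -/

section Split

variable {A : Type u} [NormedCommRing A] [IsUltrametricDist A] (S : Subring (Gr A))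

/-- `V` is a rational subspace, on which `v(g)` is bounded below, and which is split into the parts
`v(f) ≤ q v(g)` and `v(g) ≤ q⁻¹ v(f)`. -/
def IsSplit (V V₁ V₂ : Set (Spra S)) : Prop :=
  IsRational S V ∧ ∃ (f g : A) (q ρ : PosReal), (∀ x ∈ V, x.v.reif ρ ≤ x.v.val g) ∧
    V₁ = V ∩ ratioSet S f g q ρ ∧ V₂ = V ∩ ratioSet S g f q⁻¹ (q * ρ)

variable {S} {V V₁ V₂ : Set (Spra S)}

theorem IsSplit.isRational_left (h : IsSplit S V V₁ V₂) : IsRational S V₁ := by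
  obtain ⟨hV, f, g, q, ρ, -, rfl, -⟩ := h
  exact hV.inter (isRational_ratioSet _ _ _ _)

theorem IsSplit.isRational_right (h : IsSplit S V V₁ V₂) : IsRational S V₂ := by
  obtain ⟨hV, f, g, q, ρ, -, -, rfl⟩ := h
  exact hV.inter (isRational_ratioSet _ _ _ _)

theorem IsSplit.inter (h : IsSplit S V V₁ V₂) {W : Set (Spra S)} (hW : IsRational S W) :
    IsSplit S (V ∩ W) (V₁ ∩ W) (V₂ ∩ W) := by
  obtain ⟨hV, f, g, q, ρ, hg, rfl, rfl⟩ := h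
  exact ⟨hV.inter hW, f, g, q, ρ, fun x hx => hg x hx.1, Set.inter_right_comm _ _ _,
    Set.inter_right_comm _ _ _⟩

theorem IsSplit.union_eq (h : IsSplit S V V₁ V₂) : V₁ ∪ V₂ = V := by
  obtain ⟨hV, f, g, q, ρ, hg, rfl, rfl⟩ := h
  rw [← Set.inter_union_distrib_left, Set.inter_eq_left]
  intro x hx
  rcases le_total (x.v.val f) (x.v.reif q * x.v.val g) with h | h
  · exact Or.inl ⟨h, hg x hx⟩
  · refine Or.inr ⟨?_, ?_⟩
    · rwa [x.v.le_reif_mul_iff, inv_inv]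
    · rw [map_mul]
      refine le_trans ?_ h
      gcongr
      exact hg x hx

/-- The intersection is presented so that every variable is an element from V times a power of z =
f/g. Since z lives on V₁ with weight q and z⁻¹ on V₂ with weight q⁻¹, the Laurent decomposition
applies. -/
theorem IsSplit.exists_restrict_add (h : IsSplit S V V₁ V₂) (s : sections S (V₁ ∩ V₂)) :
    ∃ (s₁ : sections S V₁) (s₂ : sections S V₂),
      restrict S Set.inter_subset_left s₁ + restrict S Set.inter_subset_right s₂ = s := by
  obtain ⟨E₁, hE₁⟩ := h.isRational_left
  obtain ⟨E₂, hE₂⟩ := h.isRational_right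
  obtain ⟨⟨D, hD⟩, f, g, q, ρ, hg, hV₁, hV₂⟩ := h
  -- Divided by fg, these numerators are z, z⁻¹, 1 and 1/(fg). The last one makes the unit ideal
  -- condition trivial; its weight comes from v(f) ≥ qρ and v(g) ≥ ρ.
  let num : Fin 4 → A := ![f * f, g * g, f * g, 1]
  let wt : Fin 4 → PosReal := ![q, q⁻¹, 1, q⁻¹ * (ρ⁻¹ * ρ⁻¹)]
  let E : RationalDatum A := ofFintype (D.f₀ * (f * g))
    (fun i : Option (Fin D.n) × Fin 4 => D.f' i.1 * num i.2) (fun i => D.q' i.1 * wt i.2)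
    (span_range_mul D.span_range_f' (by
      rw [Ideal.eq_top_iff_one]; exact Ideal.subset_span ⟨3, rfl⟩))
  have hE : E.subspace S = V₁ ∩ V₂ := by
    ext x
    have hsimp : x ∈ V₁ ∩ V₂ ↔ x ∈ V ∧ x.v.val f ≤ x.v.reif q * x.v.val g ∧
        x.v.val g ≤ x.v.reif q⁻¹ * x.v.val f ∧ x.v.reif ρ ≤ x.v.val g ∧
        x.v.reif (q * ρ) ≤ x.v.val f := by
      rw [hV₁, hV₂]
      simp only [ratioSet, Set.mem_inter_iff, Set.mem_ofPred_eq]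
      tauto
    rw [hsimp, mem_ofFintype_subspace]
    constructor
    · rintro ⟨h0, h⟩
      simp only [map_mul] at h0
      have h0D := left_ne_zero_of_mul h0
      have h0f := left_ne_zero_of_mul (right_ne_zero_of_mul h0)
      have h0g := right_ne_zero_of_mul (right_ne_zero_of_mul h0)
      have hxV : x ∈ V := by
        rw [hD, mem_subspace']
        refine ⟨h0D, fun i => ?_⟩
        have := h (i, 2)
        simp only [map_mul, num, wt, Matrix.cons_val, mul_one] at this
        rw [← mul_assoc (x.v.reif _)] at this
        exact le_of_mul_le_mul_right this (zero_lt_iff.2 (mul_ne_zero h0f h0g))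
      have h1 : x.v.val f ≤ x.v.reif q * x.v.val g := by
        have := h (none, 0)
        simp only [map_mul, num, wt, Matrix.cons_val, f', q', Option.elim_none, one_mul] at this
        rw [mul_left_comm (x.v.reif q)] at this
        have := le_of_mul_le_mul_left this (zero_lt_iff.2 h0D)
        rw [mul_left_comm] at this
        exact le_of_mul_le_mul_left this (zero_lt_iff.2 h0f)
      have h2 : x.v.val g ≤ x.v.reif q⁻¹ * x.v.val f := by
        have := h (none, 1)
        simp only [map_mul, num, wt, Matrix.cons_val, f', q', Option.elim_none, one_mul] at this
        rw [mul_left_comm (x.v.reif q⁻¹)] at this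
        have := le_of_mul_le_mul_left this (zero_lt_iff.2 h0D)
        rw [← mul_assoc] at this
        exact le_of_mul_le_mul_right this (zero_lt_iff.2 h0g)
      refine ⟨hxV, h1, h2, hg x hxV, ?_⟩
      rw [map_mul, ← inv_inv q, ← x.v.le_reif_mul_iff]
      exact (hg x hxV).trans h2
    · rintro ⟨hxV, h1, h2, h3, h4⟩
      have h0f : x.v.val f ≠ 0 := fun h => (h4.trans_eq h).not_gt (x.v.reif_pos _)
      have h0g : x.v.val g ≠ 0 := fun h => (h3.trans_eq h).not_gt (x.v.reif_pos _)
      rw [hD, mem_subspace'] at hxV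
      refine ⟨by simp only [map_mul]; exact mul_ne_zero hxV.1 (mul_ne_zero h0f h0g), ?_⟩
      rintro ⟨i, k⟩
      have hk : x.v.val (num k) ≤ x.v.reif (wt k) * x.v.val (f * g) := by
        fin_cases k
        · change x.v.val (f * f) ≤ x.v.reif q * _
          rw [map_mul, map_mul, mul_left_comm]
          gcongr
        · change x.v.val (g * g) ≤ x.v.reif q⁻¹ * _
          rw [map_mul, map_mul, ← mul_assoc]
          gcongr
        · change x.v.val (f * g) ≤ x.v.reif 1 * _
          rw [map_one, one_mul]
        · change x.v.val 1 ≤ x.v.reif (q⁻¹ * (ρ⁻¹ * ρ⁻¹)) * _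
          rw [x.v.le_reif_mul_iff, map_one, mul_one, map_mul]
          have : (q⁻¹ * (ρ⁻¹ * ρ⁻¹))⁻¹ = (q * ρ) * ρ := by
            rw [mul_inv, mul_inv, inv_inv, inv_inv, mul_assoc]
          rw [this, map_mul]
          exact mul_le_mul' h4 h3
      simp only [map_mul] at hk ⊢
      rw [mul_mul_mul_comm (x.v.reif _)]
      exact mul_le_mul' (hxV.2 i) hk
  have hVD : V₁ ⊆ V := hV₁ ▸ Set.inter_subset_left
  have hVD' : V₂ ⊆ V := hV₂ ▸ Set.inter_subset_left
  obtain ⟨ψ₁, hψ₁, hψ₁c⟩ := exists_isMorphism (D := E₁) (D' := D) (S := S) (by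
    rw [← hE₁, ← hD]; exact hVD)
  obtain ⟨ψ₂, hψ₂, hψ₂c⟩ := exists_isMorphism (D := E₂) (D' := D) (S := S) (by
    rw [← hE₂, ← hD]; exact hVD')
  obtain ⟨χ₁, hχ₁, hχ₁c⟩ := exists_isMorphism (D := E) (D' := E₁) (S := S) (by
    rw [← hE₁, hE]; exact Set.inter_subset_left)
  obtain ⟨χ₂, hχ₂, hχ₂c⟩ := exists_isMorphism (D := E) (D' := E₂) (S := S) (by
    rw [← hE₂, hE]; exact Set.inter_subset_right)
  -- γ is 1/g; it already exists on V, where v(g) ≥ ρ.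
  obtain ⟨γ, hγ, hγg⟩ := exists_mul_eq (D := D) (S := S) (f := 1) (g := g) (q := ρ⁻¹)
    fun x hx => by
      have := hg x (hD ▸ hx)
      refine ⟨fun h => (this.trans_eq h).not_gt (x.v.reif_pos _), ?_⟩
      rwa [x.v.le_reif_mul_iff, inv_inv, map_one, mul_one]
  obtain ⟨z₁, hz₁, hz₁g⟩ := exists_mul_eq (D := E₁) (S := S) (f := f) (g := g) (q := q)
    fun x hx => by
      rw [← hE₁, hV₁] at hx
      exact ⟨fun h => (hx.2.2.trans_eq h).not_gt (x.v.reif_pos _), hx.2.1⟩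
  obtain ⟨z₂, hz₂, hz₂f⟩ := exists_mul_eq (D := E₂) (S := S) (f := g) (g := f) (q := q⁻¹)
    fun x hx => by
      rw [← hE₂, hV₂] at hx
      exact ⟨fun h => (hx.2.2.trans_eq h).not_gt (x.v.reif_pos _), hx.2.1⟩
  have hχ : χ₁.comp ψ₁ = χ₂.comp ψ₂ :=
    D.hom_ext (IsBoundedHom.comp hχ₁.bounded hψ₁.bounded)
      (IsBoundedHom.comp hχ₂.bounded hψ₂.bounded)
      (by rw [RingHom.comp_assoc, RingHom.comp_assoc, hψ₁c, hψ₂c, hχ₁c, hχ₂c])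
  have hD' : ∀ a, χ₁ (ψ₁ (D.toLoc a)) = E.toLoc a := fun a => by
    rw [← RingHom.comp_apply ψ₁, hψ₁c, ← RingHom.comp_apply, hχ₁c]
  have hg1 : E.toLoc g * χ₁ (ψ₁ γ) = 1 := by
    rw [← hD', ← map_mul, ← map_mul, hγg, map_one, map_one, map_one]
  have hgz : E.toLoc g * χ₁ z₁ = E.toLoc f := by
    rw [← hχ₁c, RingHom.comp_apply, ← map_mul, hz₁g, RingHom.comp_apply]
  have hfz : E.toLoc f * χ₂ z₂ = E.toLoc g := by
    rw [← hχ₂c, RingHom.comp_apply, ← map_mul, hz₂f, RingHom.comp_apply]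
  -- From f = g z₁ and g = f z₂ one gets g = g z₁ z₂, and g is invertible with inverse the image of
  -- γ.
  have hzz : χ₁ z₁ * χ₂ z₂ = 1 := by
    linear_combination χ₁ (ψ₁ γ) * χ₂ z₂ * hgz + χ₁ (ψ₁ γ) * hfz - (χ₁ z₁ * χ₂ z₂ - 1) * hg1
  let z : (E.Loc)ˣ := ⟨χ₁ z₁, χ₂ z₂, hzz, by rw [mul_comm]; exact hzz⟩
  -- These are the coefficients from V and, below, their weights and the exponents of z; the last
  -- entry is 1/(fg) = γ² z⁻¹.
  let un : Fin 4 → D.Loc := ![1, 1, 1, γ * γ]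
  let up : Fin 4 → PosReal := ![1, 1, 1, ρ⁻¹ * ρ⁻¹]
  let ex : Fin 4 → ℤ := ![1, -1, 0, -1]
  have hun : ∀ k, IsPowerBounded (up k) (un k) := by
    intro k
    fin_cases k
    exacts [isPowerBounded_one, isPowerBounded_one, isPowerBounded_one,
      (isPowerBounded_of_mem_plus hγ).mul (isPowerBounded_of_mem_plus hγ)]
  have hwt : ∀ k, wt k = up k * q ^ ex k := by
    intro k
    fin_cases k <;> simp [wt, up, ex, mul_comm]
  have hnum : ∀ k, E.toLoc f * E.toLoc g * (χ₁ (ψ₁ (un k)) * (z ^ ex k : (E.Loc)ˣ)) =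
      E.toLoc (num k) := by
    intro k
    fin_cases k
    · change _ * (χ₁ (ψ₁ 1) * ((z ^ (1 : ℤ) : (E.Loc)ˣ) : E.Loc)) = E.toLoc (f * f)
      rw [map_one, map_one, zpow_one, one_mul, map_mul]
      linear_combination E.toLoc f * hgz
    · change _ * (χ₁ (ψ₁ 1) * ((z ^ (-1 : ℤ) : (E.Loc)ˣ) : E.Loc)) = E.toLoc (g * g)
      rw [map_one, map_one, zpow_neg_one, one_mul, map_mul]
      change _ * χ₂ z₂ = _
      linear_combination E.toLoc g * hfz
    · change _ * (χ₁ (ψ₁ 1) * ((z ^ (0 : ℤ) : (E.Loc)ˣ) : E.Loc)) = E.toLoc (f * g)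
      rw [map_one, map_one, zpow_zero, one_mul, map_mul, Units.val_one, mul_one]
    · change _ * (χ₁ (ψ₁ (γ * γ)) * ((z ^ (-1 : ℤ) : (E.Loc)ˣ) : E.Loc)) = E.toLoc 1
      rw [map_mul, map_mul, zpow_neg_one, map_one]
      change _ * (_ * χ₂ z₂) = 1
      linear_combination E.toLoc g * χ₁ (ψ₁ γ) * χ₁ (ψ₁ γ) * hfz +
        (E.toLoc g * χ₁ (ψ₁ γ) + 1) * hg1
  let eqv := (Fintype.equivFin (Option (Fin D.n) × Fin 4)).symm
  have hT : ∀ j : Fin E.n, E.T j =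
      χ₁ (ψ₁ (D.T' (eqv j).1 * un (eqv j).2)) * (z ^ ex (eqv j).2 : (E.Loc)ˣ) := by
    intro j
    rw [← E.isUnit_toLoc_f₀.mul_right_inj, toLoc_mul_T]
    change E.toLoc (D.f' (eqv j).1 * num (eqv j).2) = E.toLoc (D.f₀ * (f * g)) * _
    have h1 := hnum (eqv j).2
    have h2 : E.toLoc D.f₀ * χ₁ (ψ₁ (D.T' (eqv j).1)) = E.toLoc (D.f' (eqv j).1) := by
      rw [← hD', ← map_mul, ← map_mul, toLoc_mul_T', hD']
    rw [map_mul, ← h1, ← h2]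
    simp only [map_mul]
    ring
  obtain ⟨b₁, b₂, hb⟩ := E.exists_add_eq_of_laurent D.isBoundedHom_toLoc
    (y := fun j => D.T' (eqv j).1 * un (eqv j).2)
    (p := fun j => D.q' (eqv j).1 * up (eqv j).2)
    (fun j => (D.isPowerBounded_T' _).mul (hun _)) (fun j => ex (eqv j).2)
    hψ₁.bounded hψ₂.bounded (isPowerBounded_of_mem_plus hz₁) (isPowerBounded_of_mem_plus hz₂)
    (fun j => by
      change D.q' (eqv j).1 * wt (eqv j).2 = _
      rw [hwt, mul_assoc])
    hχ₁.bounded hχ₂.bounded hχ (by rw [RingHom.comp_assoc, hψ₁c, hχ₁c]) z rfl rfl hT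
    (s.1 ⟨E, hE.subset⟩)
  obtain ⟨s₁, hs₁⟩ := exists_section hE₁.symm b₁
  obtain ⟨s₂, hs₂⟩ := exists_section hE₂.symm b₂
  refine ⟨s₁, s₂, sections_ext hE ?_⟩
  rw [← hb, ← hs₁, ← hs₂,
    s₁.2 ⟨E₁, hE₁.symm.subset⟩ ⟨E, hE.subset.trans Set.inter_subset_left⟩ χ₁ hχ₁ hχ₁c,
    s₂.2 ⟨E₂, hE₂.symm.subset⟩ ⟨E, hE.subset.trans Set.inter_subset_right⟩ χ₂ hχ₂ hχ₂c]
  rfl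

end Split

end Readic

namespace Readic

open RationalDatum

/-! ### Ultraproducts of linearly ordered groups with zero -/

/-- The ultraproduct of a family of types. -/
def UltraProd {α : Type u} (l : Ultrafilter α) (G : α → Type w) : Type max u w :=
  Quotient ((l : Filter α).productSetoid G)

namespace UltraProd

variable {α : Type u} {l : Ultrafilter α} {G : α → Type w}

variable (l) in
/-- The class of a family. -/
def mk (f : ∀ x, G x) : UltraProd l G := Quotient.mk _ f

theorem mk_surjective : Function.Surjective (mk l (G := G)) := Quotient.mk_surjective

theorem mk_eq_mk {f g : ∀ x, G x} : mk l f = mk l g ↔ ∀ᶠ x in l, f x = g x := Quotient.eq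

variable [∀ x, LinearOrderedCommGroupWithZero (G x)]

instance : LE (UltraProd l G) where
  le := Quotient.lift₂ (fun f g => ∀ᶠ x in l, f x ≤ g x) fun f g f' g' hf hg =>
    propext (Filter.eventually_congr (by
      filter_upwards [hf, hg] with x h1 h2
      rw [h1, h2]))

theorem mk_le_mk {f g : ∀ x, G x} : mk l f ≤ mk l g ↔ ∀ᶠ x in l, f x ≤ g x := Iff.rfl

noncomputable instance : LinearOrder (UltraProd l G) where
  le_refl a := by
    obtain ⟨f, rfl⟩ := mk_surjective a
    exact mk_le_mk.2 (.of_forall fun _ => le_rfl)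
  le_trans a b c h1 h2 := by
    obtain ⟨f, rfl⟩ := mk_surjective a
    obtain ⟨g, rfl⟩ := mk_surjective b
    obtain ⟨h, rfl⟩ := mk_surjective c
    rw [mk_le_mk] at *
    filter_upwards [h1, h2] with x using le_trans
  le_antisymm a b h1 h2 := by
    obtain ⟨f, rfl⟩ := mk_surjective a
    obtain ⟨g, rfl⟩ := mk_surjective b
    rw [mk_le_mk] at *
    rw [mk_eq_mk]
    filter_upwards [h1, h2] with x using le_antisymm
  le_total a b := by
    obtain ⟨f, rfl⟩ := mk_surjective a
    obtain ⟨g, rfl⟩ := mk_surjective b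
    rw [mk_le_mk, mk_le_mk, ← Ultrafilter.eventually_or]
    exact .of_forall fun x => le_total _ _
  toDecidableLE := Classical.decRel _

instance : Zero (UltraProd l G) := ⟨mk l 0⟩
instance : One (UltraProd l G) := ⟨mk l 1⟩
instance : Mul (UltraProd l G) := ⟨Quotient.map₂ (· * ·) fun f f' hf g g' hg => by
  filter_upwards [hf, hg] with x h1 h2
  simp [h1, h2]⟩
instance : Inv (UltraProd l G) := ⟨Quotient.map (fun f x => (f x)⁻¹) fun f f' hf => by
  filter_upwards [hf] with x h1
  simp [h1]⟩
instance : Pow (UltraProd l G) ℕ := ⟨fun a n => Quotient.map (· ^ n) (fun f f' hf => by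
  filter_upwards [hf] with x h1
  simp [h1]) a⟩

noncomputable instance : CommMonoidWithZero (UltraProd l G) :=
  mk_surjective.commMonoidWithZero _ rfl rfl (fun _ _ => rfl) fun _ _ => rfl

theorem mk_mul (f g : ∀ x, G x) : mk l f * mk l g = mk l (f * g) := rfl

theorem mk_eq_zero {f : ∀ x, G x} : mk l f = 0 ↔ ∀ᶠ x in l, f x = 0 := mk_eq_mk

theorem mk_lt_mk {f g : ∀ x, G x} : mk l f < mk l g ↔ ∀ᶠ x in l, f x < g x := by
  rw [← not_le, mk_le_mk, ← Ultrafilter.eventually_not]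
  simp

instance : OrderBot (UltraProd l G) where
  bot := 0
  bot_le a := by
    obtain ⟨f, rfl⟩ := mk_surjective a
    exact mk_le_mk.2 (.of_forall fun x => zero_le)

noncomputable instance : LinearOrderedCommGroupWithZero (UltraProd l G) where
  mul_lt_mul_of_pos_left := by
    intro a ha b c h
    obtain ⟨f, rfl⟩ := mk_surjective a
    obtain ⟨g, rfl⟩ := mk_surjective b
    obtain ⟨k, rfl⟩ := mk_surjective c
    change mk l 0 < _ at ha
    rw [mk_lt_mk] at ha h
    rw [mk_mul, mk_mul, mk_lt_mk]
    filter_upwards [ha, h] with x h1 h2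
    exact mul_lt_mul_of_pos_left h2 h1
  isBot_zero _ := bot_le
  exists_pair_ne := ⟨0, 1, fun h => by
    obtain ⟨x, hx⟩ := Eventually.exists (f := (l : Filter α)) (mk_eq_mk.1 h)
    exact zero_ne_one hx⟩
  inv_zero := mk_eq_mk.2 (.of_forall fun _ => inv_zero)
  mul_inv_cancel a ha := by
    obtain ⟨f, rfl⟩ := mk_surjective a
    refine mk_eq_mk.2 ?_
    rw [Ne, mk_eq_zero, ← Ultrafilter.eventually_not] at ha
    filter_upwards [ha] with x hx
    exact mul_inv_cancel₀ hx

end UltraProd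

/-- The ultraproduct of a family of reified semivaluations. -/
noncomputable def ReifiedSemivaluation.ultraProd {A α : Type u} [CommRing A] (l : Ultrafilter α)
    (v : α → ReifiedSemivaluation A) : ReifiedSemivaluation A where
  Γ₀ := UltraProd l fun x => (v x).Γ₀
  val :=
    { toFun := fun a => UltraProd.mk l fun x => (v x).val a
      map_zero' := UltraProd.mk_eq_mk.2 (.of_forall fun x => map_zero _)
      map_one' := UltraProd.mk_eq_mk.2 (.of_forall fun x => map_one _)
      map_mul' := fun a b => UltraProd.mk_eq_mk.2 (.of_forall fun x => map_mul _ _ _)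
      map_add_le_max' := fun a b => by
        rw [le_max_iff, UltraProd.mk_le_mk, UltraProd.mk_le_mk, ← Ultrafilter.eventually_or]
        exact .of_forall fun x => le_max_iff.1 ((v x).val.map_add a b) }
  reif :=
    { toFun := fun r => UltraProd.mk l fun x => (v x).reif r
      map_one' := UltraProd.mk_eq_mk.2 (.of_forall fun x => map_one _)
      map_mul' := fun a b => UltraProd.mk_eq_mk.2 (.of_forall fun x => map_mul _ _ _) }
  reif_strictMono := fun _ _ h =>
    UltraProd.mk_lt_mk.2 (.of_forall fun x => (v x).reif_strictMono h)

/-! ### The topology of `Spra (A, S)` -/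

section Topology

variable {A : Type u} [NormedCommRing A] [IsUltrametricDist A] {S : Subring (Gr A)}

theorem Spra.topology_eq : instTopologicalSpaceSpra S =
    generateFrom {s | ∃ (a b : A) (q : PosReal),
      s = {x : Spra S | x.v.val a ≤ x.v.reif q * x.v.val b ∧ x.v.val b ≠ 0}} := by
  change induced _ (generateFrom _) = _
  rw [induced_generateFrom_eq]
  congr 1
  ext s
  constructor
  · rintro ⟨_, ⟨a, b, q, rfl⟩, rfl⟩
    exact ⟨a, b, q, rfl⟩
  · rintro ⟨a, b, q, rfl⟩
    exact ⟨_, ⟨a, b, q, rfl⟩, rfl⟩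

theorem Spra.isOpen_setOf (a b : A) (q : PosReal) :
    IsOpen {x : Spra S | x.v.val a ≤ x.v.reif q * x.v.val b ∧ x.v.val b ≠ 0} := by
  have h := isOpen_generateFrom_of_mem
    (g := {s | ∃ (a b : A) (q : PosReal),
      s = {x : Spra S | x.v.val a ≤ x.v.reif q * x.v.val b ∧ x.v.val b ≠ 0}}) ⟨a, b, q, rfl⟩
  rwa [← Spra.topology_eq] at h

theorem IsRational.isOpen {V : Set (Spra S)} (hV : IsRational S V) : IsOpen V := by
  obtain ⟨D, rfl⟩ := hV
  have : D.subspace S = ⋂ i,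
      {x : Spra S | x.v.val (D.f' i) ≤ x.v.reif (D.q' i) * x.v.val D.f₀ ∧ x.v.val D.f₀ ≠ 0} := by
    ext x
    rw [mem_subspace', Set.mem_iInter]
    exact ⟨fun h i => ⟨h.2 i, h.1⟩, fun h => ⟨(h none).2, fun i => (h i).1⟩⟩
  rw [this]
  exact isOpen_iInter_of_finite fun i => Spra.isOpen_setOf _ _ _

/-- Commensurability bounds v(b) below by a real at the given point, which replaces v(b) ≠ 0 by a
condition defining a rational subspace. -/
theorem exists_isRational_subset {U : Set (Spra S)} (hU : IsOpen U) {x : Spra S} (hx : x ∈ U) :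
    ∃ W, IsRational S W ∧ x ∈ W ∧ W ⊆ U := by
  rw [Spra.topology_eq] at hU
  induction hU with
  | basic s hs =>
    obtain ⟨a, b, q, rfl⟩ := hs
    obtain ⟨ρ, hρ⟩ := x.exists_le_val hx.2
    exact ⟨_, isRational_ratioSet a b q ρ, ⟨hx.1, hρ⟩,
      fun y hy => ⟨hy.1, fun h => (hy.2.trans_eq h).not_gt (y.v.reif_pos ρ)⟩⟩
  | univ => exact ⟨_, isRational_univ, hx, subset_rfl⟩
  | inter s t _ _ hs ht =>
    obtain ⟨W, hW, hxW, hWs⟩ := hs hx.1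
    obtain ⟨W', hW', hxW', hWt⟩ := ht hx.2
    exact ⟨_, hW.inter hW', ⟨hxW, hxW'⟩, Set.inter_subset_inter hWs hWt⟩
  | sUnion T _ h =>
    obtain ⟨s, hs, hxs⟩ := hx
    obtain ⟨W, hW, hxW, hWs⟩ := h s hs hxs
    exact ⟨W, hW, hxW, hWs.trans (Set.subset_sUnion_of_mem hs)⟩

/-- The ultraproduct of the semivaluations along an ultrafilter, retracted so as to become
commensurable, is a limit point. It stays in the subspace because the uniform lower bound for v(f₀)
survives the retraction. -/
theorem IsRational.isCompact {V : Set (Spra S)} (hV : IsRational S V) : IsCompact V := by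
  obtain ⟨D, rfl⟩ := hV
  rw [isCompact_iff_ultrafilter_le_nhds]
  intro l hl
  have hl' : ∀ᶠ x in l, x ∈ D.subspace S := le_principal_iff.1 hl
  let v := ReifiedSemivaluation.ultraProd l fun x : Spra S => x.v
  obtain ⟨h, y, hy⟩ := Spra.exists_of_retract (S := S) v fun r a ha =>
    UltraProd.mk_le_mk.2 (.of_forall fun x => x.val_le_of_mem_plus ha)
  obtain ⟨ρ, hρ⟩ := exists_reif_le_of_span_eq_top (S := S) D.q D.span_eq_top
  have hf₀ : v.reif ρ ≤ v.val D.f₀ := UltraProd.mk_le_mk.2 (by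
    filter_upwards [hl'] with x hx
    exact hρ x _ hx.2)
  have h1 : (v.retract h).val D.f₀ = v.val D.f₀ := v.retract_val_of_le h hf₀
  refine ⟨y, ⟨?_, fun i => ?_⟩, ?_⟩
  · rw [Ne, ReifiedSemivaluation.val_eq_zero_iff_of_rel_eq hy, h1]
    exact fun h0 => (hf₀.trans_eq h0).not_gt (v.reif_pos ρ)
  · rw [ReifiedSemivaluation.val_le_iff_of_rel_eq hy, h1]
    refine (v.retract_val_le h _).trans (UltraProd.mk_le_mk.2 ?_)
    filter_upwards [hl'] with x hx
    exact hx.2 i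
  · have : 𝓝 y = @nhds _ (generateFrom {s | ∃ (a b : A) (q : PosReal),
        s = {x : Spra S | x.v.val a ≤ x.v.reif q * x.v.val b ∧ x.v.val b ≠ 0}}) y := by
      rw [← Spra.topology_eq]
    rw [this, nhds_generateFrom]
    refine le_iInf₂ ?_
    rintro _ ⟨hy', a, b, q, rfl⟩
    obtain ⟨h2, h3⟩ : y.v.val a ≤ y.v.reif q * y.v.val b ∧ y.v.val b ≠ 0 := hy'
    rw [ReifiedSemivaluation.val_le_iff_of_rel_eq hy] at h2
    rw [Ne, ReifiedSemivaluation.val_eq_zero_iff_of_rel_eq hy] at h3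
    obtain ⟨r, hr⟩ := v.exists_le_of_retract_val_ne_zero h h3
    rw [v.retract_val_of_le h hr] at h2
    have h4 : v.val a ≤ v.reif q * v.val b := by
      by_cases ha : ∃ s, v.reif s ≤ v.val a
      · obtain ⟨s, hs⟩ := ha
        rwa [v.retract_val_of_le h hs] at h2
      -- The retraction sets v(a) to zero only if v(a) is smaller than every real; then it is below
      -- q r ≤ q v(b) anyway.
      · push Not at ha
        refine (ha (q * r)).le.trans ?_
        rw [map_mul]
        gcongr
    rw [le_principal_iff]
    have h5 : ∀ᶠ x : Spra S in l, x.v.val a ≤ x.v.reif q * x.v.val b := UltraProd.mk_le_mk.1 h4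
    have h6 : ∀ᶠ x : Spra S in l, x.v.reif r ≤ x.v.val b := UltraProd.mk_le_mk.1 hr
    filter_upwards [h5, h6] with x hx hx'
    exact ⟨hx, fun h => (hx'.trans_eq h).not_gt (x.v.reif_pos r)⟩

end Topology

/-! ### The splitting principle -/

section Tree

variable {A : Type u} [NormedCommRing A] [IsUltrametricDist A] {S : Subring (Gr A)}

/-- The value `w v(h)` of a weighted function. -/
noncomputable def Spra.weighted (x : Spra S) (e : A × PosReal) : x.v.Γ₀ :=
  x.v.reif e.2 * x.v.val e.1

variable {P : Set (Spra S) → Prop}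

/-- The current leader e is compared with the next entry of the list by a splitting, and on each
part the winner becomes the new leader. The invariant ρ ≤ weighted e makes every comparison an
admissible splitting. -/
theorem of_isSplit_of_dominated (hsplit : ∀ V V₁ V₂, IsSplit S V V₁ V₂ → P V₁ → P V₂ → P V)
    (L : List (A × PosReal)) : ∀ (e : A × PosReal) (ρ : PosReal) {V : Set (Spra S)},
    IsRational S V → (∀ x ∈ V, x.v.reif ρ ≤ x.weighted e) →
    (∀ V' ⊆ V, IsRational S V' → ∀ e' ∈ e :: L,
      (∀ x ∈ V', ∀ e'' ∈ e :: L, x.weighted e'' ≤ x.weighted e') → P V') → P V := by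
  induction L with
  | nil =>
    intro e ρ V hV hρ H
    exact H V subset_rfl hV e (by simp) (by simp)
  | cons c L ih =>
    intro e ρ V hV hρ H
    obtain ⟨g, p⟩ := e
    obtain ⟨f, w⟩ := c
    -- The inequality w v(f) ≤ p v(g) is rewritten as v(f) ≤ w⁻¹p v(g), and ρ ≤ p v(g) as p⁻¹ρ ≤
    -- v(g).
    have hs : IsSplit S V (V ∩ ratioSet S f g (w⁻¹ * p) (p⁻¹ * ρ))
        (V ∩ ratioSet S g f (w⁻¹ * p)⁻¹ (w⁻¹ * p * (p⁻¹ * ρ))) := by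
      refine ⟨hV, f, g, w⁻¹ * p, p⁻¹ * ρ, fun x hx => ?_, rfl, rfl⟩
      rw [map_mul, ← x.v.le_reif_mul_iff]
      exact hρ x hx
    refine hsplit _ _ _ hs ?_ ?_
    · have hdom : ∀ x ∈ V ∩ ratioSet S f g (w⁻¹ * p) (p⁻¹ * ρ),
          x.weighted (f, w) ≤ x.weighted (g, p) := by
        rintro x ⟨-, hx, -⟩
        rw [map_mul, mul_assoc] at hx
        have := mul_le_mul_right hx (x.v.reif w)
        rwa [← mul_assoc (x.v.reif w), x.v.reif_mul_inv, one_mul] at this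
      refine ih (g, p) ρ hs.isRational_left (fun x hx => hρ x hx.1) fun V' hV' hr e' he' hd => ?_
      refine H V' (hV'.trans Set.inter_subset_left) hr e' ?_ fun x hx e'' he'' => ?_
      · simp only [List.mem_cons] at he' ⊢
        tauto
      · rcases List.mem_cons.1 he'' with rfl | he''
        · exact hd x hx _ (by simp)
        rcases List.mem_cons.1 he'' with rfl | he''
        · exact (hdom x (hV' hx)).trans (hd x hx _ (by simp))
        · exact hd x hx _ (by simp [he''])
    · have hdom : ∀ x ∈ V ∩ ratioSet S g f (w⁻¹ * p)⁻¹ (w⁻¹ * p * (p⁻¹ * ρ)),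
          x.weighted (g, p) ≤ x.weighted (f, w) := by
        rintro x ⟨-, hx, -⟩
        rw [mul_inv_rev, inv_inv, map_mul, mul_assoc, x.v.le_reif_mul_iff, inv_inv] at hx
        exact hx
      refine ih (f, w) ρ hs.isRational_right (fun x hx => (hρ x hx.1).trans (hdom x hx))
        fun V' hV' hr e' he' hd => ?_
      refine H V' (hV'.trans Set.inter_subset_left) hr e' ?_ fun x hx e'' he'' => ?_
      · simp only [List.mem_cons] at he' ⊢
        tauto
      · rcases List.mem_cons.1 he'' with rfl | he''
        · exact (hdom x (hV' hx)).trans (hd x hx _ (by simp))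
        · exact hd x hx _ he''

/-- A hereditary property of rational subspaces which holds locally and is compatible with
splittings holds everywhere. -/
theorem of_isSplit_of_local (hsplit : ∀ V V₁ V₂, IsSplit S V V₁ V₂ → P V₁ → P V₂ → P V)
    (hmono : ∀ V W, P V → IsRational S W → W ⊆ V → P W) (hempty : P ∅) {V : Set (Spra S)}
    (hV : IsRational S V) (hloc : ∀ x ∈ V, ∃ W, IsRational S W ∧ x ∈ W ∧ P W) : P V := by
  classical
  choose! W hW hxW hPW using hloc
  obtain ⟨t, ht, hVt⟩ := hV.isCompact.elim_nhds_subcover W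
    fun x hx => (hW x hx).isOpen.mem_nhds (hxW x hx)
  choose D hD using fun j : t => hW j.1 (ht j.1 j.2)
  choose ρ hρ using fun j : t => exists_reif_le_of_span_eq_top (S := S) (D j).q (D j).span_eq_top
  -- One parameter is taken from each datum, weighted by its inverse scale factor; the j-th subspace
  -- is then where f₀, with weight 1, is the largest parameter of `D j` and nonzero.
  let fn : (∀ j : t, Option (Fin (D j).n)) → A × PosReal := fun s =>
    (∏ j, (D j).f' (s j), ∏ j, ((D j).q' (s j))⁻¹)
  let R : PosReal := ∏ j, ρ j
  have hfn : ∀ (x : Spra S) s, x.weighted (fn s) =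
      ∏ j, x.weighted ((D j).f' (s j), ((D j).q' (s j))⁻¹) := fun x s => by
    simp only [Spra.weighted, fn, map_prod, Finset.prod_mul_distrib]
  -- At each point a product of largest parameters may use f₀ (index `none`) for a member of the
  -- cover containing the point, so the products with some `none` already attain the maximum.
  have key : ∀ x ∈ V, ∃ s, (∃ k, s k = none) ∧ x.v.reif R ≤ x.weighted (fn s) ∧
      ∀ j i, x.weighted ((D j).f' i, ((D j).q' i)⁻¹) ≤
        x.weighted ((D j).f' (s j), ((D j).q' (s j))⁻¹) := by
    intro x hx
    obtain ⟨k, hk, hxk⟩ := Set.mem_iUnion₂.1 (hVt hx)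
    let k' : t := ⟨k, hk⟩
    have hmax : ∀ j : t, ∃ m : Option (Fin (D j).n), (j = k' → m = none) ∧
        ∀ i, x.weighted ((D j).f' i, ((D j).q' i)⁻¹) ≤
          x.weighted ((D j).f' m, ((D j).q' m)⁻¹) := by
      intro j
      by_cases hj : j = k'
      · subst hj
        refine ⟨none, fun _ => rfl, fun i => ?_⟩
        have hx' : x ∈ (D k').subspace S := hD k' ▸ hxk
        have := (mem_subspace'.1 hx').2 i
        rw [x.v.le_reif_mul_iff] at this
        simpa [Spra.weighted, f', q'] using this
      · obtain ⟨m, hm⟩ := Finite.exists_max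
          fun i : Option (Fin (D j).n) => x.weighted ((D j).f' i, ((D j).q' i)⁻¹)
        exact ⟨m, fun h => absurd h hj, hm⟩
    choose s hs hs' using hmax
    refine ⟨s, ⟨k', hs k' rfl⟩, ?_, hs'⟩
    rw [hfn, map_prod]
    refine Finset.prod_le_prod' fun j _ => hρ j x _ fun i => ?_
    rw [x.v.le_reif_mul_iff]
    exact hs' j (some i)
  let L : List (A × PosReal) := ((Finset.univ.filter fun s : ∀ j : t, Option (Fin (D j).n) =>
    ∃ k, s k = none).image fn).toList
  have hL : ∀ e, e ∈ L ↔ ∃ s, (∃ k, s k = none) ∧ fn s = e := by simp [L]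
  -- The constant R' starts the comparison as a leader bounded below. Being smaller than R, it can
  -- dominate only on the empty set.
  let R' : PosReal := ⟨(R : ℝ) / 2, half_pos R.2⟩
  have hR' : R' < R := half_lt_self R.2
  refine of_isSplit_of_dominated hsplit L (1, R') R' hV (fun x _ => by simp [Spra.weighted])
    fun V' hV' hr e he hd => ?_
  rcases List.mem_cons.1 he with rfl | he
  · suffices V' = ∅ by rwa [this]
    refine Set.eq_empty_of_forall_notMem fun x hx => ?_
    obtain ⟨s, hs, hs', -⟩ := key x (hV' hx)
    have := hs'.trans (hd x hx (fn s) (List.mem_cons_of_mem _ ((hL _).2 ⟨s, hs, rfl⟩)))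
    simp only [Spra.weighted, map_one, mul_one] at this
    exact (x.v.reif_le_reif.1 this).not_gt hR'
  · obtain ⟨s, ⟨k, hk⟩, rfl⟩ := (hL _).1 he
    refine hmono (W k) V' (hPW k (ht k k.2)) hr fun x hx => ?_
    obtain ⟨m, hm, hmR, hmax⟩ := key x (hV' hx)
    have h1 := hd x hx (fn m) (List.mem_cons_of_mem _ ((hL _).2 ⟨m, hm, rfl⟩))
    have hpos : 0 < x.weighted (fn m) := (x.v.reif_pos R).trans_le hmR
    rw [hfn, hfn, ← Finset.mul_prod_erase _ _ (Finset.mem_univ k),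
      ← Finset.mul_prod_erase _ _ (Finset.mem_univ k)] at h1
    rw [hfn, ← Finset.mul_prod_erase _ _ (Finset.mem_univ k)] at hpos
    -- The factors other than the k-th are enlarged to their maxima and cancelled, which leaves f₀
    -- as a largest parameter of `D k`.
    have h2 := h1.trans (mul_le_mul_right (Finset.prod_le_prod' fun j _ => hmax j (s j)) _)
    have h3 := le_of_mul_le_mul_right h2 (pos_of_mul_pos_right hpos zero_le)
    rw [hk] at h3
    have h4 : ∀ i, x.weighted ((D k).f' i, ((D k).q' i)⁻¹) ≤ x.v.val (D k).f₀ := fun i =>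
      ((hmax k i).trans h3).trans_eq (by simp [Spra.weighted, f', q'])
    rw [hD k, mem_subspace']
    refine ⟨fun h0 => ?_, fun i => ?_⟩
    · have := hρ k x (x.v.val (D k).f₀) fun i => by
        rw [x.v.le_reif_mul_iff]
        exact h4 (some i)
      exact (this.trans_eq h0).not_gt (x.v.reif_pos _)
    · rw [x.v.le_reif_mul_iff]
      exact h4 i

end Tree

end Readic

namespace Readic

open Opposite Abelian

/-! ### Sections of sheaves of abelian groups -/

section Res

variable {X : TopCat.{u}} (P : TopCat.Presheaf AddCommGrpCat.{u} X)

/-- The restriction maps of a presheaf of abelian groups. -/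
def res {V W : Opens X} (h : W ≤ V) : P.obj (op V) →+ P.obj (op W) :=
  (P.map (homOfLE h).op).hom

theorem res_res {V W Z : Opens X} (h : W ≤ V) (h' : Z ≤ W) (s : P.obj (op V)) :
    res P h' (res P h s) = res P (h'.trans h) s := by
  change P.map (homOfLE h').op (P.map (homOfLE h).op s) = _
  rw [← ConcreteCategory.comp_apply, ← P.map_comp]
  rfl

theorem res_self {V : Opens X} (h : V ≤ V) (s : P.obj (op V)) : res P h s = s := by
  change P.map (𝟙 _) s = s
  rw [P.map_id]
  rfl

variable {P} in
theorem app_res {Q : TopCat.Presheaf AddCommGrpCat.{u} X} (φ : P ⟶ Q) {V W : Opens X}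
    (h : W ≤ V) (s : P.obj (op V)) :
    φ.app (op W) (res P h s) = res Q h (φ.app (op V) s) :=
  ConcreteCategory.congr_hom (φ.naturality (homOfLE h).op) s

variable {P} (hP : TopCat.Presheaf.IsSheaf P)
include hP

theorem eq_of_res_eq {ι : Type*} {U : ι → Opens X} {V : Opens X} (hU : ∀ i, U i ≤ V)
    (hV : V ≤ iSup U) {s t : P.obj (op V)} (h : ∀ i, res P (hU i) s = res P (hU i) t) : s = t :=
  TopCat.Sheaf.eq_of_locally_eq' ⟨P, hP⟩ U V (fun i => homOfLE (hU i)) hV s t h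

theorem exists_res_eq {ι : Type*} {U : ι → Opens X} {V : Opens X} (hU : ∀ i, U i ≤ V)
    (hV : V ≤ iSup U) (s : ∀ i, P.obj (op (U i)))
    (h : ∀ i j, res P (inf_le_left : U i ⊓ U j ≤ _) (s i) = res P inf_le_right (s j)) :
    ∃ t : P.obj (op V), ∀ i, res P (hU i) t = s i :=
  (TopCat.Sheaf.existsUnique_gluing' ⟨P, hP⟩ U V (fun i => homOfLE (hU i)) hV s h).exists

theorem eq_of_res_eq₂ {V V₁ V₂ : Opens X} (h₁ : V₁ ≤ V) (h₂ : V₂ ≤ V) (hV : V ≤ V₁ ⊔ V₂)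
    {s t : P.obj (op V)} (hs₁ : res P h₁ s = res P h₁ t) (hs₂ : res P h₂ s = res P h₂ t) :
    s = t :=
  TopCat.Sheaf.eq_of_locally_eq₂ ⟨P, hP⟩ (homOfLE h₁) (homOfLE h₂) hV s t hs₁ hs₂

theorem exists_res_eq₂ {V V₁ V₂ : Opens X} (h₁ : V₁ ≤ V) (h₂ : V₂ ≤ V) (hV : V ≤ V₁ ⊔ V₂)
    (s₁ : P.obj (op V₁)) (s₂ : P.obj (op V₂))
    (h : res P (inf_le_left : V₁ ⊓ V₂ ≤ _) s₁ = res P inf_le_right s₂) :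
    ∃ t : P.obj (op V), res P h₁ t = s₁ ∧ res P h₂ t = s₂ := by
  obtain ⟨t, ht⟩ := exists_res_eq hP (U := fun b : Bool => cond b V₁ V₂) (V := V)
    (by rintro (_ | _) <;> assumption)
    (hV.trans (sup_le (le_iSup (fun b : Bool => cond b V₁ V₂) true)
      (le_iSup (fun b : Bool => cond b V₁ V₂) false)))
    (fun b => match b with
      | true => s₁
      | false => s₂) (by
    rintro (_ | _) (_ | _)
    · rfl
    · have h' := congrArg (res P (le_of_eq (inf_comm V₂ V₁))) h
      rw [res_res, res_res] at h'
      exact h'.symm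
    · exact h
    · rfl)
  exact ⟨t, ht true, ht false⟩

theorem eq_of_eq_bot {V : Opens X} (hV : V = ⊥) (s t : P.obj (op V)) : s = t :=
  eq_of_res_eq hP (U := fun i : PEmpty.{1} => i.elim) (fun i => i.elim) (by simp [hV])
    fun i => i.elim

end Res

/-! ### Injective sheaves -/

section Injective

variable {X : TopCat.{u}} (I : Sheaf (Opens.grothendieckTopology X) AddCommGrpCat.{u})

/-- Injective sheaves of abelian groups are flasque. -/
theorem res_surjective_of_injective [Injective I] {V W : Opens X} (h : W ≤ V) :
    Function.Surjective (res I.obj h) := by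
  -- A right adjoint preserves injectives when its left adjoint, here sheafification, preserves
  -- monomorphisms.
  have : Injective I.obj := Injective.injective_of_adjoint
    (sheafificationAdjunction (Opens.grothendieckTopology X) AddCommGrpCat.{u}) I
  -- Maps from the free presheaf Z V to I are sections of I over V, so extending a section from W to
  -- V means extending a map along the monomorphism Z W → Z V.
  let Z : Opens X ⥤ (Opens X)ᵒᵖ ⥤ AddCommGrpCat.{u} :=
    yoneda ⋙ (Functor.whiskeringRight _ _ _).obj AddCommGrpCat.free
  have : Mono (Z.map (homOfLE h)) := by
    have : ∀ U, Mono ((Z.map (homOfLE h)).app U) := fun U => by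
      have : Mono ((yoneda.map (homOfLE h)).app U) := by
        rw [mono_iff_injective]
        intro a b _
        exact Subsingleton.elim (α := (unop U ⟶ W)) a b
      exact inferInstanceAs (Mono (AddCommGrpCat.free.map ((yoneda.map (homOfLE h)).app U)))
    exact NatTrans.mono_of_mono_app _
  intro s
  let φ : Z.obj W ⟶ I.obj :=
    { app := fun U => AddCommGrpCat.ofHom
        (FreeAbelianGroup.lift fun f : unop U ⟶ W => res I.obj (leOfHom f) s)
      naturality := fun U U' f => by
        refine AddCommGrpCat.hom_ext (FreeAbelianGroup.lift_ext _ _ fun g => ?_)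
        change FreeAbelianGroup.lift _ (FreeAbelianGroup.map _ (FreeAbelianGroup.of g)) =
          I.obj.map f (FreeAbelianGroup.lift _ (FreeAbelianGroup.of g))
        rw [FreeAbelianGroup.map_of_apply, FreeAbelianGroup.lift_apply_of,
          FreeAbelianGroup.lift_apply_of]
        exact (res_res I.obj (leOfHom g) (leOfHom f.unop) s).symm }
  have hφ : φ.app (op W) (FreeAbelianGroup.of (𝟙 W)) = s := by
    change FreeAbelianGroup.lift _ _ = _
    rw [FreeAbelianGroup.lift_apply_of]
    exact res_self _ _ _
  let ψ := Injective.factorThru φ (Z.map (homOfLE h))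
  have hψ : Z.map (homOfLE h) ≫ ψ = φ := Injective.comp_factorThru _ _
  have hψ' : (Z.map (homOfLE h)).app (op W) (FreeAbelianGroup.of (𝟙 W)) =
      res (Z.obj V) h (FreeAbelianGroup.of (𝟙 V)) := by
    change FreeAbelianGroup.map _ (FreeAbelianGroup.of _) =
      FreeAbelianGroup.map _ (FreeAbelianGroup.of _)
    rw [FreeAbelianGroup.map_of_apply, FreeAbelianGroup.map_of_apply]
    rfl
  refine ⟨ψ.app (op V) (FreeAbelianGroup.of (𝟙 V)), ?_⟩
  refine (app_res ψ h _).symm.trans (Eq.trans ?_ hφ)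
  rw [← hψ', ← hψ]
  rfl

end Injective

/-! ### Vanishing of cohomology -/

/-- A class of basic open sets of `X` which is stable under finite intersections, together with a
class of splittings of basic open sets into two parts by which every local property of basic open
sets can be reached. -/
structure SplittingBasis (X : TopCat.{u}) where
  IsBasic : Opens X → Prop
  IsSplit : Opens X → Opens X → Opens X → Prop
  isBasic_top : IsBasic ⊤
  inf {V W : Opens X} : IsBasic V → IsBasic W → IsBasic (V ⊓ W)
  exists_isBasic_le {U : Opens X} {x : X} : x ∈ U → ∃ W, IsBasic W ∧ x ∈ W ∧ W ≤ U
  left {V V₁ V₂ : Opens X} : IsSplit V V₁ V₂ → IsBasic V₁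
  right {V V₁ V₂ : Opens X} : IsSplit V V₁ V₂ → IsBasic V₂
  sup_eq {V V₁ V₂ : Opens X} : IsSplit V V₁ V₂ → V₁ ⊔ V₂ = V
  split_inf {V V₁ V₂ W : Opens X} : IsSplit V V₁ V₂ → IsBasic W →
    IsSplit (V ⊓ W) (V₁ ⊓ W) (V₂ ⊓ W)
  induction {P : Opens X → Prop} : (∀ V V₁ V₂, IsSplit V V₁ V₂ → P V₁ → P V₂ → P V) →
    (∀ V W, P V → IsBasic W → W ≤ V → P W) → P ⊥ → ∀ {V : Opens X}, IsBasic V →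
    (∀ x ∈ V, ∃ W, IsBasic W ∧ x ∈ W ∧ P W) → P V

section Vanishing

variable {X : TopCat.{u}} (𝓑 : SplittingBasis X)

/-- Every section over the intersection of the two parts of a splitting is a sum of sections over
the parts. -/
def SplittingBasis.IsAcyclic (P : TopCat.Presheaf AddCommGrpCat.{u} X) : Prop :=
  ∀ V V₁ V₂, 𝓑.IsSplit V V₁ V₂ → ∀ s : P.obj (op (V₁ ⊓ V₂)),
    ∃ (s₁ : P.obj (op V₁)) (s₂ : P.obj (op V₂)), res P inf_le_left s₁ + res P inf_le_right s₂ = s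

variable {𝓑}

/-- Lifts exist locally. Two lifts on the parts of a splitting differ by a section of the kernel
sheaf over the intersection; writing it as a sum of sections over the parts allows the lifts to be
corrected and glued. -/
theorem SplittingBasis.IsAcyclic.app_surjective
    {C : ShortComplex (Sheaf (Opens.grothendieckTopology X) AddCommGrpCat.{u})}
    (hC : C.ShortExact) (h₁ : 𝓑.IsAcyclic C.X₁.obj) {V : Opens X} (hV : 𝓑.IsBasic V) :
    Function.Surjective (C.g.hom.app (op V)) := by
  intro s
  have hepi := (TopCat.Sheaf.isLocallySurjective_iff_epi C.g).mpr hC.epi_g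
  suffices ∃ t, C.g.hom.app (op (V ⊓ V)) t = res C.X₃.obj inf_le_right s by
    obtain ⟨t, ht⟩ := this
    refine ⟨res C.X₂.obj (le_inf le_rfl le_rfl) t, ?_⟩
    rw [app_res, ht, res_res, res_self]
  have hfg : ∀ {W : Opens X} (a : C.X₁.obj.obj (op W)),
      C.g.hom.app (op W) (C.f.hom.app (op W) a) = 0 := fun {W} a => by
    rw [← ConcreteCategory.comp_apply, ← NatTrans.comp_app,
      ← ObjectProperty.FullSubcategory.comp_hom, C.zero]
    rfl
  -- The property speaks of W ⊓ V, since s is defined only over V while the induction passes through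
  -- arbitrary W.
  refine 𝓑.induction
    (P := fun W => ∃ t, C.g.hom.app (op (W ⊓ V)) t = res C.X₃.obj inf_le_right s) ?_ ?_ ?_ hV ?_
  · rintro W V₁ V₂ hs ⟨t₁, ht₁⟩ ⟨t₂, ht₂⟩
    replace hs := 𝓑.split_inf hs hV
    have hW := 𝓑.sup_eq hs
    have hV₁ : V₁ ⊓ V ≤ W ⊓ V := hW ▸ le_sup_left
    have hV₂ : V₂ ⊓ V ≤ W ⊓ V := hW ▸ le_sup_right
    obtain ⟨a, ha⟩ := TopCat.Sheaf.sections_exact_of_left_exact hC.1 hC.2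
      (res C.X₂.obj (inf_le_left : (V₁ ⊓ V) ⊓ (V₂ ⊓ V) ≤ _) t₁ - res C.X₂.obj inf_le_right t₂) (by
        rw [map_sub, app_res, app_res, ht₁, ht₂, res_res, res_res, sub_self])
    obtain ⟨a₁, a₂, rfl⟩ := h₁ _ _ _ hs a
    rw [map_add, app_res, app_res] at ha
    obtain ⟨t, ht, ht'⟩ := exists_res_eq₂ C.X₂.property hV₁ hV₂ hW.ge
      (t₁ - C.f.hom.app _ a₁) (t₂ + C.f.hom.app _ a₂) (by
        rw [map_sub, map_add, sub_eq_iff_eq_add, add_assoc, add_comm (res _ _ _) (res _ _ _), ha,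
          add_sub_cancel])
    refine ⟨t, eq_of_res_eq₂ C.X₃.property hV₁ hV₂ hW.ge ?_ ?_⟩
    · rw [← app_res, ht, map_sub, hfg, sub_zero, ht₁, res_res]
    · rw [← app_res, ht', map_add, hfg, add_zero, ht₂, res_res]
  · rintro W W' ⟨t, ht⟩ _ hW'
    refine ⟨res C.X₂.obj (inf_le_inf_right V hW') t, ?_⟩
    rw [app_res, ht, res_res]
  · exact ⟨0, eq_of_eq_bot C.X₃.property (bot_inf_eq V) _ _⟩
  · intro x hx
    obtain ⟨W, hWV, ⟨t, ht⟩, hxW⟩ := (TopCat.Presheaf.isLocallySurjective_iff C.g.hom).mp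
      hepi V s x hx
    obtain ⟨Z, hZ, hxZ, hZW⟩ := 𝓑.exists_isBasic_le hxW
    refine ⟨Z, hZ, hxZ, res C.X₂.obj (inf_le_left.trans hZW) t, ?_⟩
    rw [app_res, ht]
    exact res_res _ hWV _ s

/-- A section of the quotient over the intersection lifts to the injective sheaf and extends to V₁
by flasqueness, so the second summand can be zero. -/
theorem SplittingBasis.IsAcyclic.of_shortExact
    {C : ShortComplex (Sheaf (Opens.grothendieckTopology X) AddCommGrpCat.{u})}
    (hC : C.ShortExact) (h₁ : 𝓑.IsAcyclic C.X₁.obj) [Injective C.X₂] :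
    𝓑.IsAcyclic C.X₃.obj := by
  intro V V₁ V₂ hs s
  obtain ⟨t, rfl⟩ := h₁.app_surjective hC (𝓑.inf (𝓑.left hs) (𝓑.right hs)) s
  obtain ⟨t, rfl⟩ := res_surjective_of_injective C.X₂ inf_le_left t
  exact ⟨C.g.hom.app _ t, 0, by rw [map_zero, add_zero, app_res]⟩

/-- Embed F in an injective sheaf. Classes in H¹(F) are boundaries of global sections of the
cokernel, which lift; higher classes come from the cokernel, which is again acyclic. -/
theorem SplittingBasis.IsAcyclic.subsingleton_H (n : ℕ) :
    ∀ {F : Sheaf (Opens.grothendieckTopology X) AddCommGrpCat.{u}}, 𝓑.IsAcyclic F.obj →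
      Subsingleton (Sheaf.H.{u} F (n + 1)) := by
  induction n with
  | zero =>
    intro F hF
    let C := ShortComplex.mk (Injective.ι F) (Limits.cokernel.π _) (Limits.cokernel.condition _)
    have hC : C.ShortExact := { exact := ShortComplex.exact_cokernel _ }
    refine subsingleton_of_forall_eq 0 fun x => ?_
    obtain ⟨y, rfl⟩ := Ext.covariant_sequence_exact₁ _ hC x (Ext.eq_zero_of_injective _) rfl
    let hT := Limits.isTerminalTop (α := Opens X)
    obtain ⟨t, ht⟩ := hF.app_surjective hC 𝓑.isBasic_top (Sheaf.H.equiv₀ C.X₃ hT y)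
    have hy : y = Sheaf.H.map C.g 0 ((Sheaf.H.equiv₀ C.X₂ hT).symm t) := by
      rw [Sheaf.H.equiv₀_symm_naturality]
      exact ((Sheaf.H.equiv₀ C.X₃ hT).symm_apply_eq.2 ht).symm
    rw [hy, Sheaf.H.map_apply, Ext.comp_assoc_of_second_deg_zero, hC.comp_extClass, Ext.comp_zero]
  | succ n ih =>
    intro F hF
    let C := ShortComplex.mk (Injective.ι F) (Limits.cokernel.π _) (Limits.cokernel.condition _)
    have hC : C.ShortExact := { exact := ShortComplex.exact_cokernel _ }
    have := ih (hF.of_shortExact hC)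
    refine subsingleton_of_forall_eq 0 fun x => ?_
    obtain ⟨y, rfl⟩ := Ext.covariant_sequence_exact₁ _ hC x (Ext.eq_zero_of_injective _) rfl
    rw [Subsingleton.elim y 0, Ext.zero_comp]

end Vanishing

end Readic

namespace Readic

open Opposite

/-! ### Čech cochains -/

section Cochains

variable {X : TopCat.{u}} {ι : Type u} (U : ι → Opens X)

/-- The intersection of finitely many members of a family of open sets. -/
noncomputable abbrev inter {n : ℕ} (s : Fin n → ι) : Opens X := ∏ᶜ (U ∘ s)

variable {U} in
theorem le_inter_iff {n : ℕ} {s : Fin n → ι} {V : Opens X} :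
    V ≤ inter U s ↔ ∀ a, V ≤ U (s a) :=
  ⟨fun h a => h.trans (leOfHom (Limits.Pi.π (U ∘ s) a)),
    fun h => leOfHom (Limits.Pi.lift fun a => homOfLE (h a))⟩

variable {U} in
theorem inter_le {n : ℕ} (s : Fin n → ι) (a : Fin n) : inter U s ≤ U (s a) :=
  le_inter_iff.1 le_rfl a

theorem inter_le_inter_comp {n m : ℕ} (s : Fin n → ι) (t : Fin m → Fin n) :
    inter U s ≤ inter U (s ∘ t) := le_inter_iff.2 fun a => inter_le s (t a)

variable (P : TopCat.Presheaf AddCommGrpCat.{u} X)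

/-- The Čech cochains on the open set `V`, including the sections over `V` in degree zero. -/
abbrev Cochain (n : ℕ) (V : Opens X) : Type u := ∀ s : Fin n → ι, P.obj (op (V ⊓ inter U s))

namespace Cochain

variable {U P} {n : ℕ}

/-- The restriction of Čech cochains. -/
noncomputable def res {V W : Opens X} (h : W ≤ V) : Cochain U P n V →+ Cochain U P n W where
  toFun c s := Readic.res P (inf_le_inf_right _ h) (c s)
  map_zero' := funext fun _ => map_zero _
  map_add' _ _ := funext fun _ => map_add _ _ _

/-- The differential of Čech cochains. -/
noncomputable def d {V : Opens X} : Cochain U P n V →+ Cochain U P (n + 1) V where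
  toFun c s := ∑ k : Fin (n + 1), (-1 : ℤ) ^ (k : ℕ) •
    Readic.res P (inf_le_inf_left V (inter_le_inter_comp U s k.succAbove)) (c (s ∘ k.succAbove))
  map_zero' := funext fun s => by simp
  map_add' c c' := funext fun s => by simp [Finset.sum_add_distrib]

theorem d_apply {V : Opens X} (c : Cochain U P n V) (s : Fin (n + 1) → ι) :
    d c s = ∑ k : Fin (n + 1), (-1 : ℤ) ^ (k : ℕ) • Readic.res P
      (inf_le_inf_left V (inter_le_inter_comp U s k.succAbove)) (c (s ∘ k.succAbove)) := rfl

theorem res_d {V W : Opens X} (h : W ≤ V) (c : Cochain U P n V) : res h (d c) = d (res h c) := by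
  funext s
  change Readic.res P _ (d c s) = _
  rw [d_apply, d_apply, map_sum]
  refine Finset.sum_congr rfl fun k _ => ?_
  rw [map_zsmul]
  congr 1
  exact (res_res _ _ _ _).trans (res_res _ _ _ _).symm

theorem d_d {V : Opens X} (c : Cochain U P n V) : d (d c) = 0 := by
  funext s
  let h : (Fin n → Fin (n + 2)) → P.obj (op (V ⊓ inter U s)) := fun t =>
    Readic.res P (inf_le_inf_left V (inter_le_inter_comp U s t)) (c (s ∘ t))
  have key : d (d c) s = ∑ p : Fin (n + 2) × Fin (n + 1),
      (-1 : ℤ) ^ (p.1 + p.2 : ℕ) • h (p.1.succAbove ∘ p.2.succAbove) := by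
    rw [Fintype.sum_prod_type, d_apply]
    refine Finset.sum_congr rfl fun k _ => ?_
    rw [d_apply, map_sum, Finset.smul_sum]
    refine Finset.sum_congr rfl fun j _ => ?_
    rw [map_zsmul, smul_smul, pow_add]
    congr 1
    exact res_res _ _ _ _
  rw [key]
  -- Deleting two entries in either order gives the same tuple with opposite signs; this involution
  -- pairs the terms.
  refine Finset.sum_ninvolution (fun p => (p.1.succAbove p.2, p.2.predAbove p.1)) ?_ ?_
    (fun _ => Finset.mem_univ _) ?_
  · rintro ⟨i, j⟩
    have h1 : (i.succAbove j).succAbove ∘ (j.predAbove i).succAbove =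
        i.succAbove ∘ j.succAbove :=
      funext fun k => Fin.succAbove_succAbove_succAbove_predAbove i j k
    simp only [h1, Fin.neg_one_pow_succAbove_add_predAbove, neg_smul, add_neg_cancel]
  · rintro ⟨i, j⟩ - h
    exact Fin.succAbove_ne i j (congrArg Prod.fst h)
  · rintro ⟨i, j⟩
    rw [Fin.succAbove_succAbove_predAbove, Fin.predAbove_predAbove_succAbove]

theorem apply_congr {V W : Opens X} (c : Cochain U P n V) {s t : Fin n → ι} (h : s = t)
    (hs : W ≤ V ⊓ inter U s) (ht : W ≤ V ⊓ inter U t) :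
    Readic.res P hs (c s) = Readic.res P ht (c t) := by
  subst h
  rfl

variable (U P) in
/-- The augmented Čech complex on `V` is exact. -/
def Exact (V : Opens X) : Prop :=
  (∀ c : Cochain U P 0 V, d c = 0 → c = 0) ∧
    ∀ n, ∀ c : Cochain U P (n + 1) V, d c = 0 → ∃ b, d b = c

/-- The augmented Čech complex is exact on the open subsets of a member of the covering. -/
theorem exact_of_le {V : Opens X} {i : ι} (h : V ≤ U i) : Exact U P V := by
  have hcons : ∀ {n} (s : Fin n → ι),
      V ⊓ inter U s ≤ V ⊓ inter U (Fin.cons i s : Fin (n + 1) → ι) :=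
    fun s => le_inf inf_le_left (le_inter_iff.2 (Fin.cases (inf_le_left.trans h)
      fun a => inf_le_right.trans (inter_le s a)))
  -- Prepending the index i is a contracting homotopy, available because intersecting with U i does
  -- not change subsets of V.
  let η : ∀ {n}, Cochain U P (n + 1) V → Cochain U P n V := fun c s =>
    Readic.res P (hcons s) (c (Fin.cons i s))
  have key₀ : ∀ {n} (c : Cochain U P n V) (s : Fin n → ι), η (d c) s = c s +
      ∑ j : Fin n, (-1 : ℤ) ^ ((j : ℕ) + 1) • Readic.res P
        ((hcons s).trans (inf_le_inf_left V (inter_le_inter_comp U _ j.succ.succAbove)))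
        (c ((Fin.cons i s : Fin (n + 1) → ι) ∘ j.succ.succAbove)) := by
    intro n c s
    change Readic.res P _ (d c _) = _
    rw [d_apply, Fin.sum_univ_succ, map_add, map_sum]
    congr 1
    · rw [Fin.val_zero, pow_zero, one_smul, res_res]
      exact (apply_congr c (by funext a; simp) _ le_rfl).trans (res_self _ _ _)
    · refine Finset.sum_congr rfl fun j _ => ?_
      rw [map_zsmul, res_res, Fin.val_succ]
  refine ⟨fun c hc => funext fun s => ?_, fun n c hc => ⟨η c, funext fun s => ?_⟩⟩
  · have := key₀ c s
    rw [Finset.univ_eq_empty, Finset.sum_empty, add_zero, hc] at this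
    rw [← this]
    exact map_zero _
  · have := key₀ c s
    rw [hc] at this
    have h0 : η (0 : Cochain U P (n + 2) V) s = 0 := map_zero _
    rw [h0] at this
    rw [eq_comm, add_eq_zero_iff_eq_neg] at this
    rw [this, d_apply, ← Finset.sum_neg_distrib]
    refine Finset.sum_congr rfl fun j _ => ?_
    rw [pow_succ, mul_neg, mul_one, neg_smul, neg_neg]
    congr 1
    refine (res_res _ _ _ _).trans (apply_congr c ?_ _ _)
    funext a
    refine Fin.cases ?_ (fun a => ?_) a
    · simp
    · simp [Fin.succ_succAbove_succ]

section Sheaf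

variable (hP : TopCat.Presheaf.IsSheaf P)
include hP

theorem exact_bot : Exact U P ⊥ := by
  have : ∀ {n} (c c' : Cochain U P n ⊥), c = c' := fun c c' =>
    funext fun s => eq_of_eq_bot hP (bot_inf_eq _) _ _
  exact ⟨fun c _ => this _ _, fun n c _ => ⟨0, this _ _⟩⟩

variable {V V₁ V₂ : Opens X} (hV : V₁ ⊔ V₂ = V)
include hV

theorem eq_of_res_eq {c c' : Cochain U P n V}
    (h₁ : res (hV ▸ le_sup_left) c = res (W := V₁) (hV ▸ le_sup_left) c')
    (h₂ : res (hV ▸ le_sup_right) c = res (W := V₂) (hV ▸ le_sup_right) c') : c = c' := by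
  subst hV
  exact funext fun s => eq_of_res_eq₂ hP (inf_le_inf_right _ le_sup_left)
    (inf_le_inf_right _ le_sup_right) (inf_sup_right _ _ _).le (congrFun h₁ s) (congrFun h₂ s)

theorem exists_res_eq (c₁ : Cochain U P n V₁) (c₂ : Cochain U P n V₂)
    (h : res (inf_le_left : V₁ ⊓ V₂ ≤ V₁) c₁ = res inf_le_right c₂) :
    ∃ c : Cochain U P n V, res (hV ▸ le_sup_left) c = c₁ ∧ res (hV ▸ le_sup_right) c = c₂ := by
  subst hV
  have : ∀ s, ∃ c : P.obj (op ((V₁ ⊔ V₂) ⊓ inter U s)),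
      Readic.res P (inf_le_inf_right _ le_sup_left) c = c₁ s ∧
      Readic.res P (inf_le_inf_right _ le_sup_right) c = c₂ s := by
    intro s
    refine exists_res_eq₂ hP _ _ (inf_sup_right _ _ _).le _ _ ?_
    have h' := congrArg (Readic.res P (inf_inf_distrib_right V₁ V₂ (inter U s)).ge) (congrFun h s)
    exact ((res_res _ _ _ _).symm.trans h').trans (res_res _ _ _ _)
  choose c hc₁ hc₂ using this
  exact ⟨c, funext hc₁, funext hc₂⟩

end Sheaf

variable {𝓑 : SplittingBasis X}

theorem isBasic_inter (hU : ∀ i, 𝓑.IsBasic (U i)) (s : Fin n → ι) : 𝓑.IsBasic (inter U s) := by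
  have : inter U s = Finset.univ.inf (U ∘ s) :=
    le_antisymm (Finset.le_inf fun a _ => inter_le s a)
      (le_inter_iff.2 fun a => Finset.inf_le (Finset.mem_univ a))
  rw [this]
  exact Finset.inf_induction 𝓑.isBasic_top (fun _ h _ h' => 𝓑.inf h h') fun a _ => hU _

variable (hU : ∀ i, 𝓑.IsBasic (U i)) (hA : 𝓑.IsAcyclic P)
include hU hA

theorem exists_res_add {V V₁ V₂ : Opens X} (hs : 𝓑.IsSplit V V₁ V₂)
    (c : Cochain U P n (V₁ ⊓ V₂)) : ∃ (c₁ : Cochain U P n V₁) (c₂ : Cochain U P n V₂),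
      res inf_le_left c₁ + res inf_le_right c₂ = c := by
  have : ∀ s, ∃ (c₁ : P.obj (op (V₁ ⊓ inter U s))) (c₂ : P.obj (op (V₂ ⊓ inter U s))),
      Readic.res P (inf_le_inf_right _ inf_le_left) c₁ +
        Readic.res P (inf_le_inf_right _ inf_le_right) c₂ = c s := by
    intro s
    obtain ⟨c₁, c₂, h⟩ := hA _ _ _ (𝓑.split_inf hs (isBasic_inter hU s))
      (Readic.res P (inf_inf_distrib_right V₁ V₂ (inter U s)).ge (c s))
    refine ⟨c₁, c₂, ?_⟩
    have h' := congrArg (Readic.res P (inf_inf_distrib_right V₁ V₂ (inter U s)).le) h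
    rw [map_add, res_res, res_res, res_res, res_self] at h'
    exact h'
  choose c₁ c₂ h using this
  exact ⟨c₁, c₂, funext h⟩

variable (hP : TopCat.Presheaf.IsSheaf P)
include hP

/-- This is Mayer–Vietoris: by the sheaf property and acyclicity, cochains on V, on V₁ and V₂
together, and on V₁ ⊓ V₂ form a short exact sequence of complexes. -/
theorem exact_of_isSplit {V V₁ V₂ : Opens X} (hs : 𝓑.IsSplit V V₁ V₂) (h₁ : Exact U P V₁)
    (h₂ : Exact U P V₂) (h₁₂ : Exact U P (V₁ ⊓ V₂)) : Exact U P V := by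
  have hV := 𝓑.sup_eq hs
  have hV₁ : V₁ ≤ V := hV ▸ le_sup_left
  have hV₂ : V₂ ≤ V := hV ▸ le_sup_right
  refine ⟨fun c hc => eq_of_res_eq hP hV ?_ ?_, fun n c hc => ?_⟩
  · rw [map_zero]
    exact h₁.1 _ (by rw [← res_d, hc, map_zero])
  · rw [map_zero]
    exact h₂.1 _ (by rw [← res_d, hc, map_zero])
  obtain ⟨b₁, hb₁⟩ := h₁.2 n (res hV₁ c) (by rw [← res_d, hc, map_zero])
  obtain ⟨b₂, hb₂⟩ := h₂.2 n (res hV₂ c) (by rw [← res_d, hc, map_zero])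
  have hres : res (inf_le_left : V₁ ⊓ V₂ ≤ V₁) (res hV₁ c) = res inf_le_right (res hV₂ c) :=
    funext fun s => (res_res _ _ _ _).trans (res_res _ _ _ _).symm
  have hd : d (res (inf_le_left : V₁ ⊓ V₂ ≤ V₁) b₁ - res inf_le_right b₂) = 0 := by
    rw [map_sub, ← res_d, ← res_d, hb₁, hb₂, hres, sub_self]
  -- The primitives b₁ and b₂ glue after being changed by cocycles that account for their difference
  -- on the intersection.
  suffices ∃ (a₁ : Cochain U P n V₁) (a₂ : Cochain U P n V₂), d a₁ = 0 ∧ d a₂ = 0 ∧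
      res (inf_le_left : V₁ ⊓ V₂ ≤ V₁) b₁ - res inf_le_right b₂ =
        res inf_le_left a₁ + res inf_le_right a₂ by
    obtain ⟨a₁, a₂, ha₁, ha₂, ha⟩ := this
    obtain ⟨b, hb, hb'⟩ := exists_res_eq hP hV (b₁ - a₁) (b₂ + a₂) (by
      rw [map_sub, map_add, sub_eq_iff_eq_add, add_assoc, add_comm (res _ _) (res _ _), ← ha,
        add_sub_cancel])
    refine ⟨b, eq_of_res_eq hP hV ?_ ?_⟩
    · rw [res_d, hb, map_sub, ha₁, sub_zero, hb₁]
    · rw [res_d, hb', map_add, ha₂, add_zero, hb₂]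
  cases n with
  -- In degree zero a cocycle vanishes, so the primitives already agree; in higher degrees the
  -- difference is d e, and e is split into two parts.
  | zero => exact ⟨0, 0, map_zero _, map_zero _, by rw [h₁₂.1 _ hd, map_zero, map_zero, add_zero]⟩
  | succ n =>
    obtain ⟨e, he⟩ := h₁₂.2 n _ hd
    obtain ⟨e₁, e₂, rfl⟩ := exists_res_add hU hA hs e
    exact ⟨d e₁, d e₂, d_d _, d_d _, by rw [← he, map_add, res_d, res_d]⟩

/-- Exactness is not visibly hereditary, so the induction proves it for all basic W ≤ V at once;
this also covers V₁ ⊓ V₂. -/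
theorem exact_of_isBasic (hcov : ∀ x, ∃ i, x ∈ U i) {V : Opens X} (hV : 𝓑.IsBasic V) :
    Exact U P V := by
  suffices ∀ W, 𝓑.IsBasic W → W ≤ V → Exact U P W from this V hV le_rfl
  refine 𝓑.induction (P := fun V => ∀ W, 𝓑.IsBasic W → W ≤ V → Exact U P W) ?_ ?_ ?_ hV ?_
  · intro V V₁ V₂ hs h₁ h₂ W hW hWV
    have hs' := 𝓑.split_inf hs hW
    rw [inf_eq_right.2 hWV] at hs'
    exact exact_of_isSplit hU hA hP hs' (h₁ _ (𝓑.left hs') inf_le_left)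
      (h₂ _ (𝓑.right hs') inf_le_left)
      (h₁ _ (𝓑.inf (𝓑.left hs') (𝓑.right hs')) (inf_le_left.trans inf_le_left))
  · intro V W h _ hWV Z hZ hZW
    exact h Z hZ (hZW.trans hWV)
  · intro W _ hW
    rw [le_bot_iff.1 hW]
    exact exact_bot hP
  · intro x _
    obtain ⟨i, hi⟩ := hcov x
    exact ⟨U i, hU i, hi, fun W _ hW => exact_of_le hW⟩

end Cochain

end Cochains

end Readic

namespace Readic

open Opposite

/-! ### Čech cohomology -/

section CechComplex

variable {X : TopCat.{u}} (P : TopCat.Presheaf AddCommGrpCat.{u} X) {ι : Type u} (U : ι → Opens X)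

/-- The components of Čech cochains. -/
noncomputable def coord {n : ℕ} (s : Fin (n + 1) → ι) :
    (cechComplex P U).X n ⟶ P.obj (op (inter U s)) :=
  Limits.Pi.π (fun s : Fin (n + 1) → ι => P.obj (op (inter U s))) s

theorem alternatingCofaceMapComplex_d_apply (Y : CosimplicialObject AddCommGrpCat.{u}) (n : ℕ)
    (z : Y.obj (SimplexCategory.mk n)) :
    ((AlgebraicTopology.alternatingCofaceMapComplex AddCommGrpCat.{u}).obj Y).d n (n + 1) z =
      ∑ k : Fin (n + 2), (-1 : ℤ) ^ (k : ℕ) • Y.δ k z := by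
  have h : ((AlgebraicTopology.alternatingCofaceMapComplex AddCommGrpCat.{u}).obj Y).d n (n + 1) =
      ∑ k : Fin (n + 2), (-1 : ℤ) ^ (k : ℕ) • Y.δ k :=
    CochainComplex.of_d (fun n => Y.obj (SimplexCategory.mk n))
      (AlgebraicTopology.AlternatingCofaceMapComplex.objD Y) n
  let E : (Y.obj (SimplexCategory.mk n) ⟶ Y.obj (SimplexCategory.mk (n + 1))) →+
      Y.obj (SimplexCategory.mk (n + 1)) :=
    { toFun := fun f => f z
      map_zero' := rfl
      map_add' := fun _ _ => rfl }
  exact (congrArg E h).trans (map_sum E _ _)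

theorem coord_d {n : ℕ} (s : Fin (n + 2) → ι) (z : (cechComplex P U).X n) :
    coord P U s ((cechComplex P U).d n (n + 1) z) = ∑ k : Fin (n + 2), (-1 : ℤ) ^ (k : ℕ) •
      res P (inter_le_inter_comp U s k.succAbove) (coord P U (s ∘ k.succAbove) z) := by
  refine (congrArg (coord P U s) (alternatingCofaceMapComplex_d_apply _ n z)).trans ?_
  refine (map_sum (coord P U s).hom _ _).trans (Finset.sum_congr rfl fun k _ => ?_)
  refine (map_zsmul (coord P U s).hom _ _).trans ?_
  congr 1
  exact ConcreteCategory.congr_hom (Limits.Pi.lift_π _ _) z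

variable {P U}

theorem coord_ext {n : ℕ} {z z' : (cechComplex P U).X n}
    (h : ∀ s, coord P U s z = coord P U s z') : z = z' :=
  (Limits.Concrete.productEquiv fun s : Fin (n + 1) → ι => P.obj (op (inter U s))).injective
    (funext fun s => (Limits.Concrete.productEquiv_apply_apply _ _ _).trans
      ((h s).trans (Limits.Concrete.productEquiv_apply_apply _ _ _).symm))

theorem exists_coord_eq {n : ℕ} (c : ∀ s : Fin (n + 1) → ι, P.obj (op (inter U s))) :
    ∃ z : (cechComplex P U).X n, ∀ s, coord P U s z = c s :=
  ⟨_, Limits.Concrete.productEquiv_symm_apply_π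
    (fun s : Fin (n + 1) → ι => P.obj (op (inter U s))) c⟩

theorem coord_cechAugmentation (s : Fin 1 → ι) (a : P.obj (op ⊤)) :
    coord P U s (cechAugmentation P U a) = res P le_top a := by
  have : cechAugmentation P U ≫ coord P U s = P.map (homOfLE le_top).op := Limits.Pi.lift_π _ _
  rw [← ConcreteCategory.comp_apply, this]
  rfl

/-- The Čech cochain on `⊤` with the same components. -/
noncomputable def toCochain {n : ℕ} (z : (cechComplex P U).X n) : Cochain U P (n + 1) ⊤ := fun s =>
  res P inf_le_right (coord P U s z)

theorem toCochain_zero {n : ℕ} : toCochain (0 : (cechComplex P U).X n) = 0 :=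
  funext fun s => by rw [toCochain, map_zero, map_zero]; rfl

theorem toCochain_injective {n : ℕ} {z z' : (cechComplex P U).X n}
    (h : toCochain z = toCochain z') : z = z' := by
  refine coord_ext fun s => ?_
  have := congrArg (res P (le_inf le_top le_rfl)) (congrFun h s)
  simp only [toCochain, res_res, res_self] at this
  exact this

theorem toCochain_surjective {n : ℕ} (c : Cochain U P (n + 1) ⊤) :
    ∃ z : (cechComplex P U).X n, toCochain z = c := by
  obtain ⟨z, hz⟩ := exists_coord_eq fun s => res P (le_inf le_top le_rfl) (c s)
  refine ⟨z, funext fun s => ?_⟩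
  rw [toCochain, hz, res_res, res_self]

theorem toCochain_d {n : ℕ} (z : (cechComplex P U).X n) :
    toCochain ((cechComplex P U).d n (n + 1) z) = Cochain.d (toCochain z) := by
  funext s
  rw [toCochain, coord_d, map_sum, Cochain.d_apply]
  refine Finset.sum_congr rfl fun k _ => ?_
  rw [map_zsmul, toCochain, res_res, res_res]

/-- `Cochain` is shifted by one against the Čech complex, and its degree zero consists of sections
indexed by the empty tuple; hence the augmentation is its first differential. -/
theorem toCochain_cechAugmentation (b : Cochain U P 0 ⊤) (h : ⊤ ≤ ⊤ ⊓ inter U Fin.elim0) :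
    toCochain (cechAugmentation P U (res P h (b Fin.elim0))) = Cochain.d b := by
  funext s
  rw [toCochain, coord_cechAugmentation, Cochain.d_apply, Fin.sum_univ_one]
  rw [Fin.val_zero, pow_zero, one_smul, res_res, res_res]
  exact Cochain.apply_congr b (Subsingleton.elim _ _) _ _

variable (he : Cochain.Exact U P ⊤)
include he

theorem subsingleton_cechCohomology (n : ℕ) : Subsingleton (cechCohomology P U (n + 1)) := by
  refine AddCommGrpCat.subsingleton_of_isZero ?_
  rw [cechCohomology, ← HomologicalComplex.exactAt_iff_isZero_homology,
    HomologicalComplex.exactAt_iff' _ n (n + 1) (n + 2) (by simp) (by simp),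
    ShortComplex.ab_exact_iff]
  intro (z : (cechComplex P U).X (n + 1)) (hz : (cechComplex P U).d (n + 1) (n + 2) z = 0)
  obtain ⟨b, hb⟩ := he.2 (n + 1) (toCochain z) (by
    rw [← toCochain_d, hz, toCochain_zero])
  obtain ⟨y, rfl⟩ := toCochain_surjective b
  exact ⟨y, toCochain_injective ((toCochain_d y).trans hb)⟩

theorem exists_equiv_cechCohomology_zero : ∃ e : P.obj (op ⊤) ≃+ cechCohomology P U 0,
    ∀ a, IsCechClassOf P U a (e a) := by
  have htop : (⊤ : Opens X) ≤ ⊤ ⊓ inter U Fin.elim0 :=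
    le_inf le_rfl (le_inter_iff.2 fun a => a.elim0)
  have key : ∀ a : P.obj (op ⊤), ∃ b : Cochain U P 0 ⊤, res P htop (b Fin.elim0) = a :=
    fun a => ⟨fun s => res P inf_le_left a, by rw [res_res, res_self]⟩
  have hd : cechAugmentation P U ≫ (cechComplex P U).d 0 1 = 0 := by
    refine ConcreteCategory.hom_ext _ _ fun a => ?_
    obtain ⟨b, rfl⟩ := key a
    refine toCochain_injective ((toCochain_d (cechAugmentation P U _)).trans ?_)
    rw [toCochain_cechAugmentation, Cochain.d_d]
    exact toCochain_zero.symm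
  let K := cechComplex P U
  let φ : P.obj (op ⊤) ⟶ K.cycles 0 := K.liftCycles (cechAugmentation P U) 1 (by simp) hd
  have hφ : ∀ a, K.iCycles 0 (φ a) = cechAugmentation P U a := fun a => by
    rw [← ConcreteCategory.comp_apply, HomologicalComplex.liftCycles_i]
  have hi : Function.Injective (K.iCycles 0) :=
    (AddCommGrpCat.mono_iff_injective _).1 inferInstance
  -- Injectivity is exactness of the augmented complex at the sections over ⊤, surjectivity is
  -- exactness one step further; degree-zero homology equals the cycles.
  have hbij : Function.Bijective (φ ≫ K.homologyπ 0) := by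
    change Function.Bijective (K.homologyπ 0 ∘ φ)
    refine (ConcreteCategory.bijective_of_isIso (K.homologyπ 0)).comp ⟨?_, fun z => ?_⟩
    · rw [injective_iff_map_eq_zero]
      intro a ha
      obtain ⟨b, rfl⟩ := key a
      have hb : Cochain.d b = 0 := by
        rw [← toCochain_cechAugmentation b htop, ← hφ, ha, map_zero]
        exact toCochain_zero
      rw [he.1 b hb]
      exact map_zero _
    · have hz : K.d 0 1 (K.iCycles 0 z) = 0 := by
        rw [← ConcreteCategory.comp_apply, HomologicalComplex.iCycles_d]
        rfl
      obtain ⟨b, hb⟩ := he.2 0 (toCochain (K.iCycles 0 z)) (by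
        rw [← toCochain_d]
        exact (congrArg toCochain hz).trans toCochain_zero)
      refine ⟨res P htop (b Fin.elim0), hi ?_⟩
      rw [hφ]
      exact toCochain_injective ((toCochain_cechAugmentation b htop).trans hb)
  exact ⟨AddEquiv.ofBijective (φ ≫ K.homologyπ 0).hom hbij, fun a => ⟨φ a, hφ a, rfl⟩⟩

end CechComplex

/-! ### The cohomology of the structure sheaf -/

section StructureSheaf

variable {A : Type u} [NormedCommRing A] [IsUltrametricDist A] (S : Subring (Gr A))

/-- The splitting basis of rational subspaces of `Spra (A, S)`. -/
def rationalBasis : SplittingBasis (TopCat.of (Spra S)) where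
  IsBasic V := IsRational S (V : Set (Spra S))
  IsSplit V V₁ V₂ := IsSplit S (V : Set (Spra S)) V₁ V₂
  isBasic_top := isRational_univ
  inf := IsRational.inter
  exists_isBasic_le {U x} hx := by
    obtain ⟨W, hW, hxW, hWU⟩ := exists_isRational_subset U.isOpen hx
    exact ⟨⟨W, hW.isOpen⟩, hW, hxW, hWU⟩
  left := IsSplit.isRational_left
  right := IsSplit.isRational_right
  sup_eq h := Opens.ext h.union_eq
  split_inf h hW := h.inter hW
  induction {P} hsplit hmono hempty V hV hloc := by
    -- Openness is made part of the property so that the principle for sets of points applies to a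
    -- property of open sets.
    let P' : Set (Spra S) → Prop := fun W => ∃ h : IsOpen W, P ⟨W, h⟩
    have : P' V := by
      refine of_isSplit_of_local (P := P') ?_ ?_ ⟨isOpen_empty, hempty⟩ hV fun x hx => ?_
      · rintro W W₁ W₂ hW ⟨h₁, hP₁⟩ ⟨h₂, hP₂⟩
        exact ⟨hW.1.isOpen, hsplit ⟨W, hW.1.isOpen⟩ ⟨W₁, h₁⟩ ⟨W₂, h₂⟩ hW hP₁ hP₂⟩
      · rintro W Z ⟨h, hP⟩ hZ hZW
        exact ⟨hZ.isOpen, hmono ⟨W, h⟩ ⟨Z, hZ.isOpen⟩ hP hZ hZW⟩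
      · obtain ⟨W, hW, hxW, hPW⟩ := hloc x hx
        exact ⟨W, hW, hxW, W.isOpen, hPW⟩
    exact this.2

theorem isAcyclic_structurePresheafAb : (rationalBasis S).IsAcyclic (structurePresheafAb S) :=
  fun _ _ _ h s => h.exists_restrict_add s

end StructureSheaf

end Readic

/-! ### The acyclicity theorem -/

theorem theoremT {A : Type u} [NormedCommRing A] [IsUltrametricDist A] [CompleteSpace A]
    (S : Subring (Readic.Gr A)) (hS : Readic.IsAffinoid S) (hsheafy : Readic.IsSheafy S)
    {ι : Type u} [Finite ι] (U : ι → Opens (TopCat.of (Readic.Spra S)))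
    (hU : ∀ i, Readic.IsRational S (U i : Set (Readic.Spra S))) (hcov : ∀ x, ∃ i, x ∈ U i) :
    (Function.Bijective (Readic.toCohomologyZero S hsheafy) ∧
      ∀ i : ℕ, 0 < i → Subsingleton (Readic.cohomology S hsheafy i)) ∧
    ((∃ e : A ≃+ Readic.cechCohomology (Readic.structurePresheafAb S) U 0, ∀ a : A,
        Readic.IsCechClassOf (Readic.structurePresheafAb S) U (Readic.toGlobal S a) (e a)) ∧
      ∀ i : ℕ, 0 < i →
        Subsingleton (Readic.cechCohomology (Readic.structurePresheafAb S) U i)) := by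
  have hA := Readic.isAcyclic_structurePresheafAb S
  have he : Readic.Cochain.Exact U (Readic.structurePresheafAb S) ⊤ :=
    Readic.Cochain.exact_of_isBasic (𝓑 := Readic.rationalBasis S) hU hA
      (Readic.structureSheaf S hsheafy).property hcov (Readic.rationalBasis S).isBasic_top
  refine ⟨⟨?_, fun i hi => ?_⟩, ?_, fun i hi => ?_⟩
  · exact (Sheaf.H.equiv₀ (Readic.structureSheaf S hsheafy)
      (Limits.isTerminalTop (α := Opens (TopCat.of (Readic.Spra S))))).symm.bijective.comp
        (Readic.toGlobal_bijective S)
  · obtain ⟨n, rfl⟩ := Nat.exists_eq_add_one.2 hi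
    exact Readic.SplittingBasis.IsAcyclic.subsingleton_H n
      (F := Readic.structureSheaf S hsheafy) hA
  · obtain ⟨e, h⟩ := Readic.exists_equiv_cechCohomology_zero he
    exact ⟨(AddEquiv.ofBijective (Readic.toGlobal S).toAddMonoidHom
      (Readic.toGlobal_bijective S)).trans e, fun a => h _⟩
  · obtain ⟨n, rfl⟩ := Nat.exists_eq_add_one.2 hi
    exact Readic.subsingleton_cechCohomology he n
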